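/- Conventions. A tournament $T$ is a finite vertex set $V(T)$ with a set $A(T)$ of ordered pairs of distinct vertices (arcs) such that for all $x\neq y$ in $V(T)$ exactly one of $(x,y),(y,x)$ is an arc. Its dual is obtained by reversing all arcs. A module of $T$ is a set $M\subseteq V(T)$ such that for all $x,y\in M$ and $v\in V(T)\setminus M$, $(v,x)\in A(T)$ if and only if $(v,y)\in A(T)$; $T$ is indecomposable if its only modules are $\varnothing$, the singletons and $V(T)$. For a tournament $T$ with at least five vertices, $\delta(T)$ is the least number of arcs of $T$ whose reversal makes $T$ indecomposable; for $m\ge 5$, $\delta(m)$ is the maximum of $\delta(U)$ over all $m$-vertex tournaments $U$; and $T$ has $\delta$-maximal decomposability if $\delta(T)=\delta(|V(T)|)$. Let $\underline{k}$ be the transitive tournament on $\{0,\dots,k-1\}$ with arcs $(i,j)$ for $i<j$, and let $C_3$ be the tournament on $\{0,1,2\}$ with arcs $(0,1),(1,2),(2,0)$. For a tournament $S$ on $\{0,\dots,k-1\}$ and tournaments $H_0,\dots,H_{k-1}$, the lexicographic sum $S(H_0,\dots,H_{k-1})$ is the tournament on the disjoint union of the $V(H_i)$ in which, for $x\in V(H_i)$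 and $y\in V(H_j)$, $(x,y)$ is an arc if and only if either $i=j$ and $(x,y)\in A(H_i)$, or $i\ne j$ and $(i,j)\in A(S)$. Write $S.H=S(H,\dots,H)$. Theorem. Let $n\ge 1$. A tournament $T$ with $4n+1$ vertices has $\delta$-maximal decomposability if and only if it is isomorphic to a tournament of one of the following forms, where $T_k$ denotes an arbitrary tournament on the vertex set $\{0,\dots,k-1\}$: F1. $\underline{2}(\underline{1},T_{2n}.\underline{2})$ or its dual; F2. $\underline{3}(\underline{1},T_{2n}(\underline{1},\underline{2},\dots,\underline{2}),\underline{1})$; F3. $\underline{3}(\underline{1},T_{2n-1}(C_3,\underline{2},\dots,\underline{2}),\underline{1})$. -/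

import Mathlib

universe u v w

/-- A tournament: a finite set `V` of vertices with a set of arcs, i.e. ordered pairs of distinct
vertices, such that for all `x ≠ y` exactly one of `(x, y)`, `(y, x)` is an arc.
`T.Arc x y` says that `(x, y)` is an arc of `T`. -/
structure Tournament : Type (u + 1) where
  V : Type u
  finite : Finite V
  Arc : V → V → Prop
  irrefl : ∀ x, ¬ Arc x x
  arc_iff : ∀ x y, x ≠ y → (Arc x y ↔ ¬ Arc y x)

namespace Tournament

attribute [instance] Tournament.finite

/-- The number of vertices of `T`. -/
noncomputable def card (T : Tournament.{u}) : ℕ := Nat.card T.V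

/-- Two tournaments are isomorphic if there is an arc-preserving and arc-reflecting bijection
between their vertex sets. -/
def Iso (T : Tournament.{u}) (U : Tournament.{v}) : Prop := Nonempty (T.Arc ≃r U.Arc)

/-- The dual tournament, obtained by reversing all arcs. -/
def dual (T : Tournament.{u}) : Tournament.{u} where
  V := T.V
  finite := T.finite
  Arc x y := T.Arc y x
  irrefl := T.irrefl
  arc_iff x y h := T.arc_iff y x h.symm

/-- A module of `T`: a set `M` of vertices which no vertex outside `M` distinguishes. -/
def IsModule (T : Tournament.{u}) (M : Set T.V) : Prop :=
  ∀ x ∈ M, ∀ y ∈ M, ∀ z, z ∉ M → (T.Arc z x ↔ T.Arc z y)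

/-- A tournament is indecomposable if all its modules are trivial. -/
def Indecomposable (T : Tournament.{u}) : Prop :=
  ∀ M : Set T.V, T.IsModule M → M = ∅ ∨ (∃ x, M = {x}) ∨ M = Set.univ

/-- The tournament `Inv(T, B)` obtained from `T` by reversing all arcs of a set `B` of arcs. -/
def inv (T : Tournament.{u}) (B : Finset (T.V × T.V)) (hB : ∀ b ∈ B, T.Arc b.1 b.2) :
    Tournament.{u} where
  V := T.V
  finite := T.finite
  Arc x y := (T.Arc x y ∧ (x, y) ∉ B) ∨ (y, x) ∈ B
  irrefl x h := by
    rcases h with h | h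
    · exact T.irrefl x h.1
    · exact T.irrefl x (hB _ h)
  arc_iff x y h := by
    have h1 := T.arc_iff x y h
    have h2 := hB (x, y)
    have h3 := hB (y, x)
    simp only at h2 h3
    tauto

/-- The decomposability index `δ(T)`: the least number of arcs of `T` whose reversal makes `T`
indecomposable. (It is meant for tournaments with at least five vertices, for which such
sets of arcs exist.) -/
noncomputable def delta (T : Tournament.{u}) : ℕ :=
  sInf {m : ℕ | ∃ (B : Finset (T.V × T.V)) (hB : ∀ b ∈ B, T.Arc b.1 b.2),
    B.card = m ∧ (T.inv B hB).Indecomposable}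

/-- `δ(m)`: the maximum of `δ(U)` over the `m`-vertex tournaments `U`. -/
noncomputable def maxDelta (m : ℕ) : ℕ :=
  sSup {d : ℕ | ∃ U : Tournament.{0}, U.card = m ∧ U.delta = d}

/-- `T` has `δ`-maximal decomposability: `δ(T) = δ(v(T))`. -/
def DeltaMaximal (T : Tournament.{u}) : Prop := T.delta = maxDelta T.card

/-- The transitive tournament on `{0, …, k - 1}`, with an arc `(i, j)` whenever `i < j`. -/
@[reducible] def transitive (k : ℕ) : Tournament.{0} where
  V := Fin k
  finite := inferInstance
  Arc i j := i < j
  irrefl i := lt_irrefl i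
  arc_iff i j h := by
    rw [not_lt]
    exact ⟨le_of_lt, fun h' => lt_of_le_of_ne h' h⟩

/-- The cyclic tournament `C₃` on `{0, 1, 2}`, with arcs `(0, 1)`, `(1, 2)`, `(2, 0)`. -/
@[reducible] def C3 : Tournament.{0} where
  V := Fin 3
  finite := inferInstance
  Arc i j := (i = 0 ∧ j = 1) ∨ (i = 1 ∧ j = 2) ∨ (i = 2 ∧ j = 0)
  irrefl := by decide
  arc_iff := by decide

/-- The lexicographic sum of the tournaments `S i` over the tournament `T`: on the disjoint union
of the vertex sets, `(x, y)` with `x` in `S i` and `y` in `S j` is an arc if `i = j` and `(x, y)` is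
an arc of `S i`, or `i ≠ j` and `(i, j)` is an arc of `T`. -/
@[reducible] def lexSum (T : Tournament.{u}) (S : T.V → Tournament.{v}) :
    Tournament.{max u v} where
  V := Σ i : T.V, (S i).V
  finite := inferInstance
  Arc := Sigma.Lex T.Arc (fun i => (S i).Arc)
  irrefl x h := by
    rcases h with ⟨_, _, h⟩ | ⟨_, _, h⟩
    · exact T.irrefl _ h
    · exact (S _).irrefl _ h
  arc_iff := by
    rintro ⟨i, a⟩ ⟨j, b⟩ h
    by_cases hij : i = j
    · subst hij
      have hab : a ≠ b := fun e => h (by rw [e])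
      have h1 := (S i).arc_iff a b hab
      have h2 := T.irrefl i
      simp only [Sigma.lex_iff, h2, false_or, exists_true_left]
      exact h1
    · have h1 := T.arc_iff i j hij
      have hji : ¬ j = i := fun e => hij e.symm
      simp only [Sigma.lex_iff, hij, hji, IsEmpty.exists_iff, or_false]
      exact h1

/-- The lexicographic product `T.H`: the lexicographic sum over `T` of copies of `H`. -/
@[reducible] def lexProd (T : Tournament.{u}) (H : Tournament.{v}) : Tournament.{max u v} :=
  T.lexSum fun _ => H

open Classical in
/-- The lexicographic sum `T(H, K, …, K)`, where the vertices of `T` are listed in such a way that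
`a` is the first one: the vertex `a` is replaced by `H` and every other vertex by `K`. -/
@[reducible] noncomputable def lexSumFirst (T : Tournament.{u}) (a : T.V) (H K : Tournament.{v}) :
    Tournament.{max u v} :=
  T.lexSum fun i => if i = a then H else K

/-- The set defining `maxDelta` has a maximum, so `maxDelta m` is a true maximum. -/
theorem isGreatest_maxDelta (m : ℕ) :
    IsGreatest {d : ℕ | ∃ U : Tournament.{0}, U.card = m ∧ U.delta = d} (maxDelta m) := by
  have hne : {d : ℕ | ∃ U : Tournament.{0}, U.card = m ∧ U.delta = d}.Nonempty :=
    ⟨_, transitive m, by simp [card], rfl⟩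
  have hb : BddAbove {d : ℕ | ∃ U : Tournament.{0}, U.card = m ∧ U.delta = d} := by
    refine ⟨m * m, ?_⟩
    rintro _ ⟨U, hU, rfl⟩
    rcases Set.eq_empty_or_nonempty {k : ℕ | ∃ (B : Finset (U.V × U.V))
      (hB : ∀ b ∈ B, U.Arc b.1 b.2), B.card = k ∧ (U.inv B hB).Indecomposable} with he | he
    · rw [delta, he, Nat.sInf_empty]
      exact Nat.zero_le _
    · obtain ⟨B, hB, hc, -⟩ := Nat.sInf_mem he
      have : Fintype U.V := Fintype.ofFinite _
      rw [delta, ← hc, ← hU, card, ← Nat.card_prod, Nat.card_eq_fintype_card]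
      exact Finset.card_le_univ B
  exact ⟨Nat.sSup_mem hne hb, fun d hd => le_csSup hb hd⟩

end Tournament

/-! ### Modules of a tournament and the effect of reversing one arc -/

open Set
namespace TourRel
variable {V : Type u}

/-! Call a finite vertex set crossing if every nontrivial module meets it without containing it
(`Crossing`). The size of a crossing set controls how many reversals are needed. As long as a
minimum crossing set has at least four elements, one well-chosen reversal leaves a crossing set
smaller by two (`MinCrossing.reduces`). With two elements one reversal finishes
(`exists_sflip_of_two`), and with three elements one reversal leads back to the case of two
(`reducesToTwo_of_card_eq_three`). So a crossing set of size at most k gives at most ⌊(k+1)/2⌋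
reversals (`Crossing.fix`).

What makes this work is control over new modules. Reversing the arc between a and c creates only
modules that separate a from c. If a and c lie in modules meeting the crossing set in a alone and in
c alone, such a new module forces an old module containing both a and c (`new_of_pointed`,
`new_of_pairs`). The pair a, c is chosen so that this is impossible.

On 4n+1 vertices, a crossing set of at most 2n elements gives n reversals. Otherwise take a minimum
crossing set A with least sum of outdegrees (`Best`). Its elements lie in pairwise disjoint modules
(`disjoint_block`) of size at least two, apart from exceptional elements, which are the source or
have no private module; two exceptional elements must be the source and the sink, so there are at
most two. Counting vertices forces |A| = 2n+1. With one exceptional element the other vertices split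
into 2n pairs, which is F1. With two, 2n-1 modules of size at least two share 4n-1 vertices, and the
single spare vertex is either left over (F2) or enlarges one module to a 3-cycle (F3). This is
`fix_and_forms`.

Conversely, each form contains 2n+1 disjoint sets that are nontrivial modules or complements of
such. The boundary of each must be crossed by a reversed arc, and an arc crosses at most two of
these boundaries, so n reversals do not suffice (`Comodules.le_of_fix`). Hence δ(4n+1) = n+1,
attained exactly by the listed forms. -/

/-- The relation `r` is the arc relation of a tournament. -/
structure IsTour (r : V → V → Prop) : Prop where
  irrefl : ∀ x, ¬ r x x
  iff_not : ∀ x y, x ≠ y → (r x y ↔ ¬ r y x)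

/-- The reversed relation. -/
def rev (r : V → V → Prop) : V → V → Prop := fun x y => r y x

/-- `N` is a module of `r`. -/
def IsMod (r : V → V → Prop) (N : Set V) : Prop :=
  ∀ x ∈ N, ∀ y ∈ N, ∀ z, z ∉ N → (r z x ↔ r z y)

/-- `N` is a nontrivial module of `r`. -/
structure NT (r : V → V → Prop) (N : Set V) : Prop where
  mod : IsMod r N
  nontriv : N.Nontrivial
  ne_univ : N ≠ univ

/-- Every nontrivial module meets `A` and none contains `A`. -/
def Crossing (r : V → V → Prop) (A : Finset V) : Prop :=
  ∀ N, NT r N → (∃ x ∈ A, x ∈ N) ∧ ∃ x ∈ A, x ∉ N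

/-- Reversal of the arc between `a` and `c`. -/
def sflip (r : V → V → Prop) (a c : V) : V → V → Prop := fun x y =>
  (r x y ∧ ¬ ((x = a ∧ y = c) ∨ (x = c ∧ y = a))) ∨
    (r y x ∧ ((x = a ∧ y = c) ∨ (x = c ∧ y = a)))

variable {r : V → V → Prop} {M N : Set V} {a c p d s : V}

theorem IsTour.asymm (h : IsTour r) {x y : V} (hxy : r x y) : ¬ r y x := by
  rcases eq_or_ne x y with rfl | hne
  · exact h.irrefl x
  · exact (h.iff_not x y hne).1 hxy

theorem IsTour.total (h : IsTour r) {x y : V} (hne : x ≠ y) : r x y ∨ r y x := by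
  have := h.iff_not x y hne
  tauto

theorem IsTour.ne (h : IsTour r) {x y : V} (hxy : r x y) : x ≠ y := by
  rintro rfl
  exact h.irrefl x hxy

theorem IsTour.rev (h : IsTour r) : IsTour (rev r) :=
  ⟨h.irrefl, fun x y hne => h.iff_not y x hne.symm⟩

theorem IsMod.out (ht : IsTour r) (h : IsMod r N) {x y z : V} (hx : x ∈ N) (hy : y ∈ N)
    (hz : z ∉ N) : r x z ↔ r y z := by
  have h1 := h x hx y hy z hz
  have h2 := ht.iff_not x z (by rintro rfl; exact hz hx)
  have h3 := ht.iff_not y z (by rintro rfl; exact hz hy)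
  tauto

theorem isMod_rev (ht : IsTour r) : IsMod (rev r) N ↔ IsMod r N :=
  ⟨fun h _ hx _ hy _ hz => h.out ht.rev hx hy hz, fun h _ hx _ hy _ hz => h.out ht hx hy hz⟩

theorem nt_rev (ht : IsTour r) : NT (rev r) N ↔ NT r N :=
  ⟨fun h => ⟨(isMod_rev ht).1 h.1, h.2, h.3⟩, fun h => ⟨(isMod_rev ht).2 h.1, h.2, h.3⟩⟩

theorem crossing_rev (ht : IsTour r) {A : Finset V} : Crossing (rev r) A ↔ Crossing r A := by
  simp only [Crossing, nt_rev ht]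

theorem IsMod.inter (h : IsMod r M) (h' : IsMod r N) : IsMod r (M ∩ N) := by
  intro x hx y hy z hz
  by_cases hzM : z ∈ M
  · exact h' x hx.2 y hy.2 z fun hzN => hz ⟨hzM, hzN⟩
  · exact h x hx.1 y hy.1 z hzM

theorem IsMod.union (h : IsMod r M) (h' : IsMod r N) {w : V} (hwM : w ∈ M) (hwN : w ∈ N) :
    IsMod r (M ∪ N) := by
  have key : ∀ x ∈ M ∪ N, ∀ z ∉ M ∪ N, (r z x ↔ r z w) := by
    rintro x (hx | hx) z hz
    · exact h x hx w hwM z fun hz' => hz (Or.inl hz')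
    · exact h' x hx w hwN z fun hz' => hz (Or.inr hz')
  intro x hx y hy z hz
  rw [key x hx z hz, key y hy z hz]

/-- A vertex of M ∩ N relates to M \ N as the witness w does, and w, being outside M, does not
distinguish vertices of M. -/
theorem IsMod.diff (ht : IsTour r) (h : IsMod r M) (h' : IsMod r N) {w : V} (hwN : w ∈ N)
    (hwM : w ∉ M) : IsMod r (M \ N) := by
  intro x hx y hy z hz
  by_cases hzM : z ∈ M
  · have hzN : z ∈ N := by_contra fun hzN => hz ⟨hzM, hzN⟩
    rw [h'.out ht hzN hwN hx.2, h'.out ht hzN hwN hy.2]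
    exact h x hx.1 y hy.1 w hwM
  · exact h x hx.1 y hy.1 z hzM

theorem isMod_univ : IsMod r univ := fun _ _ _ _ z hz => (hz (mem_univ z)).elim

theorem sflip_comm : sflip r a c = sflip r c a := by
  funext x y
  simp only [sflip]
  grind

theorem sflip_rev : sflip (rev r) a c = rev (sflip r a c) := by
  funext x y
  simp only [sflip, rev]
  grind

theorem IsTour.sflip (h : IsTour r) : IsTour (sflip r a c) := by
  refine ⟨fun x => ?_, fun x y hne => ?_⟩
  · have := h.irrefl x
    simp only [TourRel.sflip]
    tauto
  · have := h.iff_not x y hne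
    simp only [TourRel.sflip]
    grind

/-- The reversed arc is invisible to a set having both or neither of its ends. So every new module
separates a from c, and later proofs only need to examine such modules. -/
theorem isMod_of_sflip (h : IsMod (sflip r a c) N) (hac : a ∈ N ↔ c ∈ N) : IsMod r N := by
  intro x hx y hy z hz
  have := h x hx y hy z hz
  simp only [sflip] at this
  grind

theorem sflip_spec_left (ht : IsTour r) (h : IsMod (sflip r a c) N) (ha : a ∈ N) (hc : c ∉ N)
    (hr : r a c) : ∀ n ∈ N, n ≠ a → r c n := by
  intro n hn hna
  have := h a ha n hn c hc
  have h2 := ht.asymm hr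
  simp only [sflip] at this
  grind

theorem sflip_spec_right (ht : IsTour r) (h : IsMod (sflip r a c) N) (ha : a ∉ N) (hc : c ∈ N)
    (hr : r a c) : ∀ n ∈ N, n ≠ c → r n a := by
  intro n hn hnc
  have := h c hc n hn a ha
  have h2 := ht.asymm hr
  have h3 := ht.iff_not n a (by grind)
  simp only [sflip] at this
  grind

theorem sflip_uniform (h : IsMod (sflip r a c) N) {x y z : V} (hx : x ∈ N) (hy : y ∈ N)
    (hz : z ∉ N) (hza : z ≠ a) (hzc : z ≠ c) : r z x ↔ r z y := by
  have := h x hx y hy z hz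
  simp only [sflip] at this
  grind

/-- In a module all of whose submodules with two elements contain `a`, reversing an arc leaving the
module from `a` creates no module except possibly a pair. -/
theorem new_of_pointed_aux (ht : IsTour r) (hM : IsMod r M) (ha : a ∈ M)
    (hp : ∀ L ⊆ M, IsMod r L → L.Nontrivial → a ∈ L) (h3 : (M \ {a}).Nontrivial) (hc : c ∉ M)
    (hN : IsMod (sflip r a c) N) (hNn : N.Nontrivial) (hsep : ¬ (a ∈ N ↔ c ∈ N)) (hr : r a c) :
    IsMod r (insert c M) ∧ ∃ q ∈ M, q ≠ a ∧ N = {c, q} ∧ r q a ∧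
      ∀ p ∈ M, p ≠ a → p ≠ q → r p q := by
  have hpc : ∀ p ∈ M, r p c := fun p hpM => (hM.out ht hpM ha hc).2 hr
  -- If a were the source or sink of M, then M \ {a} would be a nontrivial module avoiding a. Both
  -- cases below are driven to this contradiction.
  have hnm : ¬ ((∀ p ∈ M, p ≠ a → r p a) ∨ (∀ p ∈ M, p ≠ a → r a p)) := by
    intro h
    have hmod : IsMod r (M \ {a}) := by
      intro x hx y hy z hz
      by_cases hza : z = a
      · subst hza
        have hx' := ht.iff_not x z hx.2
        have hy' := ht.iff_not y z hy.2
        rcases h with h | h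
        · have := h x hx.1 hx.2
          have := h y hy.1 hy.2
          tauto
        · have := h x hx.1 hx.2
          have := h y hy.1 hy.2
          tauto
      · exact hM x hx.1 y hy.1 z fun hzM => hz ⟨hzM, hza⟩
    exact (hp _ sdiff_subset hmod h3).2 rfl
  -- If a ∈ N, then c beats N \ {a} while M beats c, so N meets M in a only. Another vertex n of N
  -- sees M uniformly, and M \ {a} does not distinguish a from n, so a is extreme in M.
  by_cases haN : a ∈ N
  · have hcN : c ∉ N := fun h => hsep ⟨fun _ => h, fun _ => haN⟩
    have h1 := sflip_spec_left ht hN haN hcN hr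
    obtain ⟨n, hn, hna⟩ := hNn.exists_ne a
    have hMN : ∀ p ∈ M, p ≠ a → p ∉ N := fun p hpM hpa hpN =>
      ht.asymm (h1 p hpN hpa) (hpc p hpM)
    have hnM : n ∉ M := fun h => hMN n h hna hn
    exfalso
    apply hnm
    have hu : ∀ p ∈ M, p ≠ a → (r p a ↔ r p n) := fun p hpM hpa =>
      sflip_uniform hN haN hn (hMN p hpM hpa) hpa (by rintro rfl; exact hc hpM)
    by_cases han : r a n
    · left
      intro p hpM hpa
      exact (hu p hpM hpa).2 ((hM.out ht hpM ha hnM).2 han)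
    · right
      intro p hpM hpa
      have h5 := hu p hpM hpa
      have h6 := hM.out ht hpM ha hnM
      rcases ht.total hpa with h | h
      · tauto
      · exact h
  · have hcN : c ∈ N := by tauto
    have h1 := sflip_spec_right ht hN haN hcN hr
    -- A vertex n of N outside M beats a, hence all of M. A vertex of M outside N, other than a,
    -- beats c and so would have to beat n. Thus M \ {a} lies in N, and a is the sink of M.
    have hNM : ∀ n ∈ N, n ≠ c → n ∈ M := by
      intro n hn hnc
      by_contra hnM
      apply hnm
      left
      intro p hpM hpa
      by_cases hpN : p ∈ N
      · exact h1 p hpN (by rintro rfl; exact hc hpM)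
      · exfalso
        have h5 : r p n := (sflip_uniform hN hcN hn hpN hpa
          (by rintro rfl; exact hc hpM)).1 (hpc p hpM)
        have h6 : r n p := (hM a ha p hpM n hnM).1 (h1 n hn hnc)
        exact ht.asymm h5 h6
    have hsub : (N \ {c}).Subsingleton := by
      by_contra hns
      rw [not_subsingleton_iff] at hns
      have hmod : IsMod r (N \ {c}) := by
        intro x hx y hy z hz
        by_cases hzM : z ∈ M
        · by_cases hza : z = a
          · subst hza
            have := ht.asymm (h1 x hx.1 hx.2)
            have := ht.asymm (h1 y hy.1 hy.2)
            tauto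
          · exact sflip_uniform hN hx.1 hy.1
              (fun hzN => hz ⟨hzN, by rintro rfl; exact hc hzM⟩) hza
              (by rintro rfl; exact hc hzM)
        · exact hM x (hNM x hx.1 hx.2) y (hNM y hy.1 hy.2) z hzM
      exact haN (hp _ (fun n hn => hNM n hn.1 hn.2) hmod hns).1
    obtain ⟨q, hq, hqc⟩ := hNn.exists_ne c
    have hqM := hNM q hq hqc
    have hNeq : N = {c, q} := by
      ext n
      constructor
      · intro hn
        by_cases hnc : n = c
        · exact Or.inl hnc
        · exact Or.inr (hsub ⟨hn, hnc⟩ ⟨hq, hqc⟩)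
      · rintro (rfl | rfl)
        · exact hcN
        · exact hq
    refine ⟨?_, q, hqM, by rintro rfl; exact haN hq, hNeq, h1 q hq hqc, ?_⟩
    · have key : ∀ x ∈ insert c M, ∀ z ∉ insert c M, (r z x ↔ r z q) := by
        rintro x (rfl | hx) z hz
        · refine sflip_uniform hN hcN hq (fun hzN => hz ?_) ?_ ?_
          · rw [hNeq] at hzN
            rcases hzN with rfl | rfl
            · exact Or.inl rfl
            · exact Or.inr hqM
          · rintro rfl
            exact hz (Or.inr ha)
          · rintro rfl
            exact hz (Or.inl rfl)
        · exact hM x hx q hqM z fun h => hz (Or.inr h)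
      intro x hx y hy z hz
      rw [key x hx z hz, key y hy z hz]
    · intro p hpM hpa hpq
      refine (sflip_uniform hN hcN hq (fun h => ?_) hpa ?_).1 (hpc p hpM)
      · rw [hNeq] at h
        rcases h with rfl | rfl
        · exact hc hpM
        · exact hpq rfl
      · rintro rfl
        exact hc hpM

/-- The other orientation of the arc follows by duality. Expressing directions relative to `r a c`
makes the conclusion self-dual. -/
theorem new_of_pointed (ht : IsTour r) (hM : IsMod r M) (ha : a ∈ M)
    (hp : ∀ L ⊆ M, IsMod r L → L.Nontrivial → a ∈ L) (h3 : (M \ {a}).Nontrivial) (hc : c ∉ M)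
    (hN : IsMod (sflip r a c) N) (hNn : N.Nontrivial) (hsep : ¬ (a ∈ N ↔ c ∈ N)) :
    IsMod r (insert c M) ∧ ∃ q ∈ M, q ≠ a ∧ N = {c, q} ∧ (r q a ↔ r a c) ∧
      ∀ p ∈ M, p ≠ a → p ≠ q → (r p q ↔ r a c) := by
  have hne : a ≠ c := by rintro rfl; exact hc ha
  rcases ht.total hne with hr | hr
  · obtain ⟨h1, q, h2, h4, h5, h6, h7⟩ := new_of_pointed_aux ht hM ha hp h3 hc hN hNn hsep hr
    exact ⟨h1, q, h2, h4, h5, by tauto, fun p hp hpa hpq => by have := h7 p hp hpa hpq; tauto⟩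
  · have hN' : IsMod (sflip (rev r) a c) N := by
      rw [sflip_rev]
      exact (isMod_rev ht.sflip).2 hN
    obtain ⟨h1, q, h2, h4, h5, h6, h7⟩ := new_of_pointed_aux ht.rev ((isMod_rev ht).2 hM) ha
      (fun L hL hLm => hp L hL ((isMod_rev ht).1 hLm)) h3 hc hN' hNn hsep hr
    refine ⟨(isMod_rev ht).1 h1, q, h2, h4, h5, ?_, fun p hp hpa hpq => ?_⟩
    · have := ht.asymm hr
      have := ht.asymm h6
      tauto
    · have := ht.asymm hr
      have := ht.asymm (h7 p hp hpa hpq)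
      tauto

/-- The twin p of a beats c, so it is not in N; the twin d of c is in N, since otherwise it would
distinguish a from another vertex of N. Testing N from p and from c fixes the orientation of both
pairs, and then no outside vertex distinguishes the two pairs from each other. -/
theorem new_of_pairs_aux (ht : IsTour r) (h1 : IsMod r {p, a}) (h2 : IsMod r {d, c})
    (hpa : p ≠ a) (hdc : d ≠ c) (hpd : p ≠ d) (hpc : p ≠ c) (had : a ≠ d) (hr : r a c)
    (hN : IsMod (sflip r a c) N) (hNn : N.Nontrivial) (haN : a ∈ N) (hcN : c ∉ N) :
    r p a ∧ r c d ∧ IsMod r {p, a, d, c} := by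
  have hac : a ≠ c := ht.ne hr
  have e1 : ∀ z, z ≠ p → z ≠ a → (r z p ↔ r z a) := fun z hz hz' =>
    h1 p (by simp) a (by simp) z (by simp [hz, hz'])
  have e2 : ∀ z, z ≠ d → z ≠ c → (r z d ↔ r z c) := fun z hz hz' =>
    h2 d (by simp) c (by simp) z (by simp [hz, hz'])
  have ne := ht.iff_not
  have s1 := sflip_spec_left ht hN haN hcN hr
  have s2 := fun x y z => sflip_uniform (r := r) (a := a) (c := c) (x := x) (y := y) (z := z) hN
  have hpN : p ∉ N := by grind
  obtain ⟨n0, hn0, hn0a⟩ := hNn.exists_ne a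
  have hdN : d ∈ N := by
    by_contra hdN
    have f1 := s2 a n0 d haN hn0 hdN had.symm hdc
    have f2 := e2 a had hac
    have f3 := e2 n0 (by grind) (by grind)
    have f4 := s1 n0 hn0 hn0a
    have f5 := ne n0 c (by grind)
    have f6 := ne n0 d (by grind)
    have f7 := ne a d had
    tauto
  have hcd := s1 d hdN had.symm
  have hpa' : r p a := by
    have f1 := s2 a d p haN hdN hpN hpa hpc
    have f2 := e2 p hpd hpc
    have f3 := e1 c hpc.symm hac.symm
    have f4 := ne p c hpc
    have f5 := ne a c hac
    tauto
  refine ⟨hpa', hcd, ?_⟩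
  have key : ∀ z, z ≠ p → z ≠ a → z ≠ d → z ≠ c → (r z d ↔ r z a) := by
    intro z zp za zd zc
    by_cases hzN : z ∈ N
    · have f1 := ht.asymm (s1 z hzN za)
      have f2 := ht.asymm ((s2 a z p haN hzN hpN hpa hpc).1 hpa')
      rw [e2 z zd zc, ← e1 z zp za]
      exact iff_of_false f1 f2
    · exact s2 d a z hdN haN hzN za zc
  have key2 : ∀ x ∈ ({p, a, d, c} : Set V), ∀ z ∉ ({p, a, d, c} : Set V), (r z x ↔ r z a) := by
    intro x hx z hz
    simp only [mem_insert_iff, mem_singleton_iff, not_or] at hx hz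
    obtain ⟨zp, za, zd, zc⟩ := hz
    have f3 := e1 z zp za
    have f4 := e2 z zd zc
    have f5 := key z zp za zd zc
    rcases hx with rfl | rfl | rfl | rfl <;> tauto
  intro x hx y hy z hz
  rw [key2 x hx z hz, key2 y hy z hz]

theorem new_of_pairs (ht : IsTour r) (h1 : IsMod r {p, a}) (h2 : IsMod r {d, c})
    (hpa : p ≠ a) (hdc : d ≠ c) (hpd : p ≠ d) (hpc : p ≠ c) (had : a ≠ d) (hr : r a c)
    (hN : IsMod (sflip r a c) N) (hNn : N.Nontrivial) (hsep : ¬ (a ∈ N ↔ c ∈ N)) :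
    r p a ∧ r c d ∧ IsMod r {p, a, d, c} := by
  by_cases haN : a ∈ N
  · exact new_of_pairs_aux ht h1 h2 hpa hdc hpd hpc had hr hN hNn haN (by tauto)
  · have hN' : IsMod (sflip (rev r) c a) N := by
      rw [sflip_rev, sflip_comm]
      exact (isMod_rev ht.sflip).2 hN
    obtain ⟨f1, f2, f3⟩ := new_of_pairs_aux (r := rev r) ht.rev ((isMod_rev ht).2 h2)
      ((isMod_rev ht).2 h1) hdc hpa hpd.symm had.symm hpc.symm hr hN' hNn (by tauto) haN
    refine ⟨f2, f1, ?_⟩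
    rw [isMod_rev ht] at f3
    convert f3 using 1
    grind

/-- A new module containing a would need vertices beating the source. One containing s would be seen
from p, which beats a and so is outside: its further vertices would beat p, hence also the twin a,
although a must beat them. The direction p → a is essential. -/
theorem not_new_of_source (ht : IsTour r) (h1 : IsMod r {p, a}) (hpa : r p a) (hsp : s ≠ p)
    (hsa : s ≠ a) (hs : ∀ x, x ≠ s → r s x)
    (hN : IsMod (sflip r s a) N) (hNn : N.Nontrivial) : s ∈ N ↔ a ∈ N := by
  by_contra hsep
  have e1 : ∀ z, z ≠ p → z ≠ a → (r z p ↔ r z a) := fun z hz hz' =>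
    h1 p (by simp) a (by simp) z (by simp [hz, hz'])
  have ne := ht.iff_not
  have s2 := fun x y z => sflip_uniform (r := r) (a := s) (c := a) (x := x) (y := y) (z := z) hN
  by_cases hsN : s ∈ N
  · have haN : a ∉ N := by tauto
    have s1 := sflip_spec_left ht hN hsN haN (hs a hsa.symm)
    obtain ⟨n, hn, hns⟩ := hNn.exists_ne s
    have f0 := s1 n hn hns
    have hpN : p ∉ N := fun h => ht.asymm hpa (s1 p h hsp.symm)
    have f1 := s2 s n p hsN hn hpN hsp.symm (ht.ne hpa)
    have f2 := hs p hsp.symm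
    have f3 := e1 n (by grind) (by grind)
    have f4 := ne n p (by grind)
    have f5 := ne n a (by grind)
    have f6 := ne s p hsp
    tauto
  · have haN : a ∈ N := by tauto
    have s1 := sflip_spec_right ht hN hsN haN (hs a hsa.symm)
    obtain ⟨n, hn, hns⟩ := hNn.exists_ne a
    exact ht.asymm (s1 n hn hns) (hs n (by grind))

end TourRel

/-! ### Two separating vertices: one reversal suffices -/

open Set
namespace TourRel
variable {V : Type u}
variable {r : V → V → Prop} {M N : Set V} {a c p d s : V}

/-- Four vertices never exhaust `V`. -/
def Large (V : Type u) : Prop := ∀ a b c d : V, ∃ z, z ≠ a ∧ z ≠ b ∧ z ≠ c ∧ z ≠ d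

theorem quad_comm : ({p, a, d, c} : Set V) = {d, c, p, a} := by
  ext x
  simp only [mem_insert_iff, mem_singleton_iff]
  tauto

theorem exists_eq_pair (ha : a ∈ M) (hn : M.Nontrivial) (h : ¬ (M \ {a}).Nontrivial) :
    ∃ p, p ≠ a ∧ M = {p, a} := by
  obtain ⟨p, hp, hpa⟩ := hn.exists_ne a
  refine ⟨p, hpa, ?_⟩
  rw [not_nontrivial_iff] at h
  ext x
  constructor
  · intro hx
    by_cases hxa : x = a
    · exact Or.inr hxa
    · exact Or.inl (h ⟨hx, hxa⟩ ⟨hp, hpa⟩)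
  · rintro (rfl | rfl)
    · exact hp
    · exact ha

theorem not_nt_sflip (hS : ∀ N, NT r N → ¬ (a ∈ N ↔ c ∈ N))
    (h : ∀ N, IsMod (sflip r a c) N → N.Nontrivial → N ≠ univ → (a ∈ N ↔ c ∈ N)) (N : Set V) :
    ¬ NT (sflip r a c) N := by
  intro hN
  have := h N hN.mod hN.nontriv hN.ne_univ
  exact hS N ⟨isMod_of_sflip hN.mod this, hN.nontriv, hN.ne_univ⟩ this

theorem isMod_compl_source (hs : ∀ x, x ≠ s → r s x) : IsMod r {s}ᶜ := by
  intro x hx y hy z hz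
  simp only [mem_compl_iff, mem_singleton_iff, not_not] at hx hy hz
  subst hz
  exact iff_of_true (hs x hx) (hs y hy)

theorem nt_compl_source (hV : Large V) (hs : ∀ x, x ≠ s → r s x) : NT r {s}ᶜ := by
  refine ⟨isMod_compl_source hs, ?_, fun h => ?_⟩
  · obtain ⟨x, hx, -⟩ := hV s s s s
    obtain ⟨y, hy, hyx, -⟩ := hV s x s s
    exact ⟨x, hx, y, hy, hyx.symm⟩
  · have : s ∈ ({s}ᶜ : Set V) := h ▸ mem_univ s
    exact this rfl

/-- If all nontrivial modules share a vertex and avoid the source, one reversal suffices. -/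
theorem exists_sflip_of_source (ht : IsTour r) (hV : Large V) (hs : ∀ x, x ≠ s → r s x)
    (hall : ∀ N, NT r N → s ∉ N) (ha : ∀ N, NT r N → a ∈ N) :
    ∃ x y, x ≠ y ∧ ∀ N, ¬ NT (sflip r x y) N := by
  have hH := nt_compl_source hV hs
  by_contra! hcon
  -- Since reversing the arc between s and a fails, `new_of_pointed`, applied to the module of all
  -- vertices but s, gives a vertex q that is beaten by a and beats all vertices other than s and a.
  -- Such a q distinguishes a from every further vertex of a module avoiding q, so q is again common
  -- to all nontrivial modules.
  have key : ∀ a, (∀ N, NT r N → a ∈ N) → ∃ q, (∀ N, NT r N → q ∈ N) ∧ q ≠ s ∧ r a q ∧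
      ∀ p, p ≠ s → p ≠ a → p ≠ q → r q p := by
    intro a ha
    have has : a ≠ s := ha _ hH
    obtain ⟨N, hN⟩ := hcon a s has
    have hsep : ¬ (a ∈ N ↔ s ∈ N) := by
      intro hiff
      have hN' : NT r N := ⟨isMod_of_sflip hN.mod hiff, hN.nontriv, hN.ne_univ⟩
      exact hall N hN' (hiff.1 (ha N hN'))
    have h3 : ({s}ᶜ \ {a} : Set V).Nontrivial := by
      obtain ⟨x, hx, hxa, -⟩ := hV s a s s
      obtain ⟨y, hy, hya, hyx, -⟩ := hV s a x s
      exact ⟨x, ⟨hx, hxa⟩, y, ⟨hy, hya⟩, hyx.symm⟩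
    obtain ⟨-, q, hq, hqa, hNq, h1, h2⟩ := new_of_pointed ht hH.mod has
      (fun L hL hLm hLn => ha L ⟨hLm, hLn, fun h => hL (h ▸ mem_univ s) rfl⟩) h3 (by simp)
      hN.mod hN.nontriv hsep
    have hnas := ht.asymm (hs a has)
    have haq : r a q := by
      rcases ht.total hqa with h | h
      · exact (hnas (h1.1 h)).elim
      · exact h
    have hqp : ∀ p, p ≠ s → p ≠ a → p ≠ q → r q p := by
      intro p hps hpa hpq
      rcases ht.total hpq with h | h
      · exact (hnas ((h2 p hps hpa hpq).1 h)).elim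
      · exact h
    refine ⟨q, fun L hL => ?_, hq, haq, hqp⟩
    by_contra hqL
    obtain ⟨l, hl, hla⟩ := hL.nontriv.exists_ne a
    have h3 := hL.mod a (ha L hL) l hl q hqL
    have h4 := hqp l (fun h => hall L hL (h ▸ hl)) hla (fun h => hqL (h ▸ hl))
    exact ht.asymm haq (h3.2 h4)
  -- Iterating gives a → b → e → f, and the domination properties force f = a. So s and the three
  -- vertices of a 3-cycle each dominate all remaining vertices, and these form a module avoiding a.
  obtain ⟨b, hb, hbs, hab, hb'⟩ := key a ha
  obtain ⟨e, he, hes, hbe, he'⟩ := key b hb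
  obtain ⟨f, hf, hfs, hef, hf'⟩ := key e he
  have has : a ≠ s := ha _ hH
  have nab := ht.ne hab
  have nbe := ht.ne hbe
  have nef := ht.ne hef
  have nea : e ≠ a := by rintro rfl; exact ht.asymm hab hbe
  have hfa : f = a := by
    by_contra hfa
    by_cases hfb : f = b
    · subst hfb
      exact ht.asymm hbe hef
    · exact ht.asymm (hb' f hfs hfa hfb) (hf' b hbs nbe (Ne.symm hfb))
  subst hfa
  obtain ⟨t, hts, hta, htb, hte⟩ := hV s f b e
  have hmod : IsMod r ({s, f, b, e}ᶜ) := by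
    intro x hx y hy z hz
    rw [notMem_compl_iff] at hz
    simp only [mem_compl_iff, mem_insert_iff, mem_singleton_iff, not_or] at hx hy hz
    obtain ⟨x1, x2, x3, x4⟩ := hx
    obtain ⟨y1, y2, y3, y4⟩ := hy
    rcases hz with rfl | rfl | rfl | rfl
    · exact iff_of_true (hs x x1) (hs y y1)
    · exact iff_of_true (hf' x x1 x4 x2) (hf' y y1 y4 y2)
    · exact iff_of_true (hb' x x1 x2 x3) (hb' y y1 y2 y3)
    · exact iff_of_true (he' x x1 x3 x4) (he' y y1 y3 y4)
  by_cases hn : ({s, f, b, e}ᶜ : Set V).Nontrivial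
  · refine ha _ ⟨hmod, hn, fun h => ?_⟩ (by simp)
    have : f ∈ ({s, f, b, e}ᶜ : Set V) := h ▸ mem_univ f
    simp at this
  -- Only one vertex t remains. It is a sink, so its complement is a nontrivial module containing s.
  · rw [not_nontrivial_iff] at hn
    have hto : ∀ x, x ≠ t → r x t := by
      intro x hxt
      by_cases hx : x ∈ ({s, f, b, e}ᶜ : Set V)
      · exact (hxt (hn hx (by simp [hts, hta, htb, hte]))).elim
      · simp only [mem_compl_iff, mem_insert_iff, mem_singleton_iff, not_not] at hx
        rcases hx with rfl | rfl | rfl | rfl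
        · exact hs t hts
        · exact hf' t hts hte hta
        · exact hb' t hts hta htb
        · exact he' t hts htb hte
    have h1 : NT (rev r) {t}ᶜ := nt_compl_source hV hto
    exact hall _ ((nt_rev ht).1 h1) (by simpa using hts.symm)

/-- Suppose that reversing the arc between a and z fails for every z outside the pair. The new
module is either {a, v}, where v beats a and z is the only vertex outside the pair and other than v
that distinguishes v from a, or the complement of {a}, in which case z is the only vertex beating a.
If the second case occurs for some z0, then z0 serves as v for all other z, although it has just one
distinguishing vertex. If it never occurs, z ↦ v is injective, hence a permutation of the vertices
outside the pair. All of them then beat a, and they form a second module. -/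
theorem exists_sflip_of_pair (ht : IsTour r) (hV : Large V) {b : V} [Finite V] (hba : r a b)
    (hall : ∀ N, NT r N ↔ N = {b, a}) :
    ∃ x y, x ≠ y ∧ ∀ N, ¬ NT (sflip r x y) N := by
  have hab : a ≠ b := ht.ne hba
  have hM : IsMod r {b, a} := ((hall _).2 rfl).mod
  have e1 : ∀ z, z ≠ b → z ≠ a → (r z b ↔ r z a) := fun z hz hz' =>
    hM b (by simp) a (by simp) z (by simp [hz, hz'])
  have e2 : ∀ z, z ≠ b → z ≠ a → (r b z ↔ r a z) := fun z hz hz' =>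
    hM.out ht (by simp) (by simp) (by simp [hz, hz'])
  by_contra! hcon
  have key : ∀ z, z ≠ a → z ≠ b → (∃ v, v ≠ a ∧ v ≠ b ∧ v ≠ z ∧ r v a ∧ ¬ (r z v ↔ r z a) ∧
      ∀ w, w ≠ a → w ≠ b → w ≠ z → w ≠ v → (r w v ↔ r w a)) ∨
      (r z a ∧ ∀ w, w ≠ a → w ≠ z → r a w) := by
    intro z hza hzb
    obtain ⟨N, hN⟩ := hcon a z hza.symm
    have hsep : ¬ (a ∈ N ↔ z ∈ N) := by
      intro hiff
      have h1 : NT r N := ⟨isMod_of_sflip hN.mod hiff, hN.nontriv, hN.ne_univ⟩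
      rw [hall] at h1
      subst h1
      simp [hza, hzb] at hiff
    have s2 := fun x y w => sflip_uniform (r := r) (a := a) (c := z) (x := x) (y := y) (z := w)
      hN.mod
    have hmz : ∀ n ∈ N, n ≠ a → n ≠ z → ((a ∈ N → ¬ (r z n ↔ r z a)) ∧
        (z ∈ N → ¬ (r a n ↔ r a z))) := by
      intro n hn hna hnz
      rcases ht.total hza with h | h
      · refine ⟨fun haN h1 => ?_, fun hzN h1 => ?_⟩
        · rw [sflip_comm] at hN
          have f1 := sflip_spec_right ht hN.mod (by tauto) haN h n hn hna
          exact ht.asymm f1 (h1.2 h)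
        · rw [sflip_comm] at hN
          have f1 := sflip_spec_left ht hN.mod hzN (by tauto) h n hn hnz
          exact ht.asymm h (h1.1 f1)
      · refine ⟨fun haN h1 => ?_, fun hzN h1 => ?_⟩
        · have f1 := sflip_spec_left ht hN.mod haN (by tauto) h n hn hna
          exact ht.asymm h (h1.1 f1)
        · have f1 := sflip_spec_right ht hN.mod (by tauto) hzN h n hn hnz
          exact ht.asymm f1 (h1.2 h)
    by_cases haN : a ∈ N
    · left
      have hzN : z ∉ N := by tauto
      have hbN : b ∉ N := by
        intro hbN
        apply (hmz b hbN hab.symm hzb.symm).1 haN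
        exact e1 z hzb hza
      have hin : ∀ n ∈ N, n ≠ a → r n a := by
        intro n hn hna
        have f1 := s2 a n b haN hn hbN hab.symm hzb.symm
        have f2 := ht.asymm hba
        have hnb : n ≠ b := by rintro rfl; exact hbN hn
        have f3 := ht.iff_not n b hnb
        have f4 := e1 n hnb hna
        tauto
      have hsub : (N \ {a}).Subsingleton := by
        by_contra hns
        rw [not_subsingleton_iff] at hns
        have hmod : IsMod r (N \ {a}) := by
          intro x hx y hy w hw
          by_cases hwa : w = a
          · subst hwa
            have := ht.asymm (hin x hx.1 hx.2)
            have := ht.asymm (hin y hy.1 hy.2)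
            tauto
          · have hwN : w ∉ N := fun h => hw ⟨h, hwa⟩
            by_cases hwz : w = z
            · subst hwz
              have f1 := (hmz x hx.1 hx.2 (by rintro rfl; exact hwN hx.1)).1 haN
              have f2 := (hmz y hy.1 hy.2 (by rintro rfl; exact hwN hy.1)).1 haN
              tauto
            · exact s2 x y w hx.1 hy.1 hwN hwa hwz
        have hnt : NT r (N \ {a}) := ⟨hmod, hns, fun h => by
          have : a ∈ N \ {a} := h ▸ mem_univ a
          exact this.2 rfl⟩
        rw [hall] at hnt
        have : a ∈ N \ {a} := hnt ▸ (by simp)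
        exact this.2 rfl
      obtain ⟨v, hv, hva⟩ := hN.nontriv.exists_ne a
      have hvz : v ≠ z := by rintro rfl; exact hzN hv
      refine ⟨v, hva, by rintro rfl; exact hbN hv, hvz, hin v hv hva,
        (hmz v hv hva hvz).1 haN, fun w hwa hwb hwz hwv => ?_⟩
      exact s2 v a w hv haN (fun hw => hwv (hsub ⟨hw, hwa⟩ ⟨hv, hva⟩)) hwa hwz
    · right
      have hzN : z ∈ N := by tauto
      have hbN : b ∈ N := by
        by_contra hbN
        obtain ⟨n, hn, hnz⟩ := hN.nontriv.exists_ne z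
        have hna : n ≠ a := by rintro rfl; exact haN hn
        have hnb : n ≠ b := by rintro rfl; exact hbN hn
        apply (hmz n hn hna hnz).2 hzN
        rw [← e2 n hnb hna, ← e2 z hzb hza]
        have f1 := s2 n z b hn hzN hbN hab.symm hzb.symm
        exact f1
      have hu : insert a N = univ := by
        by_contra hne
        have hmod : IsMod r (insert a N) := by
          have hk : ∀ x ∈ insert a N, ∀ w ∉ insert a N, (r w x ↔ r w b) := by
            rintro x (rfl | hx) w hw
            · rw [e1 w (by rintro rfl; exact hw (Or.inr hbN))
                (by rintro rfl; exact hw (Or.inl rfl))]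
            · exact s2 x b w hx hbN (fun h => hw (Or.inr h))
                (by rintro rfl; exact hw (Or.inl rfl)) (by rintro rfl; exact hw (Or.inr hzN))
          intro x hx y hy w hw
          rw [hk x hx w hw, hk y hy w hw]
        have hnt : NT r (insert a N) := ⟨hmod, hN.nontriv.mono (subset_insert _ _), hne⟩
        rw [hall] at hnt
        have : z ∈ insert a N := Or.inr hzN
        rw [hnt] at this
        rcases this with h | h
        · exact hzb h
        · exact hza h
      have hraz : ¬ r a z := by
        have := (hmz b hbN hab.symm hzb.symm).2 hzN
        tauto
      refine ⟨by rcases ht.total hza with h | h <;> tauto, fun w hwa hwz => ?_⟩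
      have hw : w ∈ N := by
        have : w ∈ insert a N := hu ▸ mem_univ w
        exact this.resolve_left hwa
      by_contra hraw
      exact (hmz w hw hwa hwz).2 hzN (iff_of_false hraw hraz)
  by_cases hex : ∃ z, z ≠ a ∧ z ≠ b ∧ r z a ∧ ∀ w, w ≠ a → w ≠ z → r a w
  · obtain ⟨z0, z0a, z0b, h1, h2⟩ := hex
    have key2 : ∀ z, z ≠ a → z ≠ b → z ≠ z0 → ¬ (r z z0 ↔ r z a) ∧
        ∀ w, w ≠ a → w ≠ b → w ≠ z → w ≠ z0 → (r w z0 ↔ r w a) := by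
      intro z hza hzb hzz
      rcases key z hza hzb with ⟨v, hva, hvb, hvz, hv, hv1, hv2⟩ | ⟨hz, -⟩
      · have : v = z0 := by
          by_contra hne
          exact ht.asymm hv (h2 v hva hne)
        subst this
        exact ⟨hv1, hv2⟩
      · exact (ht.asymm hz (h2 z hza hzz)).elim
    obtain ⟨z1, z1a, z1b, z10, -⟩ := hV a b z0 a
    obtain ⟨z2, z2a, z2b, z20, z21⟩ := hV a b z0 z1
    exact (key2 z1 z1a z1b z10).1 ((key2 z2 z2a z2b z20).2 z1 z1a z1b z21.symm z10)
  · have key3 : ∀ z : {z // z ≠ a ∧ z ≠ b}, ∃ v : {v // v ≠ a ∧ v ≠ b}, v.1 ≠ z ∧ r v a ∧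
        ¬ (r z v ↔ r z a) ∧
        ∀ w, w ≠ a → w ≠ b → w ≠ z.1 → w ≠ v.1 → (r w v ↔ r w a) := by
      rintro ⟨z, hza, hzb⟩
      rcases key z hza hzb with ⟨v, hva, hvb, hvz, hv⟩ | ⟨hz, hz'⟩
      · exact ⟨⟨v, hva, hvb⟩, hvz, hv⟩
      · exact (hex ⟨z, hza, hzb, hz, hz'⟩).elim
    choose f hf1 hf2 hf3 hf4 using key3
    -- The vertex z is recovered from v as the only vertex outside the pair, other than v,
    -- distinguishing v from a.
    have hinj : Function.Injective f := by
      intro z z' hzz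
      by_contra hne
      have h4 := hf4 z' z z.2.1 z.2.2 (fun h => hne (Subtype.ext h))
        (fun h => hf1 z (by rw [hzz]; exact h.symm))
      rw [← hzz] at h4
      exact hf3 z h4
    have hsurj := Finite.surjective_of_injective hinj
    have hE : ∀ z, z ≠ a → z ≠ b → r z a := by
      intro z hza hzb
      obtain ⟨y, hy⟩ := hsurj ⟨z, hza, hzb⟩
      have := hf2 y
      rwa [hy] at this
    have hnt : NT r ({a, b}ᶜ) := by
      refine ⟨?_, ?_, fun h => ?_⟩
      · intro x hx y hy z hz
        rw [notMem_compl_iff] at hz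
        simp only [mem_compl_iff, mem_insert_iff, mem_singleton_iff, not_or] at hx hy hz
        have f1 := hE x hx.1 hx.2
        have f2 := hE y hy.1 hy.2
        rcases hz with rfl | rfl
        · exact iff_of_false (ht.asymm f1) (ht.asymm f2)
        · exact iff_of_false (ht.asymm ((e1 x hx.2 hx.1).2 f1))
            (ht.asymm ((e1 y hy.2 hy.1).2 f2))
      · obtain ⟨x, hxa, hxb, -⟩ := hV a b a a
        obtain ⟨y, hya, hyb, hyx, -⟩ := hV a b x a
        exact ⟨x, by simp [hxa, hxb], y, by simp [hya, hyb], hyx.symm⟩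
      · have : a ∈ ({a, b}ᶜ : Set V) := h ▸ mem_univ a
        simp at this
    rw [hall] at hnt
    have : a ∈ ({a, b}ᶜ : Set V) := hnt ▸ (by simp)
    simp at this

theorem exists_sflip_rev (ht : IsTour r)
    (h : ∃ x y, x ≠ y ∧ ∀ N, ¬ NT (sflip (rev r) x y) N) :
    ∃ x y, x ≠ y ∧ ∀ N, ¬ NT (sflip r x y) N := by
  obtain ⟨x, y, hxy, h⟩ := h
  refine ⟨x, y, hxy, fun N hN => h N ?_⟩
  rw [sflip_rev]
  exact (nt_rev ht.sflip).2 hN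

/-- If some module H has at least three vertices, reversing the arc between a and c works unless H
is the complement of {c}: a new module would make H ∪ {c} a nontrivial module containing c. In the
exceptional case c is a source or a sink. If all modules are pairs containing a, there is only one,
because the union of two would be a larger proper module. -/
theorem exists_sflip_of_common (ht : IsTour r) (hV : Large V) [Finite V] (hex : ∃ N, NT r N)
    (ha : ∀ N, NT r N → a ∈ N) (hc : ∀ N, NT r N → c ∉ N) :
    ∃ x y, x ≠ y ∧ ∀ N, ¬ NT (sflip r x y) N := by
  by_cases h3 : ∃ N, NT r N ∧ (N \ {a}).Nontrivial
  · obtain ⟨H, hH, h3⟩ := h3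
    by_cases hc' : ∃ x, x ∉ H ∧ x ≠ c
    · obtain ⟨x, hxH, hxc⟩ := hc'
      refine ⟨a, c, fun h => hc H hH (h ▸ ha H hH), not_nt_sflip
        (fun N hN h => hc N hN (h.1 (ha N hN))) ?_⟩
      intro N hN hNn _
      by_contra hsep
      obtain ⟨h1, -⟩ := new_of_pointed ht hH.mod (ha H hH)
        (fun L hL hLm hLn => ha L ⟨hLm, hLn, fun h => hc H hH (hL (h ▸ mem_univ c))⟩) h3 (hc H hH)
        hN hNn hsep
      refine hc _ ⟨h1, hH.nontriv.mono (subset_insert _ _), fun h => ?_⟩ (mem_insert c H)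
      have : x ∈ insert c H := h ▸ mem_univ x
      exact this.elim hxc hxH
    · push Not at hc'
      have hHm : ∀ x, x ≠ c → x ∈ H := fun x hx => by_contra fun h => hx (hc' x h)
      obtain ⟨y, hy⟩ := hH.nontriv.nonempty
      have hyc : y ≠ c := by rintro rfl; exact hc H hH hy
      rcases ht.total hyc with h | h
      · apply exists_sflip_rev ht
        refine exists_sflip_of_source ht.rev hV (s := c) (a := a) (fun x hx => ?_)
          (fun N hN => hc N ((nt_rev ht).1 hN)) (fun N hN => ha N ((nt_rev ht).1 hN))
        exact (hH.mod.out ht (hHm x hx) hy (hc H hH)).2 h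
      · refine exists_sflip_of_source ht hV (s := c) (a := a) (fun x hx => ?_) hc ha
        exact (hH.mod _ (hHm x hx) _ hy c (hc H hH)).2 h
  · push Not at h3
    obtain ⟨H, hH⟩ := hex
    obtain ⟨b, hba, rfl⟩ := exists_eq_pair (ha H hH) hH.nontriv (by simpa using h3 H hH)
    have hall : ∀ N, NT r N ↔ N = {b, a} := by
      intro N
      refine ⟨fun hN => ?_, by rintro rfl; exact hH⟩
      obtain ⟨b', hba', rfl⟩ := exists_eq_pair (ha N hN) hN.nontriv (by simpa using h3 N hN)
      by_contra hne
      have hbb : b ≠ b' := by rintro rfl; exact hne rfl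
      have hU := hH.mod.union hN.mod (w := a) (by simp) (by simp)
      refine not_nontrivial_iff.2 (h3 _ ⟨hU, hH.nontriv.mono subset_union_left, fun h => ?_⟩)
        ⟨b, by simp [hba], b', by simp [hba'], hbb⟩
      obtain ⟨z, h1, h2, h3, -⟩ := hV a b b' a
      have : z ∈ ({b, a} ∪ {b', a} : Set V) := h ▸ mem_univ z
      simp [h1, h2, h3] at this
    rcases ht.total hba with h | h
    · exact exists_sflip_rev ht (exists_sflip_of_pair ht.rev hV (a := a) (b := b) h
        (fun N => (nt_rev ht).trans (hall N)))
    · exact exists_sflip_of_pair ht hV h hall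

/-- If two vertices separate every nontrivial module, one reversal suffices. -/
theorem exists_sflip_of_two (ht : IsTour r) (hV : Large V) [Finite V] (hex : ∃ N, NT r N)
    (hS : ∀ N, NT r N → ¬ (a ∈ N ↔ c ∈ N)) :
    ∃ x y, x ≠ y ∧ ∀ N, ¬ NT (sflip r x y) N := by
  by_cases h1 : ∀ N, NT r N → a ∈ N
  · exact exists_sflip_of_common ht hV hex h1
      (fun N hN hc => hS N hN (iff_of_true (h1 N hN) hc))
  by_cases h2 : ∀ N, NT r N → c ∈ N
  · exact exists_sflip_of_common ht hV hex h2
      (fun N hN hc => hS N hN (iff_of_true hc (h2 N hN)))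
  push Not at h1 h2
  obtain ⟨Nc, hNc, haNc⟩ := h1
  obtain ⟨Na, hNa, hcNa⟩ := h2
  have hcNc : c ∈ Nc := by have := hS _ hNc; tauto
  have haNa : a ∈ Na := by have := hS _ hNa; tauto
  have hac : a ≠ c := by rintro rfl; exact hcNa haNa
  -- A new module makes M ∪ {c} a module, so it is everything, and gives a vertex q not
  -- distinguished from c after the reversal. Take a further vertex x of M'. If x = q, then a
  -- distinguishes c from x; otherwise q is outside M' and distinguishes them.
  have big : ∀ {a c : V} {M M' : Set V}, a ≠ c → (∀ N, NT r N → ¬ (a ∈ N ↔ c ∈ N)) →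
      NT r M → NT r M' → a ∈ M → c ∉ M → c ∈ M' → a ∉ M' → (M \ {a}).Nontrivial →
      ∃ x y, x ≠ y ∧ ∀ N, ¬ NT (sflip r x y) N := by
    intro a c M M' hac hS hM hM' haM hcM hcM' haM' h3
    refine ⟨a, c, hac, not_nt_sflip hS ?_⟩
    intro N hN hNn _
    by_contra hsep
    obtain ⟨g1, q, hqM, hqa, -, g2, g3⟩ := new_of_pointed ht hM.mod haM
      (fun L hL hLm hLn => by
        have := hS L ⟨hLm, hLn, fun h => hcM (hL (h ▸ mem_univ c))⟩
        have hcL : c ∉ L := fun h => hcM (hL h)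
        tauto) h3 hcM hN hNn hsep
    have hu : insert c M = univ := by
      by_contra hne
      exact hS _ ⟨g1, hM.nontriv.mono (subset_insert _ _), hne⟩
        (iff_of_true (Or.inr haM) (Or.inl rfl))
    obtain ⟨x, hx, hxc⟩ := hM'.nontriv.exists_ne c
    have hxM : x ∈ M := by
      have : x ∈ insert c M := hu ▸ mem_univ x
      exact this.resolve_left hxc
    have hxa : x ≠ a := by rintro rfl; exact haM' hx
    have f1 := hM'.mod c hcM' x hx a haM'
    by_cases hqx : q = x
    · subst hqx
      have := ht.iff_not q a hqa
      tauto
    · have hqM' : q ∉ M' := by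
        intro hq
        refine hS (M ∩ M') ⟨hM.mod.inter hM'.mod, ⟨x, ⟨hxM, hx⟩, q, ⟨hqM, hq⟩, Ne.symm hqx⟩,
          fun h => ?_⟩ (iff_of_false (fun h => haM' h.2) (fun h => hcM h.1))
        have : c ∈ M ∩ M' := h ▸ mem_univ c
        exact hcM this.1
      have f2 := g3 x hxM hxa (Ne.symm hqx)
      have f3 := hM'.mod c hcM' x hx q hqM'
      have f4 := hM.mod.out ht hqM haM hcM
      have f5 := ht.iff_not x q (Ne.symm hqx)
      tauto
  by_cases h3 : (Na \ {a}).Nontrivial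
  · exact big hac hS hNa hNc haNa hcNa hcNc haNc h3
  by_cases h3' : (Nc \ {c}).Nontrivial
  · exact big hac.symm (fun N hN h => hS N hN h.symm) hNc hNa hcNc haNc haNa hcNa h3'
  obtain ⟨p, hpa, rfl⟩ := exists_eq_pair haNa hNa.nontriv h3
  obtain ⟨d, hdc, rfl⟩ := exists_eq_pair hcNc hNc.nontriv h3'
  have hpc : p ≠ c := by rintro rfl; simp at hcNa
  have had : a ≠ d := by rintro rfl; simp at haNc
  have hpd : p ≠ d := by
    rintro rfl
    have hU := hNa.mod.union hNc.mod (w := p) (by simp) (by simp)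
    refine hS _ ⟨hU, hNa.nontriv.mono subset_union_left, fun h => ?_⟩ (by simp)
    obtain ⟨z, h1, h2, h3, -⟩ := hV a p c a
    have : z ∈ ({p, a} ∪ {p, c} : Set V) := h ▸ mem_univ z
    simp [h1, h2, h3] at this
  have hU : ¬ IsMod r {p, a, d, c} := by
    intro hU
    refine hS _ ⟨hU, ⟨p, by simp, a, by simp, hpa⟩, fun h => ?_⟩ (by simp)
    obtain ⟨z, h1, h2, h3, h4⟩ := hV p a d c
    have : z ∈ ({p, a, d, c} : Set V) := h ▸ mem_univ z
    simp [h1, h2, h3, h4] at this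
  refine ⟨a, c, hac, not_nt_sflip hS ?_⟩
  intro N hN hNn _
  by_contra hsep
  rcases ht.total hac with h | h
  · exact hU (new_of_pairs ht hNa.mod hNc.mod hpa hdc hpd hpc had h hN hNn hsep).2.2
  · rw [sflip_comm] at hN
    have := (new_of_pairs ht hNc.mod hNa.mod hdc hpa hpd.symm had.symm hpc.symm h hN hNn
      (fun h => hsep h.symm)).2.2
    apply hU
    rwa [quad_comm]

end TourRel

/-! ### Minimum crossing sets and private modules -/

open Set
namespace TourRel
variable {V : Type u}
variable {r : V → V → Prop} {M N : Set V} {a b c d e f p s t x : V} {A : Finset V}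

/-- The nontrivial module `N` meets `A` in `a` only. -/
structure Priv (r : V → V → Prop) (A : Finset V) (a : V) (N : Set V) : Prop where
  nt : NT r N
  mem : a ∈ N
  eq_of_mem : ∀ x ∈ A, x ∈ N → x = a

/-- `A` is a crossing set of minimum size. -/
def MinCrossing (r : V → V → Prop) (A : Finset V) : Prop :=
  Crossing r A ∧ ∀ A', Crossing r A' → A.card ≤ A'.card

/-- Some nontrivial module splits `A` into `{a, c}` and the rest. -/
def Bad (r : V → V → Prop) (A : Finset V) (a c : V) : Prop :=
  ∃ N, NT r N ∧ ((∀ x ∈ A, x ∈ N ↔ (x = a ∨ x = c)) ∨ (∀ x ∈ A, x ∈ N ↔ ¬ (x = a ∨ x = c)))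

theorem Crossing.eq_univ (hA : Crossing r A) (hM : IsMod r M) (hn : M.Nontrivial)
    (h : ∀ x ∈ A, x ∈ M) : M = univ := by
  by_contra hne
  obtain ⟨-, x, hx, hxM⟩ := hA M ⟨hM, hn, hne⟩
  exact hxM (h x hx)

/-- A nontrivial submodule must meet A, and a is the only element of A available. This is the
hypothesis needed for `new_of_pointed`. -/
theorem Priv.pointed (hA : Crossing r A) (h : Priv r A a M) :
    ∀ L ⊆ M, IsMod r L → L.Nontrivial → a ∈ L := by
  intro L hL hLm hLn
  obtain ⟨⟨x, hx, hxL⟩, -⟩ := hA L ⟨hLm, hLn, fun hu => h.nt.ne_univ (univ_subset_iff.1 (hu ▸ hL))⟩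
  rwa [← h.eq_of_mem x hx (hL hxL)]

/-- By minimality A \ {a} is not crossing. A module witnessing this either misses A \ {a} or
contains it, and the crossing property of A then decides on which side a lies. -/
theorem MinCrossing.priv_or [DecidableEq V] (hA : MinCrossing r A) (ha : a ∈ A) :
    (∃ N, Priv r A a N) ∨ ∃ N, NT r N ∧ a ∉ N ∧ ∀ x ∈ A, x ≠ a → x ∈ N := by
  have hnc : ¬ Crossing r (A.erase a) := fun h => by
    have h1 := hA.2 _ h
    have h2 := Finset.card_erase_lt_of_mem ha
    omega
  simp only [Crossing] at hnc
  push Not at hnc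
  obtain ⟨N, hN, hNA⟩ := hnc
  obtain ⟨⟨x, hx, hxN⟩, ⟨y, hy, hyN⟩⟩ := hA.1 N hN
  by_cases h : ∃ x ∈ A.erase a, x ∈ N
  · right
    have h1 := hNA h
    refine ⟨N, hN, fun haN => hyN ?_, fun z hz hza => h1 z (Finset.mem_erase.2 ⟨hza, hz⟩)⟩
    by_cases hya : y = a
    · exact hya ▸ haN
    · exact h1 y (Finset.mem_erase.2 ⟨hya, hy⟩)
  · left
    push Not at h
    have h1 : ∀ z ∈ A, z ∈ N → z = a := fun z hz hzN =>
      by_contra fun hza => h z (Finset.mem_erase.2 ⟨hza, hz⟩) hzN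
    exact ⟨N, hN, h1 x hx hxN ▸ hxN, h1⟩

/-- Two elements of a minimum crossing set without private module are the source and the sink. -/
theorem MinCrossing.source_sink [DecidableEq V] (ht : IsTour r) (hA : MinCrossing r A)
    (h3 : 3 ≤ A.card) (ha : a ∈ A) (hc : c ∈ A) (hac : r a c) (hpa : ¬ ∃ N, Priv r A a N)
    (hpc : ¬ ∃ N, Priv r A c N) : (∀ x, x ≠ a → r a x) ∧ ∀ x, x ≠ c → r x c := by
  obtain ⟨Na, hNa, haNa, hNaA⟩ := (hA.priv_or ha).resolve_left hpa
  obtain ⟨Nc, hNc, hcNc, hNcA⟩ := (hA.priv_or hc).resolve_left hpc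
  have hne := ht.ne hac
  have haNc := hNcA a ha hne
  have hcNa := hNaA c hc hne.symm
  obtain ⟨b, hb, hba, hbc⟩ : ∃ b ∈ A, b ≠ a ∧ b ≠ c := by
    by_contra! hcon
    have : A ⊆ {a, c} := fun x hx => by
      by_cases hxa : x = a
      · simp [hxa]
      · simp [hcon x hx hxa]
    have := Finset.card_le_card this
    have := Finset.card_le_two (a := a) (b := c)
    omega
  have hU : Na ∪ Nc = univ := by
    refine hA.1.eq_univ (hNa.mod.union hNc.mod (hNaA b hb hba) (hNcA b hb hbc))
      (hNa.nontriv.mono subset_union_left) fun x hx => ?_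
    by_cases hxa : x = a
    · exact Or.inr (hxa ▸ haNc)
    · exact Or.inl (hNaA x hx hxa)
  -- If Nc missed a vertex other than c, then Na \ Nc would be a private module of c. So Nc is the
  -- complement of {c}, and c sees all other vertices alike.
  have sub : ∀ {a c : V} {Na Nc : Set V}, NT r Na → NT r Nc → a ∉ Na → a ∈ Nc → c ∈ Na → c ∉ Nc →
      (∀ x ∈ A, x ≠ c → x ∈ Nc) → (¬ ∃ N, Priv r A c N) → Na ∪ Nc = univ →
      ∀ x, x ≠ c → x ∈ Nc := by
    intro a c Na Nc hNa hNc haNa haNc hcNa hcNc hNcA hpc hU x hxc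
    by_contra hx
    have hxNa : x ∈ Na := by
      have : x ∈ Na ∪ Nc := hU ▸ mem_univ x
      exact this.resolve_right hx
    refine hpc ⟨Na \ Nc, ⟨hNa.mod.diff ht hNc.mod haNc haNa, ⟨x, ⟨hxNa, hx⟩, c, ⟨hcNa, hcNc⟩, hxc⟩,
      fun h => ?_⟩, ⟨hcNa, hcNc⟩, fun y hy hyN => ?_⟩
    · have : a ∈ Na \ Nc := h ▸ mem_univ a
      exact haNa this.1
    · by_contra hyc
      exact hyN.2 (hNcA y hy hyc)
  have hc1 := sub hNa hNc haNa haNc hcNa hcNc hNcA hpc hU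
  have ha1 := sub hNc hNa hcNc hcNa haNc haNa hNaA hpa (by rwa [union_comm])
  exact ⟨fun x hx => (hNa.mod c hcNa x (ha1 x hx) a haNa).1 hac,
    fun x hx => (hNc.mod.out ht haNc (hc1 x hx) hcNc).1 hac⟩

/-! ### Three vertices -/

/-- Every nontrivial module contains one or two of the three vertices. -/
def Cross3 (r : V → V → Prop) (a c e : V) : Prop :=
  ∀ N, NT r N → (a ∈ N ∨ c ∈ N ∨ e ∈ N) ∧ (a ∉ N ∨ c ∉ N ∨ e ∉ N)

/-- After one reversal two vertices separate every nontrivial module. -/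
def ReducesToTwo (r : V → V → Prop) : Prop :=
  ∃ a c x y : V, a ≠ c ∧ ∀ N, NT (sflip r a c) N → ¬ (x ∈ N ↔ y ∈ N)

/-- After reversing the arc between a and c, the vertices c and e separate everything. An old module
with a and c on one side must have e on the other, and a new module is {c, q} with q in M, which
avoids e. -/
theorem reducesToTwo_of_big (ht : IsTour r) (hC : Cross3 r a c e) (hce : c ≠ e)
    (hM : NT r M) (ha : a ∈ M) (hc : c ∉ M) (he : e ∉ M)
    (h3 : (M \ {a}).Nontrivial) : ReducesToTwo r := by
  refine ⟨a, c, c, e, fun h => hc (h ▸ ha), fun N hN hiff => ?_⟩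
  by_cases hsep : a ∈ N ↔ c ∈ N
  · have := hC N ⟨isMod_of_sflip hN.mod hsep, hN.nontriv, hN.ne_univ⟩
    tauto
  · obtain ⟨-, q, hq, -, rfl, -⟩ := new_of_pointed ht hM.mod ha (fun L hL hLm hLn => by
      have h1 := hC L ⟨hLm, hLn, fun h => hc (hL (h ▸ mem_univ c))⟩
      have h2 : c ∉ L := fun h => hc (hL h)
      have h3 : e ∉ L := fun h => he (hL h)
      tauto) h3 hc hN.mod hN.nontriv hsep
    have : e ∈ ({c, q} : Set V) := hiff.1 (by simp)
    rcases this with h | h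
    · exact hce h.symm
    · exact he (h ▸ hq)

/-- Reversing a → c creates no separating module unless p → a and c → d. In that case p → c is
reversed instead: with a and p exchanged the orientation is wrong for a new module. An old module
that still fails to separate c from e would either be distinguished by a, or together with p form a
private module of a that is too large. -/
theorem reducesToTwo_of_pairs (ht : IsTour r) (hC : Cross3 r a c e)
    (hbig : ∀ M, NT r M → a ∈ M → c ∉ M → e ∉ M → ¬ (M \ {a}).Nontrivial)
    (h1 : IsMod r {p, a}) (h2 : IsMod r {d, c}) (hpa : p ≠ a) (hdc : d ≠ c) (hpd : p ≠ d)
    (hpc : p ≠ c) (hpe : p ≠ e) (had : a ≠ d) (hae : a ≠ e) (hr : r a c) : ReducesToTwo r := by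
  by_cases h : r p a ∧ r c d
  · obtain ⟨hpa', hcd⟩ := h
    have hpc' : r p c := (h1.out ht (by simp) (by simp)
      (by simp [hpc.symm, (ht.ne hr).symm])).2 hr
    refine ⟨p, c, c, e, hpc, fun N hN hiff => ?_⟩
    have hsep : p ∈ N ↔ c ∈ N := by
      by_contra hsep
      have := (new_of_pairs ht (p := a) (a := p) (by rwa [pair_comm]) h2 hpa.symm hdc had
        (ht.ne hr) hpd hpc' hN.mod hN.nontriv hsep).1
      exact ht.asymm hpa' this
    have hN' : NT r N := ⟨isMod_of_sflip hN.mod hsep, hN.nontriv, hN.ne_univ⟩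
    have h3 := hC N hN'
    by_cases hpN : p ∈ N
    · have haN : a ∉ N := by tauto
      have := hN'.mod p hpN c (by tauto) a haN
      exact ht.asymm hpa' (this.2 hr)
    · have haN : a ∈ N := by tauto
      have hcN : c ∉ N := by tauto
      obtain ⟨n, hn, hna⟩ := hN'.nontriv.exists_ne a
      refine hbig (N ∪ {p, a}) ⟨hN'.mod.union h1 haN (by simp),
        hN'.nontriv.mono subset_union_left, fun h => ?_⟩ (Or.inl haN) ?_ ?_
        ⟨n, ⟨Or.inl hn, hna⟩, p, ⟨by simp, hpa⟩, by rintro rfl; exact hpN hn⟩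
      · have : c ∈ N ∪ {p, a} := h ▸ mem_univ c
        rcases this with h | h | h
        · exact hcN h
        · exact hpc h.symm
        · exact ht.ne hr h.symm
      · rintro (h | h | h)
        · exact hcN h
        · exact hpc h.symm
        · exact ht.ne hr h.symm
      · rintro (h | h | h)
        · tauto
        · exact hpe h.symm
        · exact hae h.symm
  · refine ⟨a, c, c, e, ht.ne hr, fun N hN hiff => ?_⟩
    have hsep : a ∈ N ↔ c ∈ N := by
      by_contra hsep
      obtain ⟨f1, f2, -⟩ := new_of_pairs ht h1 h2 hpa hdc hpd hpc had hr hN.mod hN.nontriv hsep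
      exact h ⟨f1, f2⟩
    have := hC N ⟨isMod_of_sflip hN.mod hsep, hN.nontriv, hN.ne_univ⟩
    tauto

theorem Cross3.perm1 (h : Cross3 r a c e) : Cross3 r c a e := fun N hN => by
  have := h N hN
  tauto

theorem Cross3.perm2 (h : Cross3 r a c e) : Cross3 r a e c := fun N hN => by
  have := h N hN
  tauto

/-- Two private pairs sharing a vertex end at the source or at the sink. -/
theorem source_or_sink_of_shared (ht : IsTour r) (hC : Cross3 r a c e)
    (hmin : ∃ N, NT r N ∧ (x ∈ N ↔ e ∈ N))
    (hbig : ∀ M, NT r M → a ∈ M → c ∉ M → e ∉ M → ¬ (M \ {a}).Nontrivial)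
    (hbig' : ∀ M, NT r M → c ∈ M → a ∉ M → e ∉ M → ¬ (M \ {c}).Nontrivial)
    (h1 : IsMod r {x, a}) (h2 : IsMod r {x, c}) (hxa : x ≠ a) (hxc : x ≠ c) (hxe : x ≠ e)
    (hae : a ≠ e) (hce : c ≠ e) (hr : r a c) : (∀ z, z ≠ a → r a z) ∨ ∀ z, z ≠ c → r z c := by
  have hac := ht.ne hr
  have hax : r a x := (h2 c (by simp) x (by simp) a (by simp [hac, hxa.symm])).1 hr
  have hxc' : r x c := (h1.out ht (by simp) (by simp) (by simp [hxc.symm, hac.symm])).2 hr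
  -- Here a → x → c. If N contains x and e, then it is the complement of {a} or of {c}, or else the
  -- twin relations orient the arc between e and x both ways. If N avoids them, x distinguishes a
  -- from c, or N with x added is a private module of three vertices.
  obtain ⟨N, hN, hiff⟩ := hmin
  have hCN := hC N hN
  have grow : ∀ {a c : V}, (∀ M, NT r M → a ∈ M → c ∉ M → e ∉ M → ¬ (M \ {a}).Nontrivial) →
      IsMod r {x, a} → x ≠ a → x ≠ c → a ≠ c → a ≠ e → a ∈ N → c ∉ N → x ∉ N → e ∉ N → False := by
    intro a c hbig h1 hxa hxc hac hae haN hcN hxN heN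
    obtain ⟨n, hn, hna⟩ := hN.nontriv.exists_ne a
    have hcU : c ∉ N ∪ {x, a} := by
      rintro (h | h | h)
      · exact hcN h
      · exact hxc h.symm
      · exact hac h.symm
    refine hbig (N ∪ {x, a}) ⟨hN.mod.union h1 haN (by simp),
      hN.nontriv.mono subset_union_left, fun h => hcU (h ▸ mem_univ c)⟩ (Or.inl haN) hcU ?_
      ⟨n, ⟨Or.inl hn, hna⟩, x, ⟨by simp, hxa⟩, by rintro rfl; exact hxN hn⟩
    rintro (h | h | h)
    · exact heN h
    · exact hxe h.symm
    · exact hae h.symm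
  by_cases hxN : x ∈ N
  · have heN := hiff.1 hxN
    by_cases haN : a ∈ N
    · right
      have hcN : c ∉ N := by tauto
      have hU : ∀ z, z ≠ c → z ∈ N := by
        have hm := hN.mod.union h2 hxN (by simp)
        have hu : N ∪ {x, c} = univ := by
          by_contra hne
          have := hC _ ⟨hm, hN.nontriv.mono subset_union_left, hne⟩
          simp [haN, heN] at this
        intro z hz
        have : z ∈ N ∪ {x, c} := hu ▸ mem_univ z
        rcases this with h | h | h
        · exact h
        · exact h ▸ hxN
        · exact (hz h).elim
      exact fun z hz => (hN.mod.out ht haN (hU z hz) hcN).1 hr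
    · by_cases hcN : c ∈ N
      · left
        have hU : ∀ z, z ≠ a → z ∈ N := by
          have hm := hN.mod.union h1 hxN (by simp)
          have hu : N ∪ {x, a} = univ := by
            by_contra hne
            have := hC _ ⟨hm, hN.nontriv.mono subset_union_left, hne⟩
            simp [hcN, heN] at this
          intro z hz
          have : z ∈ N ∪ {x, a} := hu ▸ mem_univ z
          rcases this with h | h | h
          · exact h
          · exact h ▸ hxN
          · exact (hz h).elim
        exact fun z hz => (hN.mod c hcN z (hU z hz) a haN).1 hr
      · exfalso
        have f1 := (hN.mod x hxN e heN a haN).1 hax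
        have f2 := (hN.mod.out ht hxN heN hcN).1 hxc'
        have f3 := (h1.out ht (x := x) (y := a) (z := e) (by simp) (by simp)
          (by simp [hxe.symm, hae.symm])).2 f1
        have f4 := (h2 c (by simp) x (by simp) e (by simp [hxe.symm, hce.symm])).1 f2
        exact ht.asymm f3 f4
  · exfalso
    have heN : e ∉ N := by tauto
    by_cases haN : a ∈ N
    · by_cases hcN : c ∈ N
      · have := (hN.mod.out ht haN hcN hxN).1 hax
        exact ht.asymm hxc' this
      · exact grow hbig h1 hxa hxc hac hae haN hcN hxN heN
    · have hcN : c ∈ N := by tauto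
      exact grow hbig' h2 hxc hxa hac.symm hce hcN haN hxN heN

/-- The remaining part below a source `a` and two of its successors `x`, `c` is a module. -/
theorem nt_of_shared_source (ht : IsTour r) (hV : Large V) (h1 : IsMod r {x, a})
    (h2 : IsMod r {x, c}) (hs : ∀ z, z ≠ a → r a z) : NT r {a, x, c}ᶜ ∧
      ∀ z, z ≠ a → z ≠ x → z ≠ c → r c z := by
  have f1 : ∀ z, z ≠ a → z ≠ x → r x z := fun z hza hzx =>
    (h1.out ht (x := x) (y := a) (z := z) (by simp) (by simp) (by simp [hza, hzx])).2 (hs z hza)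
  have f2 : ∀ z, z ≠ a → z ≠ x → z ≠ c → r c z := fun z hza hzx hzc =>
    (h2.out ht (x := x) (y := c) (z := z) (by simp) (by simp) (by simp [hzx, hzc])).1 (f1 z hza hzx)
  refine ⟨⟨?_, ?_, fun h => ?_⟩, f2⟩
  · intro u hu v hv z hz
    rw [notMem_compl_iff] at hz
    simp only [mem_compl_iff, mem_insert_iff, mem_singleton_iff, not_or] at hu hv hz
    rcases hz with rfl | rfl | rfl
    · exact iff_of_true (hs u hu.1) (hs v hv.1)
    · exact iff_of_true (f1 u hu.1 hu.2.1) (f1 v hv.1 hv.2.1)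
    · exact iff_of_true (f2 u hu.1 hu.2.1 hu.2.2) (f2 v hv.1 hv.2.1 hv.2.2)
  · obtain ⟨u, ha, hx, hc, -⟩ := hV a x c a
    obtain ⟨v, ha', hx', hc', hvu⟩ := hV a x c u
    exact ⟨u, by simp [ha, hx, hc], v, by simp [ha', hx', hc'], hvu.symm⟩
  · have : a ∈ ({a, x, c}ᶜ : Set V) := h ▸ mem_univ a
    simp at this

theorem ReducesToTwo.of_rev (ht : IsTour r) (h : ReducesToTwo (rev r)) : ReducesToTwo r := by
  obtain ⟨a, c, x, y, hac, h⟩ := h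
  refine ⟨a, c, x, y, hac, fun N hN => h N ?_⟩
  rw [sflip_rev]
  exact (nt_rev ht.sflip).2 hN

/-- Below a, x and c the remaining vertices form a module, private to e and hence a pair {g, e}. It
is disjoint from {x, c}, so the case of disjoint pairs applies with c and e. -/
theorem reducesToTwo_of_source (ht : IsTour r) (hV : Large V) (hC : Cross3 r a c e)
    (hbig : ∀ M, NT r M → c ∈ M → a ∉ M → e ∉ M → ¬ (M \ {c}).Nontrivial)
    (hbige : ∀ M, NT r M → e ∈ M → a ∉ M → c ∉ M → ¬ (M \ {e}).Nontrivial)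
    (h1 : IsMod r {x, a}) (h2 : IsMod r {x, c}) (hxa : x ≠ a) (hxc : x ≠ c) (hxe : x ≠ e)
    (hac : a ≠ c) (hae : a ≠ e) (hce : c ≠ e) (hs : ∀ z, z ≠ a → r a z) : ReducesToTwo r := by
  obtain ⟨hR, hcz⟩ := nt_of_shared_source ht hV h1 h2 hs
  have heR : e ∈ ({a, x, c}ᶜ : Set V) := by simp [hxe.symm, hae.symm, hce.symm]
  obtain ⟨g, hge, hg⟩ := exists_eq_pair heR hR.nontriv
    (hbige _ hR heR (by simp) (by simp))
  have hgR : g ∈ ({a, x, c}ᶜ : Set V) := by rw [hg]; simp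
  simp only [mem_compl_iff, mem_insert_iff, mem_singleton_iff, not_or] at hgR
  have hgm : IsMod r {g, e} := hg ▸ hR.mod
  exact reducesToTwo_of_pairs (a := c) (c := e) (e := a) ht hC.perm1.perm2
    (fun M hM h1 h2 h3 => hbig M hM h1 h3 h2) h2 hgm hxc hge (Ne.symm hgR.2.1) hxe hxa
    (Ne.symm hgR.2.2) hac.symm (hcz e hae.symm hxe.symm hce.symm)

theorem Cross3.of_rev (ht : IsTour r) (h : Cross3 r a c e) : Cross3 (rev r) a c e :=
  fun N hN => h N ((nt_rev ht).1 hN)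

/-- Three separating vertices, two of which lie in private pairs. -/
theorem reducesToTwo_of_two_pairs (ht : IsTour r) (hV : Large V) (hC : Cross3 r a c e)
    (hmin : ∀ x, ∃ N, NT r N ∧ (x ∈ N ↔ e ∈ N))
    (hbig : ∀ M, NT r M → a ∈ M → c ∉ M → e ∉ M → ¬ (M \ {a}).Nontrivial)
    (hbig' : ∀ M, NT r M → c ∈ M → a ∉ M → e ∉ M → ¬ (M \ {c}).Nontrivial)
    (hbige : ∀ M, NT r M → e ∈ M → a ∉ M → c ∉ M → ¬ (M \ {e}).Nontrivial)
    (h1 : IsMod r {p, a}) (h2 : IsMod r {d, c}) (hpa : p ≠ a) (hdc : d ≠ c)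
    (hpc : p ≠ c) (hpe : p ≠ e) (hda : d ≠ a) (hde : d ≠ e) (hae : a ≠ e) (hce : c ≠ e)
    (hr : r a c) : ReducesToTwo r := by
  by_cases hpd : p = d
  · subst hpd
    rcases source_or_sink_of_shared ht hC (hmin p) hbig hbig' h1 h2 hpa hpc hpe hae hce hr with
      hs | hs
    · exact reducesToTwo_of_source ht hV hC hbig' hbige h1 h2 hpa hpc hpe (ht.ne hr) hae hce hs
    · refine ReducesToTwo.of_rev ht (reducesToTwo_of_source (a := c) (c := a) (e := e) (x := p)
        ht.rev hV (hC.perm1.of_rev ht)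
        (fun M hM => hbig M ((nt_rev ht).1 hM))
        (fun M hM h3 h4 h5 => hbige M ((nt_rev ht).1 hM) h3 h5 h4) ((isMod_rev ht).2 h2)
        ((isMod_rev ht).2 h1) hpc hpa hpe (ht.ne hr).symm hce hae hs)
  · exact reducesToTwo_of_pairs ht hC hbig h1 h2 hpa hdc hpd hpc hpe hda.symm hae hr

theorem reducesToTwo_of_two_priv (ht : IsTour r) (hV : Large V) (hC : Cross3 r a c e)
    (hmin : ∀ x y, ∃ N, NT r N ∧ (x ∈ N ↔ y ∈ N)) (hac : a ≠ c) (hae : a ≠ e) (hce : c ≠ e)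
    (ha : ∃ M, NT r M ∧ a ∈ M ∧ c ∉ M ∧ e ∉ M) (hc : ∃ M, NT r M ∧ c ∈ M ∧ a ∉ M ∧ e ∉ M) :
    ReducesToTwo r := by
  by_cases hbig : ∃ M, NT r M ∧ a ∈ M ∧ c ∉ M ∧ e ∉ M ∧ (M \ {a}).Nontrivial
  · obtain ⟨M, hM, h1, h2, h3, h4⟩ := hbig
    exact reducesToTwo_of_big ht hC hce hM h1 h2 h3 h4
  by_cases hbig' : ∃ M, NT r M ∧ c ∈ M ∧ a ∉ M ∧ e ∉ M ∧ (M \ {c}).Nontrivial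
  · obtain ⟨M, hM, h1, h2, h3, h4⟩ := hbig'
    exact reducesToTwo_of_big ht hC.perm1 hae hM h1 h2 h3 h4
  by_cases hbige : ∃ M, NT r M ∧ e ∈ M ∧ a ∉ M ∧ c ∉ M ∧ (M \ {e}).Nontrivial
  · obtain ⟨M, hM, h1, h2, h3, h4⟩ := hbige
    exact reducesToTwo_of_big ht hC.perm2.perm1 hac hM h1 h2 h3 h4
  replace hbig : ∀ M, NT r M → a ∈ M → c ∉ M → e ∉ M → ¬ (M \ {a}).Nontrivial :=
    fun M h1 h2 h3 h4 h5 => hbig ⟨M, h1, h2, h3, h4, h5⟩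
  replace hbig' : ∀ M, NT r M → c ∈ M → a ∉ M → e ∉ M → ¬ (M \ {c}).Nontrivial :=
    fun M h1 h2 h3 h4 h5 => hbig' ⟨M, h1, h2, h3, h4, h5⟩
  replace hbige : ∀ M, NT r M → e ∈ M → a ∉ M → c ∉ M → ¬ (M \ {e}).Nontrivial :=
    fun M h1 h2 h3 h4 h5 => hbige ⟨M, h1, h2, h3, h4, h5⟩
  obtain ⟨M, hM, haM, hcM, heM⟩ := ha
  obtain ⟨M', hM', hcM', haM', heM'⟩ := hc
  obtain ⟨p, hpa, rfl⟩ := exists_eq_pair haM hM.nontriv (hbig M hM haM hcM heM)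
  obtain ⟨d, hdc, rfl⟩ := exists_eq_pair hcM' hM'.nontriv (hbig' _ hM' hcM' haM' heM')
  simp only [mem_insert_iff, mem_singleton_iff, not_or] at hcM heM haM' heM'
  rcases ht.total hac with h | h
  · exact reducesToTwo_of_two_pairs ht hV hC (fun x => hmin x e) hbig hbig' hbige hM.mod hM'.mod
      hpa hdc (Ne.symm hcM.1) (Ne.symm heM.1) (Ne.symm haM'.1) (Ne.symm heM'.1) hae hce h
  · exact reducesToTwo_of_two_pairs ht hV hC.perm1 (fun x => hmin x e) hbig' hbig
      (fun M hM h1 h2 h3 => hbige M hM h1 h3 h2) hM'.mod hM.mod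
      hdc hpa (Ne.symm haM'.1) (Ne.symm heM'.1) (Ne.symm hcM.1) (Ne.symm heM.1) hce hae h

theorem nt_compl_source_sink (ht : IsTour r) (hV : Large V) (hs : ∀ x, x ≠ s → r s x)
    (hk : ∀ x, x ≠ t → r x t) : NT r {s, t}ᶜ := by
  refine ⟨?_, ?_, fun h => ?_⟩
  · intro u hu v hv z hz
    rw [notMem_compl_iff] at hz
    simp only [mem_compl_iff, mem_insert_iff, mem_singleton_iff, not_or] at hu hv hz
    rcases hz with rfl | rfl
    · exact iff_of_true (hs u hu.1) (hs v hv.1)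
    · exact iff_of_false (ht.asymm (hk u hu.2)) (ht.asymm (hk v hv.2))
  · obtain ⟨u, h1, h2, -⟩ := hV s t s t
    obtain ⟨v, h3, h4, h5, -⟩ := hV s t u s
    exact ⟨u, by simp [h1, h2], v, by simp [h3, h4], h5.symm⟩
  · have : s ∈ ({s, t}ᶜ : Set V) := h ▸ mem_univ s
    simp at this

/-- All vertices other than the source and the sink form a private module of e with at least three
vertices. -/
theorem reducesToTwo_of_source_sink (ht : IsTour r) (hV : Large V) (hC : Cross3 r a c e)
    (hac : a ≠ c) (hae : a ≠ e) (hce : c ≠ e)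
    (hs : ∀ x, x ≠ a → r a x) (hk : ∀ x, x ≠ c → r x c) : ReducesToTwo r := by
  refine reducesToTwo_of_big ht hC.perm2.perm1 hac (nt_compl_source_sink ht hV hs hk)
    (by simp [hae.symm, hce.symm]) (by simp) (by simp) ?_
  obtain ⟨u, h1, h2, h3, -⟩ := hV a c e a
  obtain ⟨v, h4, h5, h6, h7⟩ := hV a c e u
  exact ⟨u, by simp [h1, h2, h3], v, by simp [h4, h5, h6], h7.symm⟩

/-- Among three vertices, two have private modules or two have none. The latter two are the source
and the sink. -/
theorem reducesToTwo_of_card_eq_three [DecidableEq V] (ht : IsTour r) (hV : Large V)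
    (hA : MinCrossing r A) (h3 : A.card = 3) : ReducesToTwo r := by
  obtain ⟨a, c, e, hac, hae, hce, rfl⟩ := Finset.card_eq_three.1 h3
  have hC : Cross3 r a c e := fun N hN => by
    have := hA.1 N hN
    simpa using this
  have hmin : ∀ x y, ∃ N, NT r N ∧ (x ∈ N ↔ y ∈ N) := by
    intro x y
    by_contra! hcon
    have h1 : Crossing r {x, y} := fun N hN => by
      have := hcon N hN
      simp only [Finset.mem_insert, Finset.mem_singleton, exists_eq_or_imp, exists_eq_left]
      tauto
    have h2 := hA.2 _ h1
    have := Finset.card_le_two (a := x) (b := y)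
    omega
  have hP : ∀ {x y z : V}, ({x, y, z} : Finset V) = {a, c, e} → x ≠ y → x ≠ z →
      (∃ N, Priv r {a, c, e} x N) → ∃ M, NT r M ∧ x ∈ M ∧ y ∉ M ∧ z ∉ M := by
    rintro x y z hxyz hxy hxz ⟨N, hN⟩
    rw [← hxyz] at hN
    exact ⟨N, hN.nt, hN.mem, fun h => hxy (hN.eq_of_mem y (by simp) h).symm,
      fun h => hxz (hN.eq_of_mem z (by simp) h).symm⟩
  have e1 : ({a, e, c} : Finset V) = {a, c, e} := by grind
  have e2 : ({c, a, e} : Finset V) = {a, c, e} := by grind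
  have e3 : ({c, e, a} : Finset V) = {a, c, e} := by grind
  have e4 : ({e, a, c} : Finset V) = {a, c, e} := by grind
  have e5 : ({e, c, a} : Finset V) = {a, c, e} := by grind
  have hss : ∀ {x y z : V}, x ≠ y → x ≠ z → y ≠ z → ({x, y, z} : Finset V) = {a, c, e} →
      Cross3 r x y z → (¬ ∃ N, Priv r {a, c, e} x N) → (¬ ∃ N, Priv r {a, c, e} y N) →
      ReducesToTwo r := by
    intro x y z hxy hxz hyz hset hC hx hy
    have hxA : x ∈ ({a, c, e} : Finset V) := by rw [← hset]; simp
    have hyA : y ∈ ({a, c, e} : Finset V) := by rw [← hset]; simp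
    rcases ht.total hxy with h | h
    · obtain ⟨h1, h2⟩ := hA.source_sink ht h3.ge hxA hyA h hx hy
      exact reducesToTwo_of_source_sink ht hV hC hxy hxz hyz h1 h2
    · obtain ⟨h1, h2⟩ := hA.source_sink ht h3.ge hyA hxA h hy hx
      exact reducesToTwo_of_source_sink ht hV hC.perm1 hxy.symm hyz hxz h1 h2
  by_cases pa : ∃ N, Priv r {a, c, e} a N
  · by_cases pc : ∃ N, Priv r {a, c, e} c N
    · exact reducesToTwo_of_two_priv ht hV hC hmin hac hae hce (hP rfl hac hae pa)
        (hP e2 hac.symm hce pc)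
    · by_cases pe : ∃ N, Priv r {a, c, e} e N
      · exact reducesToTwo_of_two_priv ht hV hC.perm2 hmin hae hac hce.symm (hP e1 hae hac pa)
          (hP e4 hae.symm hce.symm pe)
      · exact hss hce hac.symm hae.symm e3 hC.perm1.perm2 pc pe
  · by_cases pc : ∃ N, Priv r {a, c, e} c N
    · by_cases pe : ∃ N, Priv r {a, c, e} e N
      · exact reducesToTwo_of_two_priv ht hV hC.perm1.perm2 hmin hce hac.symm hae.symm
          (hP e3 hce hac.symm pc) (hP e5 hce.symm hae.symm pe)
      · exact hss hae hac hce.symm e1 hC.perm2 pa pe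
    · exact hss hac hae hce rfl hC pa pc

end TourRel

/-! ### Four or more crossing vertices: one reversal removes two of them -/

open Set
namespace TourRel
variable {V : Type u}
variable {r : V → V → Prop} {M N M' : Set V} {a b c d e f p s t x : V} {A : Finset V}

/-- The modules after the reversal are old ones with a and c on the same side. Deleting a and c from
A spoils the crossing property only at a module that cuts A into {a, c} and the rest. -/
theorem crossing_sflip [DecidableEq V] (hA : Crossing r A)
    (hb : ¬ Bad r A a c)
    (h : ∀ N, IsMod (sflip r a c) N → N.Nontrivial → (a ∈ N ↔ c ∈ N)) :
    Crossing (sflip r a c) ((A.erase a).erase c) := by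
  intro N hN
  have hac := h N hN.mod hN.nontriv
  have hN' : NT r N := ⟨isMod_of_sflip hN.mod hac, hN.nontriv, hN.ne_univ⟩
  obtain ⟨⟨x, hx, hxN⟩, y, hy, hyN⟩ := hA N hN'
  simp only [Finset.mem_erase]
  constructor
  · by_contra! hcon
    refine hb ⟨N, hN', Or.inl fun z hz => ⟨fun hzN => ?_, ?_⟩⟩
    · by_contra! hz'
      exact hcon z ⟨hz'.2, hz'.1, hz⟩ hzN
    · have haN : a ∈ N := by
        by_contra haN
        exact hcon x ⟨by grind, by grind, hx⟩ hxN
      rintro (rfl | rfl)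
      · exact haN
      · exact hac.1 haN
  · by_contra! hcon
    refine hb ⟨N, hN', Or.inr fun z hz => ⟨?_, fun hz' => ?_⟩⟩
    · have haN : a ∉ N := by
        intro haN
        exact hyN (by
          by_cases hya : y = a
          · exact hya ▸ haN
          · by_cases hyc : y = c
            · exact hyc ▸ hac.1 haN
            · exact hcon y ⟨hyc, hya, hy⟩)
      rintro hzN (rfl | rfl)
      · exact haN hzN
      · exact haN (hac.2 hzN)
    · exact hcon z ⟨by tauto, by tauto, hz⟩

/-- Each hypothesis makes one half of a splitting of the four vertices into two pairs a module of
the four-vertex tournament. Pairs taken from the three different splittings form a triangle or a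
star, and neither can consist of modules. -/
theorem not_bad_three (ht : IsTour r) (hac : a ≠ c) (hae : a ≠ e) (haf : a ≠ f) (hce : c ≠ e)
    (hcf : c ≠ f) (hef : e ≠ f) (ha : a ∈ A) (hc : c ∈ A) (he : e ∈ A) (hf : f ∈ A)
    (h1 : Bad r A a c) (h2 : Bad r A a e) (h3 : Bad r A a f) : False := by
  have key : ∀ {x y z w : V}, x ∈ A → y ∈ A → z ∈ A → w ∈ A → x ≠ y → x ≠ z → x ≠ w → y ≠ z →
      y ≠ w → z ≠ w → Bad r A x y →
      ((r z x ↔ r z y) ∧ (r w x ↔ r w y)) ∨ ((r x z ↔ r x w) ∧ (r y z ↔ r y w)) := by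
    rintro x y z w hx hy hz hw h1 h2 h3 h4 h5 h6 ⟨N, hN, h | h⟩
    · have e1 : x ∈ N := (h x hx).2 (Or.inl rfl)
      have e2 : y ∈ N := (h y hy).2 (Or.inr rfl)
      have e3 : z ∉ N := by rw [h z hz]; tauto
      have e4 : w ∉ N := by rw [h w hw]; tauto
      exact Or.inl ⟨hN.mod x e1 y e2 z e3, hN.mod x e1 y e2 w e4⟩
    · have e1 : x ∉ N := by rw [h x hx]; tauto
      have e2 : y ∉ N := by rw [h y hy]; tauto
      have e3 : z ∈ N := by rw [h z hz]; tauto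
      have e4 : w ∈ N := by rw [h w hw]; tauto
      exact Or.inr ⟨hN.mod z e3 w e4 x e1, hN.mod z e3 w e4 y e2⟩
  have k1 := key ha hc he hf hac hae haf hce hcf hef h1
  have k2 := key ha he hc hf hae hac haf hce.symm hef hcf h2
  have k3 := key ha hf hc he haf hac hae hcf.symm hef.symm hce h3
  have t1 := ht.iff_not a c hac
  have t2 := ht.iff_not a e hae
  have t3 := ht.iff_not a f haf
  have t4 := ht.iff_not c e hce
  have t5 := ht.iff_not c f hcf
  have t6 := ht.iff_not e f hef
  clear key h1 h2 h3
  grind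

theorem exists_third (h3 : 3 ≤ A.card) (a c : V) : ∃ b ∈ A, b ≠ a ∧ b ≠ c := by
  classical
  by_contra! hcon
  have : A ⊆ {a, c} := fun x hx => by
    by_cases hxa : x = a
    · simp [hxa]
    · simp [hcon x hx hxa]
  have := Finset.card_le_card this
  have := Finset.card_le_two (a := a) (b := c)
  omega

theorem bad_of_mod (h3 : 3 ≤ A.card) (hac : a ≠ c) (hN : IsMod r N) (ha : a ∈ N)
    (hc : c ∈ N) (h : ∀ x ∈ A, x ∈ N → x = a ∨ x = c) : Bad r A a c := by
  obtain ⟨b, hb, hba, hbc⟩ := exists_third h3 a c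
  refine ⟨N, ⟨hN, ⟨a, ha, c, hc, hac⟩, fun hu => ?_⟩, Or.inl fun x hx => ⟨h x hx, ?_⟩⟩
  · have := h b hb (hu ▸ mem_univ b)
    tauto
  · rintro (rfl | rfl)
    · exact ha
    · exact hc

/-- Reversing the arc between two vertices with private modules creates no module separating
them. -/
theorem Priv.not_new (ht : IsTour r) (hA : Crossing r A) (h3 : 3 ≤ A.card) (ha : a ∈ A)
    (hc : c ∈ A) (hac : a ≠ c) (hb : ¬ Bad r A a c) (hM : Priv r A a M) (hM' : Priv r A c M')
    (hN : IsMod (sflip r a c) N) (hNn : N.Nontrivial) : a ∈ N ↔ c ∈ N := by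
  by_contra hsep
  have hcM : c ∉ M := fun h => hac (hM.eq_of_mem c hc h).symm
  have haM' : a ∉ M' := fun h => hac (hM'.eq_of_mem a ha h)
  by_cases h : (M \ {a}).Nontrivial
  · have := (new_of_pointed ht hM.nt.mod hM.mem (hM.pointed hA) h hcM hN hNn hsep).1
    refine hb (bad_of_mod h3 hac this (Or.inr hM.mem) (Or.inl rfl) ?_)
    rintro x hx (rfl | hxM)
    · exact Or.inr rfl
    · exact Or.inl (hM.eq_of_mem x hx hxM)
  by_cases h' : (M' \ {c}).Nontrivial
  · rw [sflip_comm] at hN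
    have := (new_of_pointed ht hM'.nt.mod hM'.mem (hM'.pointed hA) h' haM' hN hNn
      (fun h => hsep h.symm)).1
    refine hb (bad_of_mod h3 hac this (Or.inl rfl) (Or.inr hM'.mem) ?_)
    rintro x hx (rfl | hxM)
    · exact Or.inl rfl
    · exact Or.inr (hM'.eq_of_mem x hx hxM)
  obtain ⟨p, hpa, rfl⟩ := exists_eq_pair hM.mem hM.nt.nontriv h
  obtain ⟨d, hdc, rfl⟩ := exists_eq_pair hM'.mem hM'.nt.nontriv h'
  simp only [mem_insert_iff, mem_singleton_iff, not_or] at hcM haM'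
  have hpA : p ∉ A := fun h => hpa (hM.eq_of_mem p h (by simp))
  have hdA : d ∉ A := fun h => hdc (hM'.eq_of_mem d h (by simp))
  by_cases hpd : p = d
  · subst hpd
    refine hb (bad_of_mod h3 hac (hM.nt.mod.union hM'.nt.mod (w := p) (by simp) (by simp))
      (by simp) (by simp) ?_)
    rintro x hx h
    simp only [mem_union, mem_insert_iff, mem_singleton_iff] at h
    rcases h with (rfl | h) | (rfl | h) <;> tauto
  have hq : IsMod r {p, a, d, c} := by
    rcases ht.total hac with h | h
    · exact (new_of_pairs ht hM.nt.mod hM'.nt.mod hpa hdc hpd (Ne.symm hcM.1) haM'.1 h hN hNn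
        hsep).2.2
    · rw [sflip_comm] at hN
      rw [quad_comm]
      exact (new_of_pairs ht hM'.nt.mod hM.nt.mod hdc hpa (Ne.symm hpd) (Ne.symm haM'.1) hcM.1 h
        hN hNn (fun h => hsep h.symm)).2.2
  refine hb (bad_of_mod h3 hac hq (by simp) (by simp) ?_)
  rintro x hx h
  simp only [mem_insert_iff, mem_singleton_iff] at h
  rcases h with rfl | h | rfl | h <;> tauto

theorem Crossing.source_mem (hA : Crossing r A) (hV : Large V) (hs : ∀ x, x ≠ s → r s x) :
    s ∈ A := by
  obtain ⟨-, x, hx, hxs⟩ := hA _ (nt_compl_source hV hs)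
  rw [notMem_compl_iff] at hxs
  exact (mem_singleton_iff.1 hxs) ▸ hx

theorem Crossing.sink_mem (ht : IsTour r) (hA : Crossing r A) (hV : Large V)
    (hs : ∀ x, x ≠ s → r x s) : s ∈ A :=
  Crossing.source_mem (r := rev r) ((crossing_rev ht).2 hA) hV hs

theorem bad_source_sink (ht : IsTour r) (hV : Large V) (hs : ∀ x, x ≠ s → r s x)
    (hk : ∀ x, x ≠ t → r x t) : Bad r A s t :=
  ⟨_, nt_compl_source_sink ht hV hs hk, Or.inr fun x _ => by simp⟩

/-- After one reversal there is a crossing set smaller by two. -/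
def Reduces (r : V → V → Prop) (A : Finset V) : Prop :=
  ∃ (a c : V) (A' : Finset V), a ≠ c ∧ Crossing (sflip r a c) A' ∧ A'.card + 2 ≤ A.card

theorem card_erase_erase [DecidableEq V] (ha : a ∈ A) (hc : c ∈ A) (hac : a ≠ c) :
    ((A.erase a).erase c).card + 2 ≤ A.card := by
  have h1 := Finset.card_erase_of_mem ha
  have h2 := Finset.card_erase_of_mem (Finset.mem_erase.2 ⟨hac.symm, hc⟩)
  have h3 : 0 < A.card := Finset.card_pos.2 ⟨a, ha⟩
  have h4 : 0 < (A.erase a).card := Finset.card_pos.2 ⟨c, Finset.mem_erase.2 ⟨hac.symm, hc⟩⟩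
  omega

theorem mod_eq_univ_of_source_sink (ht : IsTour r) (hN : IsMod r N) (hs : ∀ x, x ≠ s → r s x)
    (hk : ∀ x, x ≠ t → r x t) (hsN : s ∈ N) (htN : t ∈ N) : N = univ := by
  refine eq_univ_of_forall fun x => by_contra fun hx => ?_
  have h1 := hs x (by rintro rfl; exact hx hsN)
  have h2 := hk x (by rintro rfl; exact hx htN)
  exact ht.asymm h2 ((hN.out ht hsN htN hx).1 h1)

theorem reduces_of_source_sink [DecidableEq V] (ht : IsTour r) (hV : Large V)
    (hA : MinCrossing r A) (h4 : 4 ≤ A.card) (hs : ∀ x, x ≠ s → r s x)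
    (hk : ∀ x, x ≠ t → r x t) : Reduces r A := by
  have hsA := hA.1.source_mem hV hs
  have htA := hA.1.sink_mem ht hV hk
  have hst : s ≠ t := by
    rintro rfl
    obtain ⟨z, hz, -⟩ := hV s s s s
    exact ht.asymm (hs z hz) (hk z hz)
  -- The pair s, t is itself bad, so by `not_bad_three` s cannot also be bad with two further
  -- elements of A.
  obtain ⟨a, haA, has, hat, hb⟩ : ∃ a ∈ A, a ≠ s ∧ a ≠ t ∧ ¬ Bad r A s a := by
    obtain ⟨a, ha, has, hat⟩ := exists_third (by omega) s t (A := A)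
    have h5 := Finset.card_erase_of_mem ha
    obtain ⟨c, hc, hcs, hct⟩ := exists_third (A := A.erase a) (by omega) s t
    rw [Finset.mem_erase] at hc
    by_contra! hcon
    exact not_bad_three ht hst has.symm hcs.symm hat.symm hct.symm hc.1.symm hsA htA ha hc.2
      (bad_source_sink ht hV hs hk) (hcon a ha has hat) (hcon c hc.2 hcs hct)
  have hP : ∃ N, Priv r A a N := by
    refine (hA.priv_or haA).resolve_right ?_
    rintro ⟨N, hN, haN, hNA⟩
    exact hN.ne_univ (mod_eq_univ_of_source_sink ht hN.mod hs hk (hNA s hsA has.symm)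
      (hNA t htA hat.symm))
  by_cases hbig : ∃ N, Priv r A a N ∧ (N \ {a}).Nontrivial
  · obtain ⟨M, hM, h3⟩ := hbig
    have hsM : s ∉ M := fun h => has (hM.eq_of_mem s hsA h).symm
    refine ⟨a, s, _, has, crossing_sflip hA.1 (c := s) ?_ ?_, card_erase_erase haA hsA has⟩
    · rintro ⟨N, hN⟩
      exact hb ⟨N, by simpa only [or_comm] using hN⟩
    · intro N hN hNn
      by_contra hsep
      have := (new_of_pointed ht hM.nt.mod hM.mem (hM.pointed hA.1) h3 hsM hN hNn hsep).1
      refine hb (bad_of_mod (by omega) has.symm this (Or.inl rfl) (Or.inr hM.mem) ?_)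
      rintro x hx (rfl | hxM)
      · exact Or.inl rfl
      · exact Or.inr (hM.eq_of_mem x hx hxM)
  · push Not at hbig
    obtain ⟨M, hM⟩ := hP
    obtain ⟨p, hpa, rfl⟩ := exists_eq_pair hM.mem hM.nt.nontriv (by
      rw [not_nontrivial_iff]; exact hbig M hM)
    have hpA : p ∉ A := fun h => hpa (hM.eq_of_mem p h (by simp))
    have hsp : s ≠ p := by rintro rfl; exact hpA hsA
    -- `not_new_of_source` needs the end of the pair that is beaten by the other end. If this is p,
    -- the arc s → p is reversed, but s and a are still the vertices deleted from A. Since p is not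
    -- in A, the crossing property has to be checked by hand.
    rcases ht.total hpa with h | h
    · exact ⟨s, a, _, has.symm, crossing_sflip hA.1 hb (fun N hN hNn =>
        not_new_of_source ht hM.nt.mod h hsp has.symm hs hN hNn), card_erase_erase hsA haA has.symm⟩
    · refine ⟨s, p, _, hsp, ?_, card_erase_erase hsA haA has.symm⟩
      intro N hN
      have hiff : s ∈ N ↔ p ∈ N := not_new_of_source ht (p := a) (a := p)
        (by rw [pair_comm]; exact hM.nt.mod) h has.symm hsp hs hN.mod hN.nontriv
      have hN' : NT r N := ⟨isMod_of_sflip hN.mod hiff, hN.nontriv, hN.ne_univ⟩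
      obtain ⟨⟨x, hx, hxN⟩, y, hy, hyN⟩ := hA.1 N hN'
      simp only [Finset.mem_erase]
      constructor
      · by_contra! hcon
        have hNA : ∀ x ∈ A, x ∈ N → x = s ∨ x = a := by
          intro x hx hxN
          by_contra! hx'
          exact hcon x ⟨hx'.2, hx'.1, hx⟩ hxN
        by_cases hsN : s ∈ N
        · by_cases haN : a ∈ N
          · exact hb (bad_of_mod (by omega) has.symm hN'.mod hsN haN hNA)
          · exact ht.asymm h ((hN'.mod.out ht hsN (hiff.1 hsN) haN).1 (hs a has))
        · have haN : a ∈ N := by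
            rcases hNA x hx hxN with rfl | rfl
            · exact (hsN hxN).elim
            · exact hxN
          have hsU : s ∉ N ∪ {p, a} := by
            simp only [mem_union, mem_insert_iff, mem_singleton_iff]
            tauto
          obtain ⟨n, hn, hna⟩ := hN'.nontriv.exists_ne a
          have hpN : p ∉ N := fun h => hsN (hiff.2 h)
          have hnp : n ≠ p := by rintro rfl; exact hpN hn
          refine hnp (hbig (N ∪ {p, a}) ⟨⟨hN'.mod.union hM.nt.mod haN (by simp),
            hN'.nontriv.mono subset_union_left, fun hu => hsU (hu ▸ mem_univ s)⟩, Or.inl haN, ?_⟩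
            ⟨Or.inl hn, hna⟩ ⟨by simp, hpa⟩)
          rintro x hx (hxN | hxM)
          · rcases hNA x hx hxN with rfl | rfl
            · exact (hsN hxN).elim
            · rfl
          · exact hM.eq_of_mem x hx hxM
      · by_contra! hcon
        have htN : t ∈ N := hcon t ⟨hat.symm, hst.symm, htA⟩
        by_cases hsN : s ∈ N
        · exact hN'.ne_univ (mod_eq_univ_of_source_sink ht hN'.mod hs hk hsN htN)
        · have hpN : p ∉ N := fun h => hsN (hiff.2 h)
          by_cases haN : a ∈ N
          · have hpt : p ≠ t := by rintro rfl; exact hpA htA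
            exact ht.asymm (hk p hpt) ((hN'.mod.out ht haN htN hpN).1 h)
          · refine hb ⟨N, hN', Or.inr fun z hz => ⟨?_, fun h => ?_⟩⟩
            · rintro hzN (rfl | rfl)
              · exact hsN hzN
              · exact haN hzN
            · exact hcon z ⟨by tauto, by tauto, hz⟩

theorem reduces_of_priv [DecidableEq V] (ht : IsTour r) (hA : MinCrossing r A) (h4 : 4 ≤ A.card)
    (ha : a ∈ A) (hc : c ∈ A) (hac : a ≠ c) (hb : ¬ Bad r A a c) (hPa : ∃ N, Priv r A a N)
    (hPc : ∃ N, Priv r A c N) : Reduces r A := by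
  obtain ⟨M, hM⟩ := hPa
  obtain ⟨M', hM'⟩ := hPc
  exact ⟨a, c, _, hac, crossing_sflip hA.1 hb (fun N hN hNn =>
    hM.not_new ht hA.1 (by omega) ha hc hac hb hM' hN hNn), card_erase_erase ha hc hac⟩

/-- One of the four vertices cannot be bad with all three others, so some pair with private modules
is not bad. -/
theorem reduces_of_four [DecidableEq V] (ht : IsTour r) (hA : MinCrossing r A)
    (h4 : 4 ≤ A.card) {B : Finset V} (hBA : B ⊆ A) (hB : 4 ≤ B.card)
    (hP : ∀ x ∈ B, ∃ N, Priv r A x N) : Reduces r A := by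
  obtain ⟨a, ha⟩ := Finset.card_pos.1 (show 0 < B.card by omega)
  have h1 := Finset.card_erase_of_mem ha
  obtain ⟨c, e, f, hc, he, hf, hce, hcf, hef⟩ := Finset.two_lt_card_iff.1
    (show 2 < (B.erase a).card by omega)
  rw [Finset.mem_erase] at hc he hf
  by_contra hcon
  have key : ∀ x ∈ B, x ≠ a → Bad r A a x := fun x hx hxa => by_contra fun hb =>
    hcon (reduces_of_priv ht hA h4 (hBA ha) (hBA hx) hxa.symm hb (hP a ha) (hP x hx))
  exact not_bad_three ht hc.1.symm he.1.symm hf.1.symm hce hcf hef (hBA ha) (hBA hc.2) (hBA he.2)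
    (hBA hf.2) (key c hc.2 hc.1) (key e he.2 he.1) (key f hf.2 hf.1)

/-- One reversal lowers the size of a minimum crossing set by two. -/
theorem MinCrossing.reduces [DecidableEq V] (ht : IsTour r) (hV : Large V)
    (hA : MinCrossing r A) (h4 : 4 ≤ A.card) : Reduces r A := by
  by_cases hst : ∃ s t, (∀ x, x ≠ s → r s x) ∧ ∀ x, x ≠ t → r x t
  · obtain ⟨s, t, hs, hk⟩ := hst
    exact reduces_of_source_sink ht hV hA h4 hs hk
  by_cases hP : ∀ x ∈ A, ∃ N, Priv r A x N
  · exact reduces_of_four ht hA h4 subset_rfl h4 hP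
  push Not at hP
  obtain ⟨e, he, hne⟩ := hP
  have hne' : ¬ ∃ N, Priv r A e N := fun ⟨N, hN⟩ => hne N hN
  have hP : ∀ x ∈ A.erase e, ∃ N, Priv r A x N := by
    intro x hx
    rw [Finset.mem_erase] at hx
    by_contra hx'
    apply hst
    rcases ht.total hx.1 with h | h
    · exact ⟨x, e, hA.source_sink ht (by omega) hx.2 he h hx' hne'⟩
    · exact ⟨e, x, hA.source_sink ht (by omega) he hx.2 h hne' hx'⟩
  have h1 := Finset.card_erase_of_mem he
  by_cases h5 : 5 ≤ A.card
  · exact reduces_of_four ht hA h4 (Finset.erase_subset e A) (by omega) hP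
  obtain ⟨a, c, f, hac, haf, hcf, hE⟩ := Finset.card_eq_three.1 (show (A.erase e).card = 3 by omega)
  have hmem : ∀ x, x ∈ A ↔ x = e ∨ x = a ∨ x = c ∨ x = f := by
    intro x
    have : x ∈ A.erase e ↔ x = a ∨ x = c ∨ x = f := by rw [hE]; simp
    rw [Finset.mem_erase] at this
    by_cases hxe : x = e
    · simp [hxe, he]
    · tauto
  have hx : ∀ x, x = a ∨ x = c ∨ x = f → x ≠ e ∧ x ∈ A := by
    intro x hx
    rw [← Finset.mem_erase, hE]
    simpa using hx
  have ha := hx a (by simp)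
  have hc := hx c (by simp)
  have hf := hx f (by simp)
  by_contra hcon
  -- Now |A| = 4 and only e lacks a private module. Badness depends only on the splitting of A into
  -- two pairs, so if y, z cannot be used, e is bad with x. This would hold for all three choices of
  -- x.
  have key : ∀ x y z, (∀ w, w ∈ A ↔ w = e ∨ w = x ∨ w = y ∨ w = z) → x ≠ e → y ≠ e → z ≠ e →
      x ≠ y → x ≠ z → y ≠ z → Bad r A e x := by
    intro x y z hm hx hy hz hxy hxz hyz
    have hyA : y ∈ A := (hm y).2 (by tauto)
    have hzA : z ∈ A := (hm z).2 (by tauto)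
    by_contra hb
    refine hcon (reduces_of_priv ht hA h4 hyA hzA hyz ?_ (hP y (Finset.mem_erase.2 ⟨hy, hyA⟩))
      (hP z (Finset.mem_erase.2 ⟨hz, hzA⟩)))
    have hfl : ∀ w ∈ A, (w = e ∨ w = x) ↔ ¬ (w = y ∨ w = z) := by
      intro w hw
      rcases (hm w).1 hw with rfl | rfl | rfl | rfl <;> grind
    rintro ⟨N, hN, h | h⟩
    · exact hb ⟨N, hN, Or.inr fun w hw => by rw [h w hw, hfl w hw, not_not]⟩
    · exact hb ⟨N, hN, Or.inl fun w hw => by rw [h w hw, hfl w hw]⟩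
  exact not_bad_three ht ha.1.symm hc.1.symm hf.1.symm hac haf hcf he ha.2 hc.2 hf.2
    (key a c f hmem ha.1 hc.1 hf.1 hac haf hcf)
    (key c a f (fun w => by rw [hmem]; tauto) hc.1 ha.1 hf.1 hac.symm hcf haf)
    (key f a c (fun w => by rw [hmem]; tauto) hf.1 ha.1 hc.1 haf.symm hcf.symm hac)

/-- At most `k` reversals make `r` indecomposable. -/
def Fix (r : V → V → Prop) (k : ℕ) : Prop :=
  ∃ r' : V → V → Prop, IsTour r' ∧ (∀ N, ¬ NT r' N) ∧
    Set.ncard {p : V × V | r p.1 p.2 ∧ ¬ r' p.1 p.2} ≤ k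

theorem Fix.mono {k l : ℕ} (h : Fix r k) (hkl : k ≤ l) : Fix r l := by
  obtain ⟨r', h1, h2, h3⟩ := h
  exact ⟨r', h1, h2, h3.trans hkl⟩

theorem fix_zero (ht : IsTour r) (h : ∀ N, ¬ NT r N) : Fix r 0 :=
  ⟨r, ht, h, by simp⟩

theorem Fix.of_sflip [Finite V] (ht : IsTour r) {k : ℕ} (hac : a ≠ c) (h : Fix (sflip r a c) k) :
    Fix r (k + 1) := by
  have key : ∀ {a c : V}, r a c → Fix (TourRel.sflip r a c) k → Fix r (k + 1) := by
    rintro a c hac ⟨r', h1, h2, h3⟩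
    refine ⟨r', h1, h2, ?_⟩
    have hsub : {p : V × V | r p.1 p.2 ∧ ¬ r' p.1 p.2} ⊆
        insert (a, c) {p : V × V | TourRel.sflip r a c p.1 p.2 ∧ ¬ r' p.1 p.2} := by
      rintro ⟨x, y⟩ ⟨hxy, hr'⟩
      have hca := ht.asymm hac
      simp only [mem_insert_iff, Prod.mk.injEq, mem_ofPred_eq, TourRel.sflip]
      by_cases h1 : x = a ∧ y = c
      · exact Or.inl h1
      · refine Or.inr ⟨Or.inl ⟨hxy, ?_⟩, hr'⟩
        rintro (h | ⟨rfl, rfl⟩)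
        · exact h1 h
        · exact hca hxy
    calc _ ≤ _ := Set.ncard_le_ncard hsub (Set.toFinite _)
      _ ≤ _ := Set.ncard_insert_le _ _
      _ ≤ _ := by omega
  rcases ht.total hac with h' | h'
  · exact key h' h
  · exact key h' (by rwa [sflip_comm])

theorem exists_minCrossing (h : Crossing r A) : ∃ A', MinCrossing r A' ∧ A'.card ≤ A.card := by
  classical
  have hex : ∃ n, ∃ A', Crossing r A' ∧ A'.card = n := ⟨_, A, h, rfl⟩
  obtain ⟨A', h1, h2⟩ := Nat.find_spec hex
  have hm : ∀ B, Crossing r B → A'.card ≤ B.card := fun B hB => by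
    rw [h2]
    exact Nat.find_min' hex ⟨B, hB, rfl⟩
  exact ⟨A', ⟨h1, hm⟩, hm A h⟩

/-- Sizes two and three cost one and two reversals; beyond that each reversal lowers the size by
two. The value (k+1)/2 is k/2 rounded up. -/
theorem Crossing.fix [Finite V] (hV : Large V) (k : ℕ) :
    ∀ {r : V → V → Prop}, IsTour r → ∀ {A : Finset V}, Crossing r A → A.card ≤ k →
      Fix r ((k + 1) / 2) := by
  classical
  induction k using Nat.strong_induction_on with
  | _ k ih =>
    intro r ht B hB hBk
    obtain ⟨A, hA, hAB⟩ := exists_minCrossing hB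
    by_cases hex : ∃ N, NT r N
    · have two : ∀ {r : V → V → Prop} {x y : V}, IsTour r →
          (∀ N, NT r N → ¬ (x ∈ N ↔ y ∈ N)) → Fix r 1 := by
        intro r x y ht h
        by_cases hex : ∃ N, NT r N
        · obtain ⟨u, v, huv, h'⟩ := exists_sflip_of_two ht hV hex h
          exact (fix_zero ht.sflip h').of_sflip ht huv
        · push Not at hex
          exact (fix_zero ht hex).mono (by omega)
      have h2 : 2 ≤ A.card := by
        obtain ⟨N, hN⟩ := hex
        obtain ⟨⟨x, hx, hxN⟩, y, hy, hyN⟩ := hA.1 N hN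
        exact Finset.one_lt_card.2 ⟨x, hx, y, hy, by rintro rfl; exact hyN hxN⟩
      by_cases h2' : A.card = 2
      · obtain ⟨x, y, -, rfl⟩ := Finset.card_eq_two.1 h2'
        refine (two (x := x) (y := y) ht fun N hN => ?_).mono (by omega)
        have := hA.1 N hN
        simp only [Finset.mem_insert, Finset.mem_singleton, exists_eq_or_imp,
          exists_eq_left] at this
        tauto
      by_cases h3 : A.card = 3
      · obtain ⟨a, c, x, y, hac, h⟩ := reducesToTwo_of_card_eq_three ht hV hA h3
        exact ((two ht.sflip h).of_sflip ht hac).mono (by omega)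
      obtain ⟨a, c, A', hac, hA', hle⟩ := hA.reduces ht hV (by omega)
      exact ((ih (k - 2) (by omega) ht.sflip hA' (by omega)).of_sflip ht hac).mono (by omega)
    · push Not at hex
      exact (fix_zero ht hex).mono (by omega)

end TourRel

/-! ### Disjoint blocks around an extremal crossing set -/

open Set
namespace TourRel
variable {V : Type u}
variable {r : V → V → Prop} {M N : Set V} {a b c d e f p s t x y : V} {A : Finset V}

/-- The number of out-neighbours. -/
noncomputable def outdeg (r : V → V → Prop) (a : V) : ℕ := Set.ncard {x | r a x}

/-- A minimum crossing set with the least sum of outdegrees. -/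
def Best (r : V → V → Prop) (A : Finset V) : Prop :=
  MinCrossing r A ∧ ∀ A', Crossing r A' → A'.card = A.card →
    ∑ a ∈ A, outdeg r a ≤ ∑ a ∈ A', outdeg r a

theorem exists_best (h : Crossing r A) : ∃ A', Best r A' := by
  classical
  obtain ⟨B, hB, -⟩ := exists_minCrossing h
  have hex : ∃ n, ∃ A', Crossing r A' ∧ A'.card = B.card ∧ ∑ a ∈ A', outdeg r a = n :=
    ⟨_, B, hB.1, rfl, rfl⟩
  obtain ⟨A', h1, h2, h3⟩ := Nat.find_spec hex
  refine ⟨A', ⟨h1, fun C hC => h2 ▸ hB.2 C hC⟩, fun C hC hcard => ?_⟩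
  rw [h3]
  exact Nat.find_min' hex ⟨C, hC, hcard.trans h2, rfl⟩

theorem outdeg_lt [Finite V] (ht : IsTour r) (h1 : IsMod r {x, a}) (hr : r a x) :
    outdeg r x < outdeg r a := by
  refine Set.ncard_lt_ncard ⟨fun z (hz : r x z) => ?_, fun h => ?_⟩ (Set.toFinite _)
  · have hza : z ≠ a := by rintro rfl; exact ht.asymm hr hz
    exact (h1.out ht (by simp) (by simp) (by simp [hza, (ht.ne hz).symm])).1 hz
  · exact ht.irrefl x (h hr)

/-- The end of a private pair can be chosen to be `a`, unless `a` is the source. -/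
theorem Best.exists_pair [Finite V] [DecidableEq V] (ht : IsTour r) (hA : Best r A) (ha : a ∈ A)
    (hns : ¬ ∀ x, x ≠ a → r a x) (hx : Priv r A a {x, a}) (hxa : x ≠ a) :
    ∃ y, y ≠ a ∧ Priv r A a {y, a} ∧ r y a := by
  rcases ht.total hxa with h | h
  · exact ⟨x, hxa, hx, h⟩
  have hxA : x ∉ A := fun h => hxa (hx.eq_of_mem x h (by simp))
  -- As a → x, the twin x has smaller outdegree, so exchanging a for x must destroy the crossing
  -- property. A module N witnessing this either makes a the source, or is a pair {y, a} avoiding x.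
  -- In the latter case y → x because a → x, and then y → a because x and a are twins.
  have hnc : ¬ Crossing r (insert x (A.erase a)) := by
    intro hC
    have hx' : x ∉ A.erase a := fun h => hxA (Finset.mem_of_mem_erase h)
    have h1 := hA.2 _ hC (by
      rw [Finset.card_insert_of_notMem hx', Finset.card_erase_add_one ha])
    rw [Finset.sum_insert hx', ← Finset.add_sum_erase A _ ha] at h1
    have := outdeg_lt ht hx.nt.mod h
    omega
  simp only [Crossing] at hnc
  push Not at hnc
  obtain ⟨N, hN, hNA⟩ := hnc
  obtain ⟨⟨u, hu, huN⟩, v, hv, hvN⟩ := hA.1.1 N hN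
  by_cases hm : ∃ z ∈ insert x (A.erase a), z ∈ N
  · exfalso
    have hall := hNA hm
    have hxN : x ∈ N := hall x (by simp)
    have hAN : ∀ z ∈ A, z ≠ a → z ∈ N := fun z hz hza =>
      hall z (Finset.mem_insert_of_mem (Finset.mem_erase.2 ⟨hza, hz⟩))
    have haN : a ∉ N := by
      intro haN
      by_cases hva : v = a
      · exact hvN (hva ▸ haN)
      · exact hvN (hAN v hv hva)
    have hU : N ∪ {x, a} = univ := by
      refine hA.1.1.eq_univ (hN.mod.union hx.nt.mod hxN (by simp))
        (hN.nontriv.mono subset_union_left) fun z hz => ?_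
      by_cases hza : z = a
      · simp [hza]
      · exact Or.inl (hAN z hz hza)
    refine hns fun z hza => ?_
    have hzN : z ∈ N := by
      have : z ∈ N ∪ {x, a} := hU ▸ mem_univ z
      rcases this with h | h | h
      · exact h
      · exact h ▸ hxN
      · exact (hza h).elim
    exact (hN.mod x hxN z hzN a haN).1 h
  · push Not at hm
    have hxN : x ∉ N := hm x (by simp)
    have hAN : ∀ z ∈ A, z ∈ N → z = a := fun z hz hzN => by_contra fun hza =>
      hm z (Finset.mem_insert_of_mem (Finset.mem_erase.2 ⟨hza, hz⟩)) hzN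
    have haN : a ∈ N := hAN u hu huN ▸ huN
    have hsub : ¬ (N \ {a}).Nontrivial := by
      intro hn
      have heq : N \ {x, a} = N \ {a} := by
        ext z
        simp only [mem_sdiff, mem_insert_iff, mem_singleton_iff]
        constructor
        · tauto
        · rintro ⟨h1, h2⟩
          exact ⟨h1, by rintro (rfl | rfl) <;> tauto⟩
      have hm' := hN.mod.diff ht hx.nt.mod (w := x) (by simp) hxN
      rw [heq] at hm'
      obtain ⟨⟨z, hz, hzN⟩, -⟩ := hA.1.1 _ ⟨hm', hn, fun hu => hxN (by
        have : x ∈ N \ {a} := hu ▸ mem_univ x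
        exact this.1)⟩
      exact hzN.2 (hAN z hz hzN.1)
    obtain ⟨y, hya, rfl⟩ := exists_eq_pair haN hN.nontriv hsub
    simp only [mem_insert_iff, mem_singleton_iff, not_or] at hxN
    refine ⟨y, hya, ⟨hN, by simp, hAN⟩, ?_⟩
    have h1 : r y x := (hN.mod.out ht (x := y) (y := a) (by simp) (by simp)
      (by simpa using hxN)).2 h
    exact (hx.nt.mod x (by simp) a (by simp) y (by simp [Ne.symm hxN.1, hya])).1 h1

/-- The vertex `a` of `A` is the source or has no private module. -/
def Solo (r : V → V → Prop) (A : Finset V) (a : V) : Prop :=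
  (∀ x, x ≠ a → r a x) ∨ ¬ ∃ N, Priv r A a N

/-- Two vertices of a minimum crossing set which are the source or have no private module are
the source and the sink. -/
theorem MinCrossing.solo_two [DecidableEq V] (ht : IsTour r)
    (hA : MinCrossing r A) (h3 : 3 ≤ A.card) (ha : a ∈ A) (hc : c ∈ A) (hac : a ≠ c)
    (hsa : Solo r A a) (hsc : Solo r A c) :
    ((∀ x, x ≠ a → r a x) ∧ ∀ x, x ≠ c → r x c) ∨ ((∀ x, x ≠ c → r c x) ∧ ∀ x, x ≠ a → r x a) := by
  have key : ∀ {s e : V}, s ∈ A → e ∈ A → s ≠ e → (∀ x, x ≠ s → r s x) →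
      (¬ ∃ N, Priv r A e N) → ∀ x, x ≠ e → r x e := by
    intro s e hs he hse hsrc hP
    obtain ⟨N, hN, heN, hNA⟩ := (hA.priv_or he).resolve_left hP
    have hsN := hNA s hs hse
    have hU : ∀ x, x ≠ e → x ∈ N := by
      intro x hxe
      by_contra hxN
      have hxs : x ≠ s := by rintro rfl; exact hxN hsN
      refine hP ⟨{s}ᶜ \ N, ⟨(isMod_compl_source hsrc).diff ht hN.mod hsN (by simp),
        ⟨x, ⟨hxs, hxN⟩, e, ⟨hse.symm, heN⟩, hxe⟩, fun hu => ?_⟩, ⟨hse.symm, heN⟩, ?_⟩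
      · have : s ∈ ({s}ᶜ \ N : Set V) := hu ▸ mem_univ s
        exact this.1 rfl
      · intro z hz hzN
        by_contra hze
        exact hzN.2 (hNA z hz hze)
    exact fun x hx => (hN.mod.out ht hsN (hU x hx) heN).1 (hsrc e hse.symm)
  rcases hsa with hsa | hsa <;> rcases hsc with hsc | hsc
  · exact (ht.asymm (hsa c hac.symm) (hsc a hac)).elim
  · exact Or.inl ⟨hsa, key ha hc hac hsa hsc⟩
  · exact Or.inr ⟨hsc, key hc ha hac.symm hsc hsa⟩
  · rcases ht.total hac with h | h
    · exact Or.inl (hA.source_sink ht h3 ha hc h hsa hsc)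
    · exact Or.inr (hA.source_sink ht h3 hc ha h hsc hsa)

/-- A block of `a`: a singleton, a private pair ending in `a`, or a smallest private module. -/
structure IsBlock (r : V → V → Prop) (A : Finset V) (a : V) (D : Finset V) : Prop where
  mem : a ∈ D
  eq_of_mem : ∀ x ∈ A, x ∈ D → x = a
  type : (D = {a} ∧ Solo r A a) ∨
    (Priv r A a D ∧ ((∃ y, y ≠ a ∧ (D : Set V) = {y, a} ∧ r y a) ∨
      (3 ≤ D.card ∧ ∀ N, Priv r A a N → D.card ≤ N.ncard)))

/-- If some private module is a pair, `Best.exists_pair` orients one towards a; otherwise a smallest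
private module has at least three vertices. -/
theorem Best.exists_block [Finite V] [DecidableEq V] (ht : IsTour r) (hA : Best r A)
    (ha : a ∈ A) : ∃ D, IsBlock r A a D := by
  by_cases hs : Solo r A a
  · exact ⟨{a}, by simp, by simp, Or.inl ⟨rfl, hs⟩⟩
  have hs' := hs
  simp only [Solo, not_or, not_not] at hs
  obtain ⟨hns, hP⟩ := hs
  by_cases hpair : ∃ x, x ≠ a ∧ Priv r A a {x, a}
  · obtain ⟨x, hxa, hx⟩ := hpair
    obtain ⟨y, hya, hy, hr⟩ := hA.exists_pair ht ha hns hx hxa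
    refine ⟨{y, a}, by simp, fun z hz hz' => hy.eq_of_mem z hz (by simpa using hz'), Or.inr ⟨?_, ?_⟩⟩
    · simpa using hy
    · exact Or.inl ⟨y, hya, by simp, hr⟩
  · have hex : ∃ n, ∃ N, Priv r A a N ∧ N.ncard = n := by
      obtain ⟨N, hN⟩ := hP
      exact ⟨_, N, hN, rfl⟩
    classical
    obtain ⟨N, hN, hcard⟩ := Nat.find_spec hex
    have hmin : ∀ N', Priv r A a N' → N.ncard ≤ N'.ncard := fun N' hN' => by
      rw [hcard]
      exact Nat.find_min' hex ⟨N', hN', rfl⟩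
    have hfin := Set.toFinite N
    have hcN : hfin.toFinset.card = N.ncard := (Set.ncard_eq_toFinset_card N hfin).symm
    refine ⟨hfin.toFinset, by simpa using hN.mem, fun z hz hz' => hN.eq_of_mem z hz (by
      simpa using hz'), Or.inr ⟨by simpa using hN, Or.inr ⟨?_, ?_⟩⟩⟩
    · rw [hcN]
      by_contra hlt
      apply hpair
      obtain ⟨p, hpa, rfl⟩ := exists_eq_pair hN.mem hN.nt.nontriv (fun h => by
        obtain ⟨u, hu, v, hv, huv⟩ := h
        have h3 : ({u, v, a} : Set V).ncard = 3 := by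
          rw [Set.ncard_eq_three]
          exact ⟨u, v, a, huv, hu.2, hv.2, rfl⟩
        have := Set.ncard_le_ncard (show ({u, v, a} : Set V) ⊆ N by
          rintro z (rfl | rfl | rfl)
          · exact hu.1
          · exact hv.1
          · exact hN.mem) hfin
        omega)
      exact ⟨p, hpa, hN⟩
    · rw [hcN]
      exact hmin

theorem IsBlock.isMod {D : Finset V} (h : IsBlock r A a D) : IsMod r D := by
  rcases h.type with ⟨rfl, -⟩ | ⟨h, -⟩
  · intro x hx y hy z _
    simp only [Finset.coe_singleton, mem_singleton_iff] at hx hy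
    rw [hx, hy]
  · exact h.nt.mod

theorem IsBlock.two_le [Finite V] {D : Finset V} (h : IsBlock r A a D) (hs : ¬ Solo r A a) :
    2 ≤ D.card := by
  rcases h.type with ⟨-, h⟩ | ⟨h, -⟩
  · exact (hs h).elim
  · obtain ⟨u, hu, v, hv, huv⟩ := h.nt.nontriv
    exact Finset.one_lt_card.2 ⟨u, hu, v, hv, huv⟩

/-- If D meets N, then D \ N is smaller than D and so cannot be a private module of c. It is thus
reduced to c, and D ∩ N is a nontrivial module containing no vertex of A. -/
theorem disjoint_block_aux [Finite V] [DecidableEq V] (ht : IsTour r) (hA : Crossing r A)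
    (hc : c ∈ A) (hac : a ≠ c) {D : Finset V} {N : Set V} (ha : a ∈ A)
    (hD : Priv r A c D) (h3 : 3 ≤ D.card) (hmin : ∀ N, Priv r A c N → D.card ≤ N.ncard)
    (hN : Priv r A a N) (hxD : x ∈ D) (hxN : x ∈ N) : False := by
  have haD : a ∉ (D : Set V) := fun h => hac (hD.eq_of_mem a ha h)
  have hcN : c ∉ N := fun h => hac (hN.eq_of_mem c hc h).symm
  have h1 : ¬ ((D : Set V) \ N).Nontrivial := by
    intro hn
    have hP : Priv r A c (↑D \ N) := ⟨⟨hD.nt.mod.diff ht hN.nt.mod hN.mem haD, hn, fun hu =>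
      haD (by
        have : a ∈ (D : Set V) \ N := hu ▸ mem_univ a
        exact this.1)⟩, ⟨hD.mem, hcN⟩, fun z hz hzD => hD.eq_of_mem z hz hzD.1⟩
    have h2 := hmin _ hP
    have h3 : ((D : Set V) \ N).ncard < (D : Set V).ncard :=
      Set.ncard_lt_ncard ⟨sdiff_subset, fun h => (h hxD).2 hxN⟩ (Set.toFinite _)
    rw [Set.ncard_coe_finset] at h3
    omega
  rw [not_nontrivial_iff] at h1
  have hsub : ∀ z ∈ D, z ≠ c → z ∈ N := fun z hz hzc => by_contra fun hzN =>
    hzc (h1 ⟨hz, hzN⟩ ⟨hD.mem, hcN⟩)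
  obtain ⟨u, hu, v, hv, huv⟩ := Finset.one_lt_card.1 (show 1 < (D.erase c).card by
    rw [Finset.card_erase_of_mem hD.mem]; omega)
  rw [Finset.mem_erase] at hu hv
  obtain ⟨⟨z, hz, hzD⟩, -⟩ := hA ((D : Set V) ∩ N) ⟨hD.nt.mod.inter hN.nt.mod,
    ⟨u, ⟨hu.2, hsub u hu.2 hu.1⟩, v, ⟨hv.2, hsub v hv.2 hv.1⟩, huv⟩, fun h => by
      have : c ∈ (D : Set V) ∩ N := h ▸ mem_univ c
      exact hcN this.2⟩
  exact hcN (hD.eq_of_mem z hz hzD.1 ▸ hzD.2)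

theorem disjoint_block [Finite V] [DecidableEq V] (ht : IsTour r) (hA : Crossing r A) (ha : a ∈ A)
    (hc : c ∈ A) (hac : a ≠ c) {D E : Finset V} (hD : IsBlock r A a D) (hE : IsBlock r A c E) :
    Disjoint D E := by
  rw [Finset.disjoint_left]
  intro x hxD hxE
  have haE : a ∉ E := fun h => hac (hE.eq_of_mem a ha h)
  have hcD : c ∉ D := fun h => hac (hD.eq_of_mem c hc h).symm
  rcases hD.type with ⟨rfl, -⟩ | ⟨hD', hD''⟩
  · exact haE (Finset.mem_singleton.1 hxD ▸ hxE)
  rcases hE.type with ⟨rfl, -⟩ | ⟨hE', hE''⟩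
  · exact hcD (Finset.mem_singleton.1 hxE ▸ hxD)
  rcases hE'' with ⟨y', hy', hE, hr'⟩ | ⟨h3, hmin⟩
  swap
  · exact disjoint_block_aux ht hA hc hac ha hE' h3 hmin hD' hxE hxD
  rcases hD'' with ⟨y, hy, hD, hr⟩ | ⟨h3, hmin⟩
  swap
  · exact disjoint_block_aux ht hA ha hac.symm hc hD' h3 hmin hE' hxD hxE
  have hxD' : x ∈ (D : Set V) := hxD
  have hxE' : x ∈ (E : Set V) := hxE
  have haE' : a ∉ (E : Set V) := haE
  have hcD' : c ∉ (D : Set V) := hcD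
  rw [hD] at hxD' hcD' hD'
  rw [hE] at hxE' haE' hE'
  have hxy : x = y := by
    rcases hxD' with h | h
    · exact h
    · rcases hxE' with h' | h' <;> subst h <;> simp_all
  have hxy' : x = y' := by
    rcases hxE' with h | h
    · exact h
    · subst h
      simp_all
  rw [hxy'] at hxy
  subst hxy
  -- Two pairs sharing y would have y → a and y → c. Then a → c since y and a are twins, and a → y
  -- since y and c are twins. The orientation required of block pairs serves to exclude this.
  have h1 := (hD'.nt.mod.out ht (x := y') (y := a) (by simp) (by simp) hcD').1 hr'
  have h2 := (hE'.nt.mod y' (by simp) c (by simp) a haE').2 h1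
  exact ht.asymm h2 hr

end TourRel

/-! ### Counting the blocks: the extremal structures -/

open Set
namespace TourRel
variable {V : Type u}
variable {r : V → V → Prop} {M N : Set V} {a b c d e f p s t x y : V} {A R W : Finset V}
  {E : V → Finset V} {n : ℕ}

/-- The sets `E a` with `a` in `R` are disjoint modules with union `W`. -/
structure Blocks (r : V → V → Prop) (W R : Finset V) (E : V → Finset V) : Prop where
  mem : ∀ a ∈ R, a ∈ E a
  isMod : ∀ a ∈ R, IsMod r (E a)
  disj : ∀ a ∈ R, ∀ c ∈ R, a ≠ c → Disjoint (E a) (E c)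
  cover : ∀ x, x ∈ W ↔ ∃ a ∈ R, x ∈ E a

/-- The vertices other than a source or sink `e` are partitioned into `2n` pairs. -/
def FormPairs (r : V → V → Prop) (n : ℕ) : Prop :=
  ∃ (e : V) (W R : Finset V) (E : V → Finset V), ((∀ x, x ≠ e → r e x) ∨ ∀ x, x ≠ e → r x e) ∧
    (∀ x, x ∈ W ↔ x ≠ e) ∧ Blocks r W R E ∧ R.card = 2 * n ∧ ∀ a ∈ R, (E a).card = 2

/-- The vertices other than the source and the sink are partitioned into pairs and one further
module, which is a vertex or a cycle. -/
def FormOdd (r : V → V → Prop) (n : ℕ) : Prop :=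
  ∃ (s t : V) (W R : Finset V) (E : V → Finset V), (∀ x, x ≠ s → r s x) ∧ (∀ x, x ≠ t → r x t) ∧
    (∀ x, x ∈ W ↔ x ≠ s ∧ x ≠ t) ∧ Blocks r W R E ∧ ∃ a ∈ R, (∀ c ∈ R, c ≠ a → (E c).card = 2) ∧
      ((R.card = 2 * n ∧ (E a).card = 1) ∨
        (R.card = 2 * n - 1 ∧ ∃ x y z, (E a : Set V) = {x, y, z} ∧ r x y ∧ r y z ∧ r z x))

theorem eq_two_of_sum_le {f : V → ℕ} (h2 : ∀ a ∈ R, 2 ≤ f a) (h : ∑ a ∈ R, f a ≤ 2 * R.card) :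
    ∀ a ∈ R, f a = 2 := by
  have h1 : ∑ a ∈ R, 2 = 2 * R.card := by rw [Finset.sum_const, smul_eq_mul, mul_comm]
  have h3 := (Finset.sum_eq_sum_iff_of_le h2).1 (le_antisymm (Finset.sum_le_sum h2) (h.trans h1.ge))
  exact fun a ha => (h3 a ha).symm

theorem two_mul_le_sum {f : V → ℕ} (h2 : ∀ a ∈ R, 2 ≤ f a) : 2 * R.card ≤ ∑ a ∈ R, f a := by
  have := Finset.card_nsmul_le_sum R f 2 h2
  rwa [smul_eq_mul, mul_comm] at this

theorem partition_even [DecidableEq V] (hd : ∀ a ∈ R, ∀ c ∈ R, a ≠ c → Disjoint (E a) (E c))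
    (hW : ∀ a ∈ R, E a ⊆ W) (h2 : ∀ a ∈ R, 2 ≤ (E a).card) (hc : W.card = 2 * R.card) :
    (∀ a ∈ R, (E a).card = 2) ∧ R.biUnion E = W := by
  have h1 := Finset.card_biUnion hd
  have h3 : R.biUnion E ⊆ W := Finset.biUnion_subset.2 hW
  have h4 := Finset.card_le_card h3
  have h5 := two_mul_le_sum h2
  exact ⟨eq_two_of_sum_le h2 (by omega), Finset.eq_of_subset_of_card_le h3 (by omega)⟩

theorem partition_odd [DecidableEq V] (hd : ∀ a ∈ R, ∀ c ∈ R, a ≠ c → Disjoint (E a) (E c))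
    (hW : ∀ a ∈ R, E a ⊆ W) (h2 : ∀ a ∈ R, 2 ≤ (E a).card) (hc : W.card = 2 * R.card + 1) :
    ((∀ a ∈ R, (E a).card = 2) ∧ ∃ w ∈ W, R.biUnion E = W.erase w) ∨
      ∃ a ∈ R, (E a).card = 3 ∧ (∀ c ∈ R, c ≠ a → (E c).card = 2) ∧ R.biUnion E = W := by
  have h1 := Finset.card_biUnion hd
  have h3 : R.biUnion E ⊆ W := Finset.biUnion_subset.2 hW
  have h4 := Finset.card_le_card h3
  by_cases hall : ∀ a ∈ R, (E a).card = 2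
  · refine Or.inl ⟨hall, ?_⟩
    have h5 : ∑ a ∈ R, (E a).card = 2 * R.card := by
      rw [Finset.sum_congr rfl hall, Finset.sum_const, smul_eq_mul, mul_comm]
    have h6 : (W \ R.biUnion E).card = 1 := by
      rw [Finset.card_sdiff_of_subset h3]
      omega
    obtain ⟨w, hw⟩ := Finset.card_eq_one.1 h6
    refine ⟨w, (Finset.mem_sdiff.1 (hw ▸ Finset.mem_singleton_self w)).1, ?_⟩
    rw [Finset.erase_eq, ← hw, Finset.sdiff_sdiff_eq_self h3]
  · push Not at hall
    obtain ⟨a, ha, hne⟩ := hall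
    have h5 := h2 a ha
    have h6 := Finset.add_sum_erase R (fun a => (E a).card) ha
    have h7 := two_mul_le_sum (R := R.erase a) (f := fun a => (E a).card)
      fun c hc => h2 c (Finset.mem_of_mem_erase hc)
    have h8 := Finset.card_erase_add_one ha
    refine Or.inr ⟨a, ha, by omega, fun c hc hca => ?_,
      Finset.eq_of_subset_of_card_le h3 (by omega)⟩
    exact eq_two_of_sum_le (R := R.erase a) (f := fun a => (E a).card)
      (fun c hc => h2 c (Finset.mem_of_mem_erase hc)) (by omega) c (Finset.mem_erase.2 ⟨hca, hc⟩)

/-- A pair inside the block that is a module would be a smaller private module, or would miss A. So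
each vertex of the block distinguishes the other two, which makes a 3-cycle. -/
theorem IsBlock.cycle [Finite V] [DecidableEq V] (ht : IsTour r) (hA : Crossing r A)
    {D : Finset V} (hD : IsBlock r A a D) (h3 : D.card = 3) :
    ∃ x y z, (D : Set V) = {x, y, z} ∧ r x y ∧ r y z ∧ r z x := by
  rcases hD.type with ⟨rfl, -⟩ | ⟨hP, ⟨y, hy, hD', -⟩ | ⟨-, hmin⟩⟩
  · simp at h3
  · have := Set.ncard_pair hy
    rw [← hD', Set.ncard_coe_finset] at this
    omega
  have nomod : ∀ u ∈ D, ∀ v ∈ D, u ≠ v → ¬ IsMod r {u, v} := by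
    intro u hu v hv huv hm
    have hsub : ({u, v} : Set V) ⊆ D := by
      rintro z (rfl | rfl)
      · exact hu
      · exact hv
    have hNT : NT r {u, v} := ⟨hm, Set.nontrivial_pair huv, fun h =>
      hP.nt.ne_univ (univ_subset_iff.1 (h ▸ hsub))⟩
    by_cases ha : a ∈ ({u, v} : Set V)
    · have := hmin _ ⟨hNT, ha, fun x hx hx' => hP.eq_of_mem x hx (hsub hx')⟩
      rw [Set.ncard_pair huv] at this
      omega
    · obtain ⟨⟨x, hx, hx'⟩, -⟩ := hA _ hNT
      exact ha (hP.eq_of_mem x hx (hsub hx') ▸ hx')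
  obtain ⟨x, y, z, hxy, hxz, hyz, rfl⟩ := Finset.card_eq_three.1 h3
  have key : ∀ u v w : V, u ≠ v → ({u, v, w} : Finset V) = {x, y, z} → ¬ (r w u ↔ r w v) := by
    intro u v w huv hset hiff
    have hu : u ∈ ({x, y, z} : Finset V) := by rw [← hset]; simp
    have hv : v ∈ ({x, y, z} : Finset V) := by rw [← hset]; simp
    refine nomod u hu v hv huv ?_
    have h1 : ∀ q, q ∉ ({u, v} : Set V) → (r q u ↔ r q v) := by
      intro q hq
      by_cases hqD : q ∈ ({x, y, z} : Finset V)
      · rw [← hset] at hqD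
        simp only [mem_insert_iff, mem_singleton_iff, Finset.mem_insert,
          Finset.mem_singleton] at hq hqD
        have : q = w := by tauto
        rwa [this]
      · exact hP.nt.mod u hu v hv q hqD
    rintro k (rfl | rfl) l (rfl | rfl) q hq
    · rfl
    · exact h1 q hq
    · exact (h1 q hq).symm
    · rfl
  have k1 := key x y z hxy rfl
  have k2 := key x z y hxz (by grind)
  have k3 := key y z x hyz (by grind)
  have t1 := ht.iff_not x y hxy
  have t2 := ht.iff_not x z hxz
  have t3 := ht.iff_not y z hyz
  by_cases h : r x y
  · exact ⟨x, y, z, by simp, h, by tauto, by tauto⟩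
  · exact ⟨x, z, y, by rw [pair_comm]; simp, by tauto, by tauto, by tauto⟩

theorem Blocks.of_biUnion [DecidableEq V] (hm : ∀ a ∈ R, a ∈ E a) (hM : ∀ a ∈ R, IsMod r (E a))
    (hd : ∀ a ∈ R, ∀ c ∈ R, a ≠ c → Disjoint (E a) (E c)) (hU : R.biUnion E = W) :
    Blocks r W R E :=
  ⟨hm, hM, hd, fun x => by rw [← hU, Finset.mem_biUnion]⟩

/-- If all blocks but that of `e` are pairs covering the rest, then `e` is the source or the
sink. -/
theorem source_or_sink_of_blocks [DecidableEq V] (ht : IsTour r) (hA : MinCrossing r A)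
    (he : e ∈ A) (hs : Solo r A e)
    (hR : ∀ a, a ∈ R ↔ a ∈ A ∧ a ≠ e) (hW : ∀ x, x ∈ W ↔ x ≠ e) (hB : Blocks r W R E) :
    (∀ x, x ≠ e → r e x) ∨ ∀ x, x ≠ e → r x e := by
  rcases hs with hs | hP
  · exact Or.inl hs
  obtain ⟨N, hN, heN, hNA⟩ := (hA.priv_or he).resolve_left hP
  have h1 : ∀ x, x ≠ e → ∃ a, a ∈ N ∧ (r e x ↔ r e a) := by
    intro x hx
    obtain ⟨a, ha, hxa⟩ := (hB.cover x).1 ((hW x).2 hx)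
    have heE : e ∉ (E a : Set V) := fun h =>
      (hW e).1 ((hB.cover e).2 ⟨a, ha, h⟩) rfl
    exact ⟨a, hNA a ((hR a).1 ha).1 ((hR a).1 ha).2,
      hB.isMod a ha x hxa a (hB.mem a ha) e heE⟩
  obtain ⟨g, hg⟩ := hN.nontriv.nonempty
  -- Every vertex looks to e like the representative of its block. All representatives lie in N,
  -- which e sees uniformly.
  by_cases h : r e g
  · left
    intro x hx
    obtain ⟨a, ha, h2⟩ := h1 x hx
    exact h2.2 ((hN.mod a ha g hg e heN).2 h)
  · right
    intro x hx
    obtain ⟨a, ha, h2⟩ := h1 x hx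
    have h3 : ¬ r e x := fun h4 => h ((hN.mod a ha g hg e heN).1 (h2.1 h4))
    exact (ht.total hx).resolve_right h3

/-- The upper bound, and the structure of the tournaments attaining it. -/
theorem fix_and_forms [Finite V] (ht : IsTour r) (hV : Large V) (hn : 1 ≤ n)
    (hcard : Nat.card V = 4 * n + 1) :
    Fix r (n + 1) ∧ (¬ Fix r n → FormPairs r n ∨ FormOdd r n) := by
  classical
  have := Fintype.ofFinite V
  rw [Nat.card_eq_fintype_card] at hcard
  have hex : Crossing r Finset.univ := fun N hN => by
    obtain ⟨x, hx⟩ := hN.nontriv.nonempty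
    obtain ⟨y, hy⟩ := (ne_univ_iff_exists_notMem N).1 hN.ne_univ
    exact ⟨⟨x, by simp, hx⟩, y, by simp, hy⟩
  obtain ⟨A, hA⟩ := exists_best hex
  by_cases hk : A.card ≤ 2 * n
  · have h1 : Fix r n := (hA.1.1.fix hV _ ht hk).mono (by omega)
    exact ⟨h1.mono (by omega), fun h => (h h1).elim⟩
  have hbl : ∀ a, ∃ D, a ∈ A → IsBlock r A a D := fun a => by
    by_cases ha : a ∈ A
    · obtain ⟨D, hD⟩ := hA.exists_block ht ha
      exact ⟨D, fun _ => hD⟩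
    · exact ⟨∅, fun h => (ha h).elim⟩
  choose E hE using hbl
  set S := A.filter (Solo r A) with hS
  set R := A.filter (fun a => ¬ Solo r A a) with hR
  have hSA : ∀ x ∈ S, x ∈ A ∧ Solo r A x := fun x hx => Finset.mem_filter.1 hx
  have hRA : ∀ x ∈ R, x ∈ A ∧ ¬ Solo r A x := fun x hx => Finset.mem_filter.1 hx
  have hcSR : S.card + R.card = A.card := Finset.card_filter_add_card_filter_not _
  have hd : ∀ a ∈ R, ∀ c ∈ R, a ≠ c → Disjoint (E a) (E c) := fun a ha c hc hac =>
    disjoint_block ht hA.1.1 (hRA a ha).1 (hRA c hc).1 hac (hE a (hRA a ha).1) (hE c (hRA c hc).1)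
  have hW : ∀ a ∈ R, E a ⊆ Sᶜ := by
    intro a ha x hx
    rw [Finset.mem_compl]
    intro hxS
    have := (hE a (hRA a ha).1).eq_of_mem x (hSA x hxS).1 hx
    subst this
    exact (hRA x ha).2 (hSA x hxS).2
  have h2 : ∀ a ∈ R, 2 ≤ (E a).card := fun a ha => (hE a (hRA a ha).1).two_le (hRA a ha).2
  have hm : ∀ a ∈ R, a ∈ E a := fun a ha => (hE a (hRA a ha).1).mem
  have hM : ∀ a ∈ R, IsMod r (E a) := fun a ha => (hE a (hRA a ha).1).isMod
  have hcW : (Sᶜ).card + S.card = 4 * n + 1 := by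
    rw [Finset.card_compl, ← hcard]
    have := Finset.card_le_univ S
    omega
  have hle : 2 * R.card ≤ (Sᶜ).card := by
    have h1 := Finset.card_biUnion hd
    have h3 := Finset.card_le_card (Finset.biUnion_subset.2 hW)
    have h4 := two_mul_le_sum h2
    omega
  have solo := fun {a c : V} (ha : a ∈ S) (hc : c ∈ S) (hac : a ≠ c) =>
    hA.1.solo_two ht (by omega) (hSA a ha).1 (hSA c hc).1 hac (hSA a ha).2 (hSA c hc).2
  -- Any two elements of S are the source and the sink in some order, and neither can occur twice.
  have hS2 : S.card ≤ 2 := by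
    by_contra! hlt
    obtain ⟨a, c, e, ha, hc, he, hac, hae, hce⟩ := Finset.two_lt_card_iff.1 hlt
    have src : ∀ {x y : V}, x ≠ y → (∀ z, z ≠ x → r x z) → ¬ ∀ z, z ≠ y → r y z :=
      fun hxy h h' => ht.asymm (h _ hxy.symm) (h' _ hxy)
    have snk : ∀ {x y : V}, x ≠ y → (∀ z, z ≠ x → r z x) → ¬ ∀ z, z ≠ y → r z y :=
      fun hxy h h' => ht.asymm (h _ hxy.symm) (h' _ hxy)
    rcases solo ha hc hac with ⟨h1, h3⟩ | ⟨h1, h3⟩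
    · rcases solo ha he hae with ⟨h4, h5⟩ | ⟨h4, h5⟩
      · exact snk hce h3 h5
      · exact src hae h1 h4
    · rcases solo hc he hce with ⟨h4, h5⟩ | ⟨h4, h5⟩
      · exact snk hae h3 h5
      · exact src hce h1 h4
  refine ⟨(hA.1.1.fix hV (2 * n + 1) ht (by omega)).mono (by omega), fun _ => ?_⟩
  -- If S were empty, 2|R| ≤ 4n+1 would give |A| = |R| ≤ 2n, which is excluded.
  obtain hS1 | hS2' : S.card = 1 ∨ S.card = 2 := by omega
  · left
    obtain ⟨e, he⟩ := Finset.card_eq_one.1 hS1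
    obtain ⟨h4, h5⟩ := partition_even hd hW h2 (by omega)
    have heS : e ∈ S := by rw [he]; simp
    have hWe : ∀ x, x ∈ Sᶜ ↔ x ≠ e := fun x => by rw [he]; simp
    have hB := Blocks.of_biUnion hm hM hd h5
    refine ⟨e, Sᶜ, R, E, ?_, hWe, hB, by omega, h4⟩
    refine source_or_sink_of_blocks ht hA.1 (hSA e heS).1 (hSA e heS).2 (fun a => ?_) hWe hB
    constructor
    · intro ha
      exact ⟨(hRA a ha).1, by rintro rfl; exact (hRA _ ha).2 (hSA _ heS).2⟩
    · rintro ⟨ha, hae⟩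
      refine Finset.mem_filter.2 ⟨ha, fun hs => hae ?_⟩
      have : a ∈ S := Finset.mem_filter.2 ⟨ha, hs⟩
      rw [he] at this
      simpa using this
  · right
    obtain ⟨s, t, hst, hSst, hs, hk⟩ : ∃ s t, s ≠ t ∧ S = {s, t} ∧ (∀ x, x ≠ s → r s x) ∧
        ∀ x, x ≠ t → r x t := by
      obtain ⟨s, t, hst, h⟩ := Finset.card_eq_two.1 hS2'
      rcases solo (a := s) (c := t) (by rw [h]; simp) (by rw [h]; simp) hst with ⟨h1, h3⟩ | ⟨h1, h3⟩
      · exact ⟨s, t, hst, h, h1, h3⟩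
      · exact ⟨t, s, hst.symm, by rw [h, Finset.pair_comm], h1, h3⟩
    have hWst : ∀ x, x ∈ Sᶜ ↔ x ≠ s ∧ x ≠ t := fun x => by rw [hSst]; simp
    rcases partition_odd hd hW h2 (by omega) with ⟨h4, w, hw, h5⟩ | ⟨a, ha, h3, h4, h5⟩
    -- The leftover vertex w becomes a singleton block of its own.
    · have hwE : ∀ a ∈ R, w ∉ E a := by
        intro a ha hwa
        have : w ∈ R.biUnion E := Finset.mem_biUnion.2 ⟨a, ha, hwa⟩
        rw [h5] at this
        simp at this
      have hwR : w ∉ R := fun h => hwE w h (hm w h)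
      have hF : ∀ a ∈ R, Function.update E w {w} a = E a := fun a ha =>
        Function.update_of_ne (by rintro rfl; exact hwR ha) _ _
      have hFw : Function.update E w {w} w = {w} := Function.update_self _ _ _
      refine ⟨s, t, Sᶜ, insert w R, Function.update E w {w}, hs, hk, hWst, ⟨?_, ?_, ?_, ?_⟩, w,
        by simp, ?_, Or.inl ⟨?_, ?_⟩⟩
      · intro a ha
        rcases Finset.mem_insert.1 ha with rfl | ha
        · simp
        · rw [hF a ha]
          exact hm a ha
      · intro a ha
        rcases Finset.mem_insert.1 ha with rfl | ha
        · rw [hFw]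
          intro x hx y hy z _
          simp only [Finset.coe_singleton, mem_singleton_iff] at hx hy
          rw [hx, hy]
        · rw [hF a ha]
          exact hM a ha
      · intro a ha c hc hac
        rcases Finset.mem_insert.1 ha with rfl | ha' <;>
          rcases Finset.mem_insert.1 hc with rfl | hc'
        · exact (hac rfl).elim
        · rw [hF c hc', hFw, Finset.disjoint_singleton_left]
          exact hwE c hc'
        · rw [hF a ha', hFw, Finset.disjoint_singleton_right]
          exact hwE a ha'
        · rw [hF a ha', hF c hc']
          exact hd a ha' c hc' hac
      · intro x
        constructor
        · intro hx
          by_cases hxw : x = w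
          · exact ⟨w, by simp, by rw [hFw, hxw]; simp⟩
          · have : x ∈ R.biUnion E := by rw [h5]; exact Finset.mem_erase.2 ⟨hxw, hx⟩
            obtain ⟨a, ha, hxa⟩ := Finset.mem_biUnion.1 this
            exact ⟨a, Finset.mem_insert_of_mem ha, by rwa [hF a ha]⟩
        · rintro ⟨a, ha, hxa⟩
          rcases Finset.mem_insert.1 ha with rfl | ha
          · rw [hFw, Finset.mem_singleton] at hxa
            rwa [hxa]
          · rw [hF a ha] at hxa
            exact hW a ha hxa
      · intro c hc hcw
        rcases Finset.mem_insert.1 hc with rfl | hc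
        · exact (hcw rfl).elim
        · rw [hF c hc]
          exact h4 c hc
      · rw [Finset.card_insert_of_notMem hwR]
        omega
      · rw [hFw, Finset.card_singleton]
    · exact ⟨s, t, Sᶜ, R, E, hs, hk, hWst, Blocks.of_biUnion hm hM hd h5, a, ha, h4,
        Or.inr ⟨by omega, (hE a (hRA a ha).1).cycle ht hA.1.1 h3⟩⟩

end TourRel

open Set
namespace TourRel
variable {V : Type u}
variable {r : V → V → Prop} {M N : Set V} {a b c d e f p s t x y : V} {A R W : Finset V}
  {E : V → Finset V} {n k m : ℕ}

/-! ### The lower bound -/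

/-- There are `m` disjoint sets which are nontrivial modules or complements of such. -/
def Comodules (r : V → V → Prop) (m : ℕ) : Prop :=
  ∃ (ι : Type) (_ : Fintype ι) (C : ι → Set V), Fintype.card ι = m ∧
    (∀ i j, i ≠ j → Disjoint (C i) (C j)) ∧ ∀ i, NT r (C i) ∨ NT r (C i)ᶜ

theorem IsMod.congr {r' : V → V → Prop} (h : IsMod r M)
    (hr : ∀ x y, ¬ (x ∈ M ↔ y ∈ M) → (r x y ↔ r' x y)) : IsMod r' M := by
  intro x hx y hy z hz
  rw [← hr z x (by tauto), ← hr z y (by tauto)]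
  exact h x hx y hy z hz

/-- Each reversed arc breaks at most two of the modules. -/
theorem Comodules.le_of_fix [Finite V] (ht : IsTour r) (hC : Comodules r m) (h : Fix r k) :
    m ≤ 2 * k := by
  classical
  obtain ⟨ι, _, C, rfl, hd, hC⟩ := hC
  obtain ⟨r', ht', hind, hk⟩ := h
  -- If no reversed arc crossed the boundary of C i, then C i or its complement would remain a
  -- nontrivial module.
  have key : ∀ i, ∃ p : V × V, (r p.1 p.2 ∧ ¬ r' p.1 p.2) ∧ ¬ (p.1 ∈ C i ↔ p.2 ∈ C i) := by
    intro i
    by_contra! hcon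
    have hr : ∀ x y, ¬ (x ∈ C i ↔ y ∈ C i) → (r x y ↔ r' x y) := by
      intro x y hxy
      have hne : x ≠ y := by rintro rfl; exact hxy Iff.rfl
      have h1 := hcon (x, y)
      have h2 := hcon (y, x)
      have h3 := ht.iff_not x y hne
      have h4 := ht'.iff_not x y hne
      simp only at h1 h2
      tauto
    rcases hC i with h | h
    · exact hind _ ⟨h.mod.congr hr, h.nontriv, h.ne_univ⟩
    · refine hind _ ⟨h.mod.congr fun x y hxy => hr x y ?_, h.nontriv, h.ne_univ⟩
      rw [mem_compl_iff, mem_compl_iff] at hxy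
      tauto
  choose p hp hpC using key
  -- The Boolean records which end of the crossing arc lies in C i. Since the sets are disjoint, the
  -- arc and this end determine i.
  let F : ι → {p : V × V | r p.1 p.2 ∧ ¬ r' p.1 p.2} × Bool := fun i =>
    (⟨p i, hp i⟩, decide ((p i).1 ∈ C i))
  have hF : Function.Injective F := by
    intro i j hij
    by_contra hne
    simp only [F, Prod.mk.injEq, Subtype.mk.injEq, decide_eq_decide] at hij
    obtain ⟨h1, h2⟩ := hij
    have h3 := hpC i
    have h4 := hpC j
    rw [← h1] at h4 h2
    have h5 := Set.disjoint_left.1 (hd i j hne)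
    by_cases h6 : (p i).1 ∈ C i
    · exact h5 h6 (h2.1 h6)
    · exact h5 (a := (p i).2) (by tauto) (by tauto)
  have := Nat.card_le_card_of_injective F hF
  rw [Nat.card_prod, Nat.card_coe_set_eq, Nat.card_eq_fintype_card, Nat.card_eq_fintype_card,
    Fintype.card_bool] at this
  omega

theorem Comodules.of_rev (ht : IsTour r) (h : Comodules (rev r) m) : Comodules r m := by
  obtain ⟨ι, i, C, h1, h2, h3⟩ := h
  exact ⟨ι, i, C, h1, h2, fun i => by simpa only [nt_rev ht] using h3 i⟩

theorem NT.preimage {V' : Type v} {r' : V' → V' → Prop} (e : r ≃r r') {N : Set V'} (h : NT r' N) :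
    NT r (e ⁻¹' N) := by
  refine ⟨fun x hx y hy z hz => ?_, ?_, fun hu => h.ne_univ ?_⟩
  · rw [← e.map_rel_iff, ← e.map_rel_iff]
    exact h.mod _ hx _ hy _ hz
  · exact h.nontriv.preimage e.surjective
  · exact eq_univ_of_forall fun x => by
      obtain ⟨y, rfl⟩ := e.surjective x
      have : y ∈ e ⁻¹' N := hu ▸ mem_univ y
      exact this

theorem Comodules.of_iso {V' : Type v} {r' : V' → V' → Prop} (e : r ≃r r') (h : Comodules r' m) :
    Comodules r m := by
  obtain ⟨ι, i, C, h1, h2, h3⟩ := h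
  refine ⟨ι, i, fun i => e ⁻¹' C i, h1, fun i j hij => (h2 i j hij).preimage e, fun i => ?_⟩
  rcases h3 i with h | h
  · exact Or.inl (h.preimage e)
  · exact Or.inr (h.preimage e)

theorem large_of_card [Finite V] (h : 5 ≤ Nat.card V) : Large V := by
  classical
  have := Fintype.ofFinite V
  intro a b c d
  by_contra! hcon
  have h1 : (Finset.univ : Finset V) ⊆ {a, b, c, d} := fun z _ => by
    have := hcon z
    simp only [Finset.mem_insert, Finset.mem_singleton]
    tauto
  have h2 := Finset.card_le_card h1
  have h3 := Finset.card_le_four (a := a) (b := b) (c := c) (d := d)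
  rw [Finset.card_univ, ← Nat.card_eq_fintype_card] at h2
  omega

end TourRel

/-! ### From reversals of relations to the decomposability index -/

namespace Tournament
open TourRel

theorem isTour (T : Tournament.{u}) : IsTour T.Arc := ⟨T.irrefl, T.arc_iff⟩

theorem indecomposable_iff (T : Tournament.{u}) : T.Indecomposable ↔ ∀ N, ¬ NT T.Arc N := by
  constructor
  · intro h N hN
    rcases h N hN.mod with rfl | ⟨x, rfl⟩ | h
    · exact not_nontrivial_empty hN.nontriv
    · exact not_nontrivial_singleton hN.nontriv
    · exact hN.ne_univ h
  · intro h N hN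
    by_contra! hcon
    refine h N ⟨hN, ?_, hcon.2.2⟩
    by_contra hns
    rw [not_nontrivial_iff] at hns
    rcases hns.eq_empty_or_singleton with h | ⟨x, h⟩
    · exact hcon.1.ne_empty h
    · exact hcon.2.1 x h

variable {n k m : ℕ}

theorem fix_iff (T : Tournament.{u}) : Fix T.Arc k ↔ ∃ m ≤ k,
    ∃ (B : Finset (T.V × T.V)) (hB : ∀ b ∈ B, T.Arc b.1 b.2),
      B.card = m ∧ (T.inv B hB).Indecomposable := by
  constructor
  · rintro ⟨r', ht, hind, hk⟩
    have hfin : {p : T.V × T.V | T.Arc p.1 p.2 ∧ ¬ r' p.1 p.2}.Finite := Set.toFinite _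
    have hmem : ∀ x y, (x, y) ∈ hfin.toFinset ↔ T.Arc x y ∧ ¬ r' x y := by simp
    refine ⟨_, hk, hfin.toFinset, fun b hb => ((hmem b.1 b.2).1 hb).1,
      (Set.ncard_eq_toFinset_card _ hfin).symm, ?_⟩
    rw [indecomposable_iff]
    have heq : (T.inv hfin.toFinset fun b hb => ((hmem b.1 b.2).1 hb).1).Arc = r' := by
      funext (x : T.V) (y : T.V)
      simp only [inv, eq_iff_iff]
      rw [hmem x y, hmem y x]
      by_cases hxy : x = y
      · subst hxy
        have := T.irrefl x
        have := ht.irrefl x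
        tauto
      · have h1 := T.arc_iff x y hxy
        have h2 := ht.iff_not x y hxy
        tauto
    rw [heq]
    exact hind
  · rintro ⟨_, hk, B, hB, rfl, hind⟩
    refine ⟨(T.inv B hB).Arc, (T.inv B hB).isTour, (indecomposable_iff _).1 hind, ?_⟩
    rw [← Set.ncard_coe_finset] at hk
    refine (Set.ncard_le_ncard ?_ (Set.toFinite _)).trans hk
    rintro ⟨x, y⟩ ⟨h1, h2⟩
    by_contra h3
    exact h2 (Or.inl ⟨h1, h3⟩)

theorem delta_le (T : Tournament.{u}) (h : Fix T.Arc k) : T.delta ≤ k := by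
  obtain ⟨m, hm, h⟩ := T.fix_iff.1 h
  exact (Nat.sInf_le h).trans hm

/-- The hypothesis guarantees that the infimum is over a nonempty set, so `delta` is attained and is
not the default value 0. -/
theorem fix_delta (T : Tournament.{u}) (h : Fix T.Arc k) : Fix T.Arc T.delta := by
  obtain ⟨m, hm, h⟩ := T.fix_iff.1 h
  have hne : {m : ℕ | ∃ (B : Finset (T.V × T.V)) (hB : ∀ b ∈ B, T.Arc b.1 b.2),
    B.card = m ∧ (T.inv B hB).Indecomposable}.Nonempty := ⟨m, h⟩
  obtain ⟨B, hB, hc, hi⟩ := Nat.sInf_mem hne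
  exact T.fix_iff.2 ⟨_, le_rfl, B, hB, hc, hi⟩

theorem delta_eq (T : Tournament.{u}) (h : Fix T.Arc (n + 1)) :
    T.delta = n + 1 ↔ ¬ Fix T.Arc n := by
  constructor
  · intro h1 h2
    have := T.delta_le h2
    omega
  · intro h1
    have h2 := T.delta_le h
    have h3 : ¬ T.delta ≤ n := fun h4 => h1 ((T.fix_delta h).mono h4)
    omega

/-! ### Modules of lexicographic sums -/

theorem lexSum_arc_same (Q : Tournament.{u}) (S : Q.V → Tournament.{v}) (i : Q.V) (x y : (S i).V) :
    (Q.lexSum S).Arc ⟨i, x⟩ ⟨i, y⟩ ↔ (S i).Arc x y := by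
  simp [Sigma.lex_iff, Q.irrefl i]

theorem lexSum_arc_ne (Q : Tournament.{u}) (S : Q.V → Tournament.{v}) {i j : Q.V} (h : i ≠ j)
    (x : (S i).V) (y : (S j).V) : (Q.lexSum S).Arc ⟨i, x⟩ ⟨j, y⟩ ↔ Q.Arc i j := by
  simp [Sigma.lex_iff, h]

theorem isMod_image (Q : Tournament.{u}) (S : Q.V → Tournament.{v}) (i : Q.V) {N : Set (S i).V}
    (hN : IsMod (S i).Arc N) : IsMod (Q.lexSum S).Arc (Sigma.mk i '' N) := by
  rintro _ ⟨x, hx, rfl⟩ _ ⟨y, hy, rfl⟩ ⟨j, z⟩ hz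
  by_cases hji : j = i
  · subst hji
    rw [lexSum_arc_same, lexSum_arc_same]
    exact hN x hx y hy z fun h => hz ⟨z, h, rfl⟩
  · rw [lexSum_arc_ne _ _ hji, lexSum_arc_ne _ _ hji]

theorem disjoint_image (Q : Tournament.{u}) (S : Q.V → Tournament.{v}) {i j : Q.V} (h : i ≠ j)
    (M : Set (S i).V) (N : Set (S j).V) :
    Disjoint (Sigma.mk i '' M : Set (Q.lexSum S).V) (Sigma.mk j '' N) := by
  rw [Set.disjoint_left]
  rintro _ ⟨x, -, rfl⟩ ⟨y, -, hy⟩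
  exact h (congrArg Sigma.fst hy).symm

/-- Disjoint modules in one summand and sources or sinks outside of it. -/
theorem comodules_lexSum (Q : Tournament.{0}) (S : Q.V → Tournament.{0})
    (hV : Large (Q.lexSum S).V) (i : Q.V) {J : Type} [Fintype J] (N : J → Set (S i).V)
    (hN : ∀ j, IsMod (S i).Arc (N j)) (hn : ∀ j, (N j).Nontrivial)
    (hd : ∀ j k, j ≠ k → Disjoint (N j) (N k)) {I : Type} [Fintype I] [Nonempty I]
    (P : I → (Q.lexSum S).V) (hP : Function.Injective P) (hPi : ∀ j, (P j).1 ≠ i)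
    (hPs : ∀ j, (∀ x, x ≠ P j → (Q.lexSum S).Arc (P j) x) ∨
      ∀ x, x ≠ P j → (Q.lexSum S).Arc x (P j)) :
    Comodules (Q.lexSum S).Arc (Fintype.card I + Fintype.card J) := by
  have hPN : ∀ j k, P j ∉ (Sigma.mk i '' N k : Set (Q.lexSum S).V) := by
    rintro j k ⟨x, -, hx⟩
    exact hPi j (by rw [← hx])
  refine ⟨I ⊕ J, inferInstance, Sum.elim (fun j => {P j}) (fun j => Sigma.mk i '' N j),
    Fintype.card_sum, ?_, ?_⟩
  · rintro (j | j) (k | k) hjk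
    · simp only [Sum.elim_inl, disjoint_singleton]
      exact fun h => hjk (congrArg _ (hP h))
    · simp only [Sum.elim_inl, Sum.elim_inr, disjoint_singleton_left]
      exact hPN j k
    · simp only [Sum.elim_inl, Sum.elim_inr, disjoint_singleton_right]
      exact hPN k j
    · simp only [Sum.elim_inr]
      refine (disjoint_image_iff sigma_mk_injective).2 (hd j k fun h => hjk (congrArg _ h))
  · rintro (j | j)
    · right
      simp only [Sum.elim_inl]
      rcases hPs j with h | h
      · exact nt_compl_source hV h
      · exact (nt_rev (isTour _)).1 (nt_compl_source (r := rev (Q.lexSum S).Arc) hV h)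
    · left
      simp only [Sum.elim_inr]
      refine ⟨isMod_image Q S i (hN j), (hn j).image sigma_mk_injective, fun h => ?_⟩
      obtain ⟨l⟩ := ‹Nonempty I›
      exact hPN l j (h ▸ mem_univ _)

end Tournament

namespace TourRel
open Tournament

/-! ### Recognizing lexicographic sums -/

variable {V : Type u} {r : V → V → Prop}

/-- There is an arc-preserving map from `S` with range `W`. -/
def Onto (r : V → V → Prop) (W : Set V) (S : Tournament.{v}) : Prop :=
  ∃ g : S.V → V, (∀ i j, S.Arc i j → r (g i) (g j)) ∧ range g = W

/-- Between tournaments an arc-preserving map is automatically injective and arc-reflecting, so only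
surjectivity is needed. -/
theorem Onto.iso (ht : IsTour r) {S : Tournament.{v}} (h : Onto r univ S) :
    Nonempty (r ≃r S.Arc) := by
  obtain ⟨g, hg, hr⟩ := h
  have hinj : Function.Injective g := by
    intro i j hij
    by_contra hne
    rcases S.isTour.total hne with h | h
    · exact ht.ne (hg _ _ h) hij
    · exact ht.ne (hg _ _ h) hij.symm
  have hiff : ∀ i j, r (g i) (g j) ↔ S.Arc i j := by
    refine fun i j => ⟨fun h => ?_, hg i j⟩
    have hne : i ≠ j := by rintro rfl; exact ht.irrefl _ h
    exact (S.isTour.total hne).resolve_right fun h' => ht.asymm h (hg _ _ h')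
  exact ⟨RelIso.symm ⟨Equiv.ofBijective g ⟨hinj, range_eq_univ.1 hr⟩, fun {i j} => hiff i j⟩⟩

theorem onto_lexSum {Q : Tournament.{v}} {S : Q.V → Tournament.{w}} {W : Q.V → Set V}
    (h : ∀ i, Onto r (W i) (S i)) (hW : ∀ i j, Q.Arc i j → ∀ x ∈ W i, ∀ y ∈ W j, r x y) :
    Onto r (⋃ i, W i) (Q.lexSum S) := by
  choose g hg hr using h
  have hmem : ∀ i x, g i x ∈ W i := fun i x => hr i ▸ mem_range_self x
  refine ⟨fun x => g x.1 x.2, ?_, ?_⟩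
  · rintro ⟨i, x⟩ ⟨j, y⟩ hxy
    by_cases hij : i = j
    · subst hij
      exact hg i x y ((lexSum_arc_same Q S i x y).1 hxy)
    · exact hW i j ((lexSum_arc_ne Q S hij x y).1 hxy) _ (hmem i x) _ (hmem j y)
  · ext v
    simp only [mem_range, Sigma.exists, mem_iUnion, ← hr]

theorem onto_one (e : V) : Onto r {e} (transitive 1) :=
  ⟨fun _ => e, fun i j h => by simp [Subsingleton.elim i j] at h, range_const⟩

theorem onto_two (ht : IsTour r) {D : Finset V} (h : D.card = 2) : Onto r D (transitive 2) := by
  classical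
  have key : ∀ {x y : V}, r x y → Onto r {x, y} (transitive 2) := by
    intro x y hxy
    refine ⟨![x, y], ?_, by simp [Matrix.range_cons, pair_comm]⟩
    intro i j hij
    fin_cases i <;> fin_cases j <;> simp_all
  obtain ⟨x, y, hne, rfl⟩ := Finset.card_eq_two.1 h
  rw [Finset.coe_pair]
  rcases ht.total hne with h | h
  · exact key h
  · rw [pair_comm]
    exact key h

theorem onto_C3 {x y z : V} (hxy : r x y) (hyz : r y z) (hzx : r z x) :
    Onto r {x, y, z} C3 := by
  refine ⟨![x, y, z], ?_, ?_⟩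
  · rintro i j (⟨rfl, rfl⟩ | ⟨rfl, rfl⟩ | ⟨rfl, rfl⟩)
    · exact hxy
    · exact hyz
    · exact hzx
  · simp only [Matrix.range_cons, Matrix.range_empty, union_empty]
    rfl

/-- The tournament induced on the vertices `g i`. -/
@[reducible] def pull (ht : IsTour r) {m : ℕ} (g : Fin m ↪ V) : Tournament.{0} where
  V := Fin m
  finite := inferInstance
  Arc i j := r (g i) (g j)
  irrefl _ := ht.irrefl _
  arc_iff _ _ h := ht.iff_not _ _ fun h' => h (g.injective h')

/-- All arcs between two disjoint modules go the same way, so the representatives `g i` determine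
the quotient. -/
theorem Blocks.onto {W R : Finset V} {E : V → Finset V} (ht : IsTour r) (hB : Blocks r W R E)
    {m : ℕ} (g : Fin m ↪ V) (hg : ∀ a, a ∈ R ↔ ∃ i, g i = a) (S : Fin m → Tournament.{0})
    (hS : ∀ i, Onto r (E (g i)) (S i)) : Onto r W ((pull ht g).lexSum S) := by
  have hgR : ∀ i, g i ∈ R := fun i => (hg _).2 ⟨i, rfl⟩
  have h := onto_lexSum (r := r) (Q := pull ht g) (W := fun i => (E (g i) : Set V)) hS ?_
  · convert h
    ext x
    rw [Finset.mem_coe, hB.cover x, mem_iUnion]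
    constructor
    · rintro ⟨a, ha, hx⟩
      obtain ⟨i, rfl⟩ := (hg a).1 ha
      exact ⟨i, hx⟩
    · rintro ⟨i, hx⟩
      exact ⟨g i, hgR i, hx⟩
  · intro i j hij x hx y hy
    have hd := Finset.disjoint_left.1 (hB.disj _ (hgR i) _ (hgR j) (ht.ne hij))
    have hyi : y ∉ (E (g i) : Set V) := fun h => hd h hy
    have hgj : g i ∉ (E (g j) : Set V) := fun h => hd (hB.mem _ (hgR i)) h
    rw [(hB.isMod _ (hgR i)).out ht hx (hB.mem _ (hgR i)) hyi]
    exact (hB.isMod _ (hgR j) y hy _ (hB.mem _ (hgR j)) _ hgj).2 hij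

theorem exists_enum (R : Finset V) {m : ℕ} (h : R.card = m) :
    ∃ g : Fin m ↪ V, ∀ a, a ∈ R ↔ ∃ i, g i = a := by
  subst h
  refine ⟨R.equivFin.symm.toEmbedding.trans (Function.Embedding.subtype _), fun a => ?_⟩
  constructor
  · intro ha
    exact ⟨R.equivFin ⟨a, ha⟩, by simp⟩
  · rintro ⟨i, rfl⟩
    simp

theorem Blocks.onto_lexProd {W R : Finset V} {E : V → Finset V} (ht : IsTour r)
    (hB : Blocks r W R E) {m : ℕ} (hm : R.card = m) (h2 : ∀ a ∈ R, (E a).card = 2) :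
    ∃ U : Tournament.{0}, U.card = m ∧ Onto r W (U.lexProd (transitive 2)) := by
  obtain ⟨g, hg⟩ := exists_enum R hm
  exact ⟨pull ht g, by simp [Tournament.card],
    hB.onto ht g hg _ fun i => onto_two ht (h2 _ ((hg _).2 ⟨i, rfl⟩))⟩

theorem Blocks.onto_lexSumFirst {W R : Finset V} {E : V → Finset V} (ht : IsTour r)
    (hB : Blocks r W R E) {m : ℕ} (hm : R.card = m) {a : V} (ha : a ∈ R)
    (h2 : ∀ c ∈ R, c ≠ a → (E c).card = 2) {H : Tournament.{0}} (hH : Onto r (E a) H) :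
    ∃ (U : Tournament.{0}) (i : U.V), U.card = m ∧
      Onto r W (U.lexSumFirst i H (transitive 2)) := by
  obtain ⟨g, hg⟩ := exists_enum R hm
  obtain ⟨i, rfl⟩ := (hg a).1 ha
  refine ⟨pull ht g, i, by simp [Tournament.card], hB.onto ht g hg _ fun j => ?_⟩
  split_ifs with h
  · subst h
    exact hH
  · exact onto_two ht (h2 _ ((hg _).2 ⟨j, rfl⟩) fun h' => h (g.injective h'))

/-- A source followed by `H`. -/
theorem onto_source {e : V} {W : Set V} (hs : ∀ x, x ≠ e → r e x) (hW : ∀ x, x ∈ W ↔ x ≠ e)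
    {H : Tournament.{0}} (hH : Onto r W H) :
    Onto r univ ((transitive 2).lexSum ![transitive 1, H]) := by
  have h := onto_lexSum (r := r) (Q := transitive 2) (S := ![transitive 1, H])
    (W := ![{e}, W]) ?_ ?_
  · convert h
    symm
    refine eq_univ_of_forall fun x => mem_iUnion.2 ?_
    by_cases hx : x = e
    · exact ⟨0, hx⟩
    · exact ⟨1, (hW x).2 hx⟩
  · exact Fin.forall_fin_two.2 ⟨onto_one e, hH⟩
  · intro i j hij x hx y hy
    fin_cases i <;> fin_cases j <;> simp at hij
    rw [show x = e from hx]
    exact hs y ((hW y).1 hy)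

/-- A source followed by `H` followed by a sink. -/
theorem onto_source_sink {s t : V} {W : Set V} (hst : s ≠ t) (hs : ∀ x, x ≠ s → r s x)
    (hk : ∀ x, x ≠ t → r x t) (hW : ∀ x, x ∈ W ↔ x ≠ s ∧ x ≠ t) {H : Tournament.{0}}
    (hH : Onto r W H) :
    Onto r univ ((transitive 3).lexSum ![transitive 1, H, transitive 1]) := by
  have h := onto_lexSum (r := r) (Q := transitive 3) (S := ![transitive 1, H, transitive 1])
    (W := ![{s}, W, {t}]) ?_ ?_
  · convert h
    symm
    refine eq_univ_of_forall fun x => mem_iUnion.2 ?_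
    by_cases hx : x = s
    · exact ⟨0, hx⟩
    by_cases hx' : x = t
    · exact ⟨2, hx'⟩
    · exact ⟨1, (hW x).2 ⟨hx, hx'⟩⟩
  · intro i
    fin_cases i
    · exact onto_one s
    · exact hH
    · exact onto_one t
  · intro i j hij x hx y hy
    fin_cases i <;> fin_cases j <;> simp at hij
    · rw [show x = s from hx]
      exact hs y ((hW y).1 hy).1
    · rw [show x = s from hx, show y = t from hy]
      exact hs t hst.symm
    · rw [show y = t from hy]
      exact hk x ((hW x).1 hx).2

end TourRel

/-! ### The three forms and the theorem -/

open Set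
namespace Tournament
open TourRel
variable {n : ℕ}

theorem nontrivial_fiber (U : Tournament.{0}) (S : U.V → Tournament.{0}) (u : U.V)
    (h : Nontrivial (S u).V) : (Sigma.mk u '' univ : Set (U.lexSum S).V).Nontrivial :=
  nontrivial_univ.image sigma_mk_injective

theorem comodules_source (U : Tournament.{0}) (S : U.V → Tournament.{0})
    (hV : Large ((transitive 2).lexSum ![transitive 1, U.lexSum S]).V) {J : Type} [Fintype J]
    (f : J ↪ U.V) (hf : ∀ j, Nontrivial (S (f j)).V) :
    Comodules ((transitive 2).lexSum ![transitive 1, U.lexSum S]).Arc (1 + Fintype.card J) := by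
  have h := comodules_lexSum (transitive 2) ![transitive 1, U.lexSum S] hV (1 : Fin 2)
    (fun j => (Sigma.mk (f j) '' univ : Set (U.lexSum S).V))
    (fun j => isMod_image U S (f j) isMod_univ) (fun j => nontrivial_fiber U S (f j) (hf j))
    (fun j k hjk => disjoint_image U S (fun h => hjk (f.injective h)) _ _)
    (fun _ : Unit => ⟨(0 : Fin 2), (0 : Fin 1)⟩) (fun _ _ _ => rfl) (fun _ => Fin.zero_ne_one)
    (fun _ => Or.inl ?_)
  · simpa using h
  · rintro ⟨i, x⟩ hx
    by_cases hi : i = 0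
    · subst hi
      exact (hx (congrArg (Sigma.mk 0) (Subsingleton.elim (α := Fin 1) x 0))).elim
    · exact (lexSum_arc_ne _ _ (Ne.symm hi) _ _).2 (Fin.pos_of_ne_zero hi)

theorem comodules_source_sink (U : Tournament.{0}) (S : U.V → Tournament.{0})
    (hV : Large ((transitive 3).lexSum ![transitive 1, U.lexSum S, transitive 1]).V) {J : Type}
    [Fintype J] (f : J ↪ U.V) (hf : ∀ j, Nontrivial (S (f j)).V) :
    Comodules ((transitive 3).lexSum ![transitive 1, U.lexSum S, transitive 1]).Arc
      (2 + Fintype.card J) := by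
  have h := comodules_lexSum (transitive 3) ![transitive 1, U.lexSum S, transitive 1] hV
    (1 : Fin 3)
    (fun j => (Sigma.mk (f j) '' univ : Set (U.lexSum S).V))
    (fun j => isMod_image U S (f j) isMod_univ) (fun j => nontrivial_fiber U S (f j) (hf j))
    (fun j k hjk => disjoint_image U S (fun h => hjk (f.injective h)) _ _)
    (fun b : Bool => bif b then ⟨(0 : Fin 3), (0 : Fin 1)⟩ else ⟨(2 : Fin 3), (0 : Fin 1)⟩) ?_ ?_ ?_
  · simpa using h
  · rintro (_ | _) (_ | _) hbc
    · rfl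
    · exact absurd (congrArg Sigma.fst hbc) (show ¬ (2 : Fin 3) = 0 by decide)
    · exact absurd (congrArg Sigma.fst hbc) (show ¬ (0 : Fin 3) = 2 by decide)
    · rfl
  · rintro (_ | _)
    · exact show (2 : Fin 3) ≠ 1 by decide
    · exact show (0 : Fin 3) ≠ 1 by decide
  · rintro (_ | _)
    · right
      rintro ⟨i, x⟩ hx
      by_cases hi : i = 2
      · subst hi
        exact (hx (congrArg (Sigma.mk 2) (Subsingleton.elim (α := Fin 1) x 0))).elim
      · exact (lexSum_arc_ne _ _ hi _ _).2 ((by decide : ∀ i : Fin 3, i ≠ 2 → i < 2) i hi)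
    · left
      rintro ⟨i, x⟩ hx
      by_cases hi : i = 0
      · subst hi
        exact (hx (congrArg (Sigma.mk 0) (Subsingleton.elim (α := Fin 1) x 0))).elim
      · exact (lexSum_arc_ne _ _ (Ne.symm hi) _ _).2 (Fin.pos_of_ne_zero hi)

theorem large_of_relIso {T : Tournament.{u}} {M : Tournament.{v}} (hn : 1 ≤ n)
    (hT : T.card = 4 * n + 1) (e : T.Arc ≃r M.Arc) : Large M.V := by
  refine large_of_card ?_
  rw [← Nat.card_congr e.toEquiv]
  have : Nat.card T.V = 4 * n + 1 := hT
  omega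

theorem not_fix_of_comodules {T : Tournament.{u}} {M : Tournament.{v}} (e : T.Arc ≃r M.Arc)
    (h : Comodules M.Arc (2 * n + 1)) : ¬ Fix T.Arc n := fun hf => by
  have := (h.of_iso e).le_of_fix T.isTour hf
  omega

theorem comodules_pairs (U : Tournament.{0}) (hU : U.card = 2 * n)
    (hV : Large ((transitive 2).lexSum ![transitive 1, U.lexProd (transitive 2)]).V) :
    Comodules ((transitive 2).lexSum ![transitive 1, U.lexProd (transitive 2)]).Arc
      (2 * n + 1) := by
  have := Fintype.ofFinite U.V
  have h := comodules_source U _ hV (Function.Embedding.refl U.V) fun _ =>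
    (inferInstance : Nontrivial (Fin 2))
  rw [← Nat.card_eq_fintype_card] at h
  convert h using 1
  have : Nat.card U.V = 2 * n := hU
  omega

theorem relIso_dual {T : Tournament.{u}} {M : Tournament.{v}} :
    Nonempty (rev T.Arc ≃r M.Arc) ↔ Nonempty (T.Arc ≃r M.dual.Arc) :=
  ⟨fun ⟨e⟩ => ⟨⟨e.toEquiv, fun {a b} => e.map_rel_iff (a := b) (b := a)⟩⟩,
    fun ⟨e⟩ => ⟨⟨e.toEquiv, fun {a b} => e.map_rel_iff (a := b) (b := a)⟩⟩⟩

theorem not_fix_of_form (hn : 1 ≤ n) (T : Tournament.{u}) (hT : T.card = 4 * n + 1)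
    (h : (∃ U : Tournament.{0}, U.card = 2 * n ∧
        (T.Iso ((transitive 2).lexSum ![transitive 1, U.lexProd (transitive 2)]) ∨
          T.Iso ((transitive 2).lexSum ![transitive 1, U.lexProd (transitive 2)]).dual)) ∨
      (∃ (U : Tournament.{0}) (a : U.V), U.card = 2 * n ∧
        T.Iso ((transitive 3).lexSum ![transitive 1,
          U.lexSumFirst a (transitive 1) (transitive 2), transitive 1])) ∨
      (∃ (U : Tournament.{0}) (a : U.V), U.card = 2 * n - 1 ∧
        T.Iso ((transitive 3).lexSum ![transitive 1,
          U.lexSumFirst a C3 (transitive 2), transitive 1]))) : ¬ Fix T.Arc n := by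
  classical
  rcases h with ⟨U, hU, h | h⟩ | ⟨U, a, hU, ⟨e⟩⟩ | ⟨U, a, hU, ⟨e⟩⟩
  · obtain ⟨e⟩ := h
    exact not_fix_of_comodules e (comodules_pairs U hU (large_of_relIso hn hT e))
  · obtain ⟨e⟩ := h
    have hV := large_of_relIso hn hT e
    have h := comodules_pairs U hU hV
    exact not_fix_of_comodules e (Comodules.of_rev (isTour _) h)
  -- The one-vertex fibre over a is dropped. This leaves 2n-1 pairs, which with the source and the
  -- sink give 2n+1 sets.
  · have := Fintype.ofFinite U.V
    have h := comodules_source_sink U _ (large_of_relIso hn hT e)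
      (Function.Embedding.subtype fun u => u ≠ a) fun j => by
        have h1 : (if (j : U.V) = a then transitive 1 else transitive 2) = transitive 2 := if_neg j.2
        rw [Function.Embedding.subtype_apply, h1]
        exact (inferInstance : Nontrivial (Fin 2))
    refine not_fix_of_comodules e ?_
    convert h using 1
    have h1 : Fintype.card U.V = 2 * n := by rw [← Nat.card_eq_fintype_card]; exact hU
    have h2 := Fintype.card_subtype_compl (fun u : U.V => u = a)
    rw [Fintype.card_subtype_eq, h1] at h2
    simp only [ne_eq]
    omega
  -- Here all 2n-1 fibres count, the 3-cycle being one of them.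
  · have := Fintype.ofFinite U.V
    have h := comodules_source_sink U _ (large_of_relIso hn hT e)
      (Function.Embedding.refl U.V) fun j => by
        simp only [Function.Embedding.refl_apply]
        split_ifs
        · exact (inferInstance : Nontrivial (Fin 3))
        · exact (inferInstance : Nontrivial (Fin 2))
    refine not_fix_of_comodules e ?_
    convert h using 1
    have h1 : Fintype.card U.V = 2 * n - 1 := by rw [← Nat.card_eq_fintype_card]; exact hU
    omega

theorem iso_of_formPairs (T : Tournament.{u}) (h : FormPairs T.Arc n) :
    ∃ U : Tournament.{0}, U.card = 2 * n ∧
      (T.Iso ((transitive 2).lexSum ![transitive 1, U.lexProd (transitive 2)]) ∨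
        T.Iso ((transitive 2).lexSum ![transitive 1, U.lexProd (transitive 2)]).dual) := by
  obtain ⟨e, W, R, E, hs | hs, hW, hB, hR, h2⟩ := h
  · obtain ⟨U, hU, h⟩ := hB.onto_lexProd T.isTour hR h2
    exact ⟨U, hU, Or.inl ((onto_source hs hW h).iso T.isTour)⟩
  · have hB' : Blocks (rev T.Arc) W R E :=
      ⟨hB.mem, fun a ha => (isMod_rev T.isTour).2 (hB.isMod a ha), hB.disj, hB.cover⟩
    obtain ⟨U, hU, h⟩ := hB'.onto_lexProd T.isTour.rev hR h2
    exact ⟨U, hU, Or.inr (relIso_dual.1 ((onto_source hs hW h).iso T.isTour.rev))⟩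

theorem iso_of_formOdd (T : Tournament.{u}) (hV : Large T.V) (h : FormOdd T.Arc n) :
    (∃ (U : Tournament.{0}) (a : U.V), U.card = 2 * n ∧
        T.Iso ((transitive 3).lexSum ![transitive 1,
          U.lexSumFirst a (transitive 1) (transitive 2), transitive 1])) ∨
      (∃ (U : Tournament.{0}) (a : U.V), U.card = 2 * n - 1 ∧
        T.Iso ((transitive 3).lexSum ![transitive 1,
          U.lexSumFirst a C3 (transitive 2), transitive 1])) := by
  obtain ⟨s, t, W, R, E, hs, hk, hW, hB, a, ha, h2, h3⟩ := h
  have hst : s ≠ t := by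
    rintro rfl
    obtain ⟨z, hz, -⟩ := hV s s s s
    exact T.isTour.asymm (hs z hz) (hk z hz)
  rcases h3 with ⟨hR, h1⟩ | ⟨hR, x, y, z, hE, hxy, hyz, hzx⟩
  · obtain ⟨w, hw⟩ := Finset.card_eq_one.1 h1
    obtain ⟨U, i, hU, h⟩ := hB.onto_lexSumFirst T.isTour hR ha h2 (H := transitive 1) (by
      rw [hw, Finset.coe_singleton]
      exact onto_one w)
    exact Or.inl ⟨U, i, hU, (onto_source_sink hst hs hk hW h).iso T.isTour⟩
  · obtain ⟨U, i, hU, h⟩ := hB.onto_lexSumFirst T.isTour hR ha h2 (H := C3) (by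
      rw [hE]
      exact onto_C3 hxy hyz hzx)
    exact Or.inr ⟨U, i, hU, (onto_source_sink hst hs hk hW h).iso T.isTour⟩

theorem card_lexSum_pairs (U : Tournament.{0}) (hU : U.card = 2 * n) :
    ((transitive 2).lexSum ![transitive 1, U.lexProd (transitive 2)]).card = 4 * n + 1 := by
  have := Fintype.ofFinite U.V
  have h1 : Nat.card (Σ _ : U.V, Fin 2) = 4 * n := by
    have : Nat.card U.V = 2 * n := hU
    rw [Nat.card_sigma]
    simp only [Nat.card_eq_fintype_card, Fintype.card_fin, Finset.sum_const, smul_eq_mul,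
      Finset.card_univ] at this ⊢
    omega
  have h2 : ((transitive 2).lexSum ![transitive 1, U.lexProd (transitive 2)]).card =
      ∑ i : Fin 2, Nat.card ((![transitive 1, U.lexProd (transitive 2)] : Fin 2 → Tournament) i).V :=
    Nat.card_sigma
  rw [h2, Fin.sum_univ_two]
  have h3 : Nat.card (Fin 1) = 1 := by simp
  exact (congrArg₂ (· + ·) h3 h1).trans (add_comm _ _)

theorem fix_succ (hn : 1 ≤ n) (T : Tournament.{u}) (hT : T.card = 4 * n + 1) :
    Fix T.Arc (n + 1) :=
  (fix_and_forms T.isTour (large_of_relIso hn hT (RelIso.refl _)) hn hT).1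

theorem maxDelta_eq (hn : 1 ≤ n) : maxDelta (4 * n + 1) = n + 1 := by
  obtain ⟨⟨U, hU, hd⟩, hub⟩ := isGreatest_maxDelta (4 * n + 1)
  refine le_antisymm ?_ ?_
  · rw [← hd]
    exact U.delta_le (fix_succ hn U hU)
  -- Any tournament of one of the forms attains the maximum; F1 over a transitive quotient is used
  -- as witness.
  · have hc : (transitive (2 * n)).card = 2 * n := by simp [card]
    have hM := card_lexSum_pairs _ hc
    refine hub ⟨_, hM, (delta_eq _ (fix_succ hn _ hM)).2 ?_⟩
    exact not_fix_of_form hn _ hM (Or.inl ⟨_, hc, Or.inl ⟨RelIso.refl _⟩⟩)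

end Tournament

theorem theorem6p2 (n : ℕ) (hn : 1 ≤ n) (T : Tournament.{u}) (hT : T.card = 4 * n + 1) :
    T.DeltaMaximal ↔
      (∃ U : Tournament.{0}, U.card = 2 * n ∧
        (T.Iso ((Tournament.transitive 2).lexSum
            ![Tournament.transitive 1, U.lexProd (Tournament.transitive 2)]) ∨
          T.Iso ((Tournament.transitive 2).lexSum
            ![Tournament.transitive 1, U.lexProd (Tournament.transitive 2)]).dual)) ∨
      (∃ (U : Tournament.{0}) (a : U.V), U.card = 2 * n ∧
        T.Iso ((Tournament.transitive 3).lexSum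
          ![Tournament.transitive 1,
            U.lexSumFirst a (Tournament.transitive 1) (Tournament.transitive 2),
            Tournament.transitive 1])) ∨
      (∃ (U : Tournament.{0}) (a : U.V), U.card = 2 * n - 1 ∧
        T.Iso ((Tournament.transitive 3).lexSum
          ![Tournament.transitive 1,
            U.lexSumFirst a Tournament.C3 (Tournament.transitive 2),
            Tournament.transitive 1])) := by
  open Tournament TourRel in
  rw [DeltaMaximal, hT, maxDelta_eq hn, T.delta_eq (fix_succ hn T hT)]
  refine ⟨fun h => ?_, not_fix_of_form hn T hT⟩
  have hV := large_of_relIso hn hT (RelIso.refl T.Arc)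
  rcases (fix_and_forms T.isTour hV hn hT).2 h with h | h
  · exact Or.inl (T.iso_of_formPairs h)
  · exact Or.inr (T.iso_of_formOdd hV h)
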